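/- Let $f(x)=\ln(1+|x|)$, applied entrywise to vectors, and for $x\in\mathbb R^{d+1}$ let $g(x)=(f(x_{1:d}),x_{d+1})\in\mathbb R^{d+1}$. Let $A\in\mathbb R^{n\times d}$ and $b\in\mathbb R^n$ be not both zero, let $Q=(A\ \ b)\in\mathbb R^{n\times(d+1)}$ have rows $Q_i=(A_i,b_i)$, and let $M=\sum_i\|g(Q_i)\|_2^2$. **The algorithm (H-Sketch sampling with transform $g$).** The input is $Q$, $\epsilon>0$, $K\ge 1$ and a number $\widehat M$ with $M\le\widehat M\le KM$. Put $L=\lceil\log_2(Kn/\epsilon)\rceil$, $\hat L=\lceil\log_2 n\rceil$, $j_0=\lceil\log_2(4K\epsilon^{-3}L^3)\rceil$ and $\delta=1/(\hat L+1)$. *Sketch.* For $\ell=0,\dots,\hat L$, let $Q^{(\ell)}$ be obtained from $Q$ by keeping each row independently with probability $2^{-\ell}$ and replacing the other rows by $0$. The structure $\mathcal D_\ell$ consists of $R=O(\log(2n/\delta))$ independent repetitions of the following: a pairwise independent uniform hash function $h:[n]\to[w]$, with $w=O(1/(\phi^2\nu^3))$; independently, $4$-wise independent uniform random signs $\sigma_1,\dots,\sigma_n$;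 and the buckets $H_v=\sum_{i:\,h(i)=v}\sigma_iQ^{(\ell)}_i$ for $v\in[w]$. Here $\nu=O(1)$, $0<\nu\le 1/20$, and $\phi=O(\epsilon^3/(KL^3))$ for $\ell=0$, $\phi=O(\epsilon^3/L^3)$ for $\ell\ge1$. Hash functions and signs are independent of the row sampling. The query $\mathrm{Query}_\ell(i)$ returns, of the $R$ buckets to which $i$ is hashed, the one with median value of $\|g(\cdot)\|_2$. Put $\lambda^{(\ell)}_i=\|g(\mathrm{Query}_\ell(i))\|_2^2$ and let $\Lambda_\ell$ be the set of the $\Theta(L^3/\epsilon^3)$ indices $i$ with largest $\lambda_i^{(\ell)}$. Let $\zeta$ be uniform on $[1/2,1]$, independent of everything else. No assumption is made on how different structures $\mathcal D_\ell$ depend on each other. *Levels.* For $j=0,1,\dots,L$ let $W_{j,\ell}$ be the set of $i\in\Lambda_\ell$ with $\lambda^{(\ell)}_i\in\left[(1+\epsilon)\zeta\widehat M/2^j,\ (2-\epsilon)\zeta\widehat M/2^j\right]$. If $j\le j_0$ put $\ell(j)=0$; if $j>j_0$ let $\ell(j)$ be the largest $\ell\in\{0,\dots,\hat L\}$ with $(1-\sqrt{20}\epsilon)L^2/\epsilon^2\le|W_{j,\ell}|\le2(1+\sqrt{20}\epsilon)L^2/\epsilon^2$,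 if there is one. Put $\widetilde M_j=2^{\ell(j)}\sum_{i\in W_{j,\ell(j)}}\lambda_i^{(\ell(j))}$, and $\widetilde M_j=0$ if $\ell(j)$ does not exist. *Output.* Sample $j^*\in\{0,\dots,L\}$ with probability proportional to $\widetilde M_j$, then $i^*\in W_{j^*,\ell(j^*)}$ with probability proportional to $\lambda_i^{(\ell(j^*))}$, and return $H=\mathrm{Query}_{\ell(j^*)}(i^*)$. If all $\widetilde M_j$ vanish, the algorithm fails. **Theorem.** There are absolute constants in the $O(\cdot)$ and $\Theta(\cdot)$ of the algorithm and an absolute constant $C>0$ such that for every $K\ge1$ the following holds for all sufficiently small $\epsilon>0$ (that is, $0<\epsilon\le\epsilon_0(K)$) and for all $n,d,A,b,\widehat M$ as above: with probability at least $0.9$, over all random choices, the algorithm does not fail and there exists $u\in[n]$ such that $$(1-C\epsilon)\left(\|f(A_u)\|_2^2+|b_u|^2\right)\le\|g(H)\|_2^2\le(1+C\epsilon)\left(\|f(A_u)\|_2^2+|b_u|^2\right).$$ -/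

import Mathlib

open MeasureTheory ProbabilityTheory
open scoped ENNReal

noncomputable section

namespace HSketch

/-! ### The entrywise transformations -/

/-- `f(x) = ln(1 + |x|)`. -/
def f (x : ℝ) : ℝ := Real.log (1 + |x|)

/-- `f` applied to each entry of a vector; the result carries the Euclidean norm. -/
def fVec {d : ℕ} (x : Fin d → ℝ) : EuclideanSpace ℝ (Fin d) :=
  WithLp.toLp 2 fun t => f (x t)

/-- `g(x) = (f(x_{1:d}), x_{d+1})`; the result carries the Euclidean norm. -/
def g {d : ℕ} (x : Fin (d + 1) → ℝ) : EuclideanSpace ℝ (Fin (d + 1)) :=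
  WithLp.toLp 2 (Fin.snoc (α := fun _ => ℝ) (fun t : Fin d => f (x t.castSucc)) (x (Fin.last d)))

/-- The concatenated matrix `(A b)`. -/
def concat {n d : ℕ} (A : Matrix (Fin n) (Fin d) ℝ) (b : Fin n → ℝ) :
    Matrix (Fin n) (Fin (d + 1)) ℝ :=
  Matrix.of fun i => Fin.snoc (α := fun _ => ℝ) (A i) (b i)

/-- `M = ∑ i, ‖T(B_i)‖²`, the squared Frobenius norm of the transformed matrix. -/
def mass {n m : ℕ} (T : (Fin m → ℝ) → EuclideanSpace ℝ (Fin m))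
    (B : Matrix (Fin n) (Fin m) ℝ) : ℝ :=
  ∑ i, ‖T (B i)‖ ^ 2

/-! ### The heavy hitter structures -/

/-- Bucket `v` of the basic structure: `∑_{i ∈ h⁻¹(v)} ε_i B_i`. -/
def bucket {n m w : ℕ} (B : Matrix (Fin n) (Fin m) ℝ) (h : Fin n → Fin w) (s : Fin n → ℤˣ)
    (v : Fin w) : Fin m → ℝ :=
  fun t => ∑ i with h i = v, ((s i : ℤ) : ℝ) * B i t

/-- The index of the (lower) median of the numbers `x r`. -/
def medianIndex {R : ℕ} (hR : 0 < R) (x : Fin R → ℝ) : Fin R :=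
  Tuple.sort x ⟨(R - 1) / 2, by omega⟩

/-- The answer of the complete structure (`R` basic structures) to the query `i`: of the `R`
vectors in the buckets to which `i` is hashed, the one whose transformed norm is the median. -/
def query {n m w R : ℕ} (T : (Fin m → ℝ) → EuclideanSpace ℝ (Fin m))
    (B : Matrix (Fin n) (Fin m) ℝ) (h : Fin R → Fin n → Fin w) (s : Fin R → Fin n → ℤˣ)
    (i : Fin n) : Fin m → ℝ :=
  if hR : 0 < R then
    bucket B (h (medianIndex hR fun r => ‖T (bucket B (h r) (s r) (h r i))‖))
      (s (medianIndex hR fun r => ‖T (bucket B (h r) (s r) (h r i))‖))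
      (h (medianIndex hR fun r => ‖T (bucket B (h r) (s r) (h r i))‖) i)
  else 0

/-- The indices of the `k` largest values of `x` (ties are broken in favour of small indices;
all indices if there are at most `k`). -/
def topIndices {n : ℕ} (k : ℕ) (x : Fin n → ℝ) : Finset (Fin n) :=
  {i | Finset.card {i' : Fin n | x i < x i' ∨ (x i' = x i ∧ i' < i)} < k}

/-! ### Parameters of the sampling algorithm -/

/-- The constants hidden in the `O(·)` and `Θ(·)` of the algorithm. -/
structure Constants where
  /-- the number of buckets is `cw / (φ²ν³)` -/
  cw : ℝ
  /-- the number of repetitions is `cR log(2n/δ)` -/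
  cR : ℝ
  /-- the accuracy parameter `ν = O(1)` of the heavy hitter structures -/
  ν : ℝ
  /-- `φ = cφ₀ ε³/(KL³)` in the structure for the full matrix -/
  cφ₀ : ℝ
  /-- `φ = cφ ε³/L³` in the structures for the downsampled matrices -/
  cφ : ℝ
  /-- the `cΛ L³/ε³` heaviest hitters of each structure are used -/
  cΛ : ℝ
  cw_pos : 0 < cw
  cR_pos : 0 < cR
  ν_pos : 0 < ν
  ν_le : ν ≤ 1 / 20
  cφ₀_pos : 0 < cφ₀
  cφ_pos : 0 < cφ
  cΛ_pos : 0 < cΛ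

/-- `L = log(Kn/ε)`, the index of the last level. -/
def levels (K ε : ℝ) (n : ℕ) : ℕ := ⌈Real.logb 2 (K * n / ε)⌉₊

/-- `L̂ = log n`, the number of downsampled structures. -/
def rates (n : ℕ) : ℕ := ⌈Real.logb 2 n⌉₊

/-- `j₀ = log(4Kε⁻³L³)`, the last level that is read off the full matrix. -/
def lastHeavyLevel (K ε : ℝ) (n : ℕ) : ℕ :=
  ⌈Real.logb 2 (4 * K * (levels K ε n : ℝ) ^ 3 / ε ^ 3)⌉₊

/-- The heaviness parameter `φ` of the `ℓ`-th structure. -/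
def phi (c : Constants) (K ε : ℝ) (n : ℕ) (ℓ : Fin (rates n + 1)) : ℝ :=
  if ℓ = 0 then c.cφ₀ * ε ^ 3 / (K * (levels K ε n : ℝ) ^ 3)
  else c.cφ * ε ^ 3 / (levels K ε n : ℝ) ^ 3

/-- The number of buckets `w = O(1/(φ²ν³))` of the `ℓ`-th structure. -/
def width (c : Constants) (K ε : ℝ) (n : ℕ) (ℓ : Fin (rates n + 1)) : ℕ :=
  ⌈c.cw / (phi c K ε n ℓ ^ 2 * c.ν ^ 3)⌉₊

/-- The number of repetitions `R = O(log(n/δ))`, where `δ = 1/(L̂ + 1)`. -/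
def reps (c : Constants) (n : ℕ) : ℕ :=
  ⌈c.cR * Real.log (2 * n / (1 / ((rates n : ℝ) + 1)))⌉₊

/-- The number `Θ(L³/ε³)` of heavy hitters taken from each structure. -/
def topSize (c : Constants) (K ε : ℝ) (n : ℕ) : ℕ :=
  ⌈c.cΛ * (levels K ε n : ℝ) ^ 3 / ε ^ 3⌉₊

/-! ### The randomness of the sketch -/

/-- A realisation of the random choices made by the sketch (the final sampling step excepted). -/
structure Seed (c : Constants) (K ε : ℝ) (n : ℕ) where
  /-- does row `i` survive in the matrix downsampled at rate `2⁻ℓ`? -/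
  keep : Fin (rates n + 1) → Fin n → Bool
  /-- the hash functions of the `ℓ`-th structure -/
  hash : (ℓ : Fin (rates n + 1)) → Fin (reps c n) → Fin n → Fin (width c K ε n ℓ)
  /-- the random signs of the `ℓ`-th structure -/
  sign : Fin (rates n + 1) → Fin (reps c n) → Fin n → ℤˣ
  /-- the random shift of the levels -/
  ζ : ℝ

/-- The values of the random function `X` at any `k` distinct points are independent and
uniformly distributed. -/
def KWiseIndependent {Ω ι β : Type*} [MeasurableSpace Ω] [Fintype β] (k : ℕ) (μ : Measure Ω)
    (X : Ω → ι → β) : Prop :=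
  ∀ s : Finset ι, s.card ≤ k → ∀ y : ι → β,
    μ {ω | ∀ i ∈ s, X ω i = y i} = (Fintype.card β : ℝ≥0∞)⁻¹ ^ s.card

/-- The joint law of the random choices of the sketch. Within each of the structures the
downsampling, the hash functions and the signs of all the repetitions are independent, and `ζ` is
independent of all of these; how different structures depend on each other does not matter (so
that both nested and independent downsampling are covered). -/
structure IsRandomSeed {Ω : Type*} [MeasurableSpace Ω] {c : Constants} {K ε : ℝ} {n : ℕ}
    (μ : Measure Ω) (S : Ω → Seed c K ε n) : Prop where
  measurable_keep : ∀ ℓ, Measurable fun ω => (S ω).keep ℓ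
  measurable_hash : ∀ ℓ r, Measurable fun ω => (S ω).hash ℓ r
  measurable_sign : ∀ ℓ r, Measurable fun ω => (S ω).sign ℓ r
  measurable_ζ : Measurable fun ω => (S ω).ζ
  /-- at rate `2⁻ℓ` each row survives with probability `2⁻ℓ` … -/
  keep_prob : ∀ ℓ i, μ {ω | (S ω).keep ℓ i = true} = (2 : ℝ≥0∞)⁻¹ ^ (ℓ : ℕ)
  /-- … independently of the other rows -/
  keep_indep : ∀ ℓ, iIndepFun (fun i ω => (S ω).keep ℓ i) μ
  hash_pairwise : ∀ ℓ r, KWiseIndependent 2 μ fun ω => (S ω).hash ℓ r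
  sign_fourwise : ∀ ℓ r, KWiseIndependent 4 μ fun ω => (S ω).sign ℓ r
  hash_indep_sign : ∀ ℓ r, IndepFun (fun ω => (S ω).hash ℓ r) (fun ω => (S ω).sign ℓ r) μ
  reps_indep : ∀ ℓ, iIndepFun (fun r ω => ((S ω).hash ℓ r, (S ω).sign ℓ r)) μ
  keep_indep_sketch : ∀ ℓ,
    IndepFun (fun ω => (S ω).keep ℓ) (fun ω => ((S ω).hash ℓ, (S ω).sign ℓ)) μ
  ζ_uniform : pdf.IsUniform (fun ω => (S ω).ζ) (Set.Icc (1 / 2) 1) μ volume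
  ζ_indep : IndepFun (fun ω => (S ω).ζ) (fun ω => ((S ω).keep, (S ω).hash, (S ω).sign)) μ

/-! ### The sampling algorithm -/

/-- Pick `a` with probability proportional to `wt a` (weights are nonnegative); `none` (failure)
if all the weights vanish. -/
def pick {α : Type} [Fintype α] (wt : α → ℝ) : PMF (Option α) :=
  if h : ∑ a, ENNReal.ofReal (wt a) = 0 then PMF.pure none
  else (PMF.normalize (fun a => ENNReal.ofReal (wt a)) (by rwa [tsum_fintype])
    (by rw [tsum_fintype]; exact ENNReal.sum_ne_top.2 fun _ _ => ENNReal.ofReal_ne_top)).map some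

section Algorithm

variable {c : Constants} {K ε : ℝ} {n m : ℕ} (T : (Fin m → ℝ) → EuclideanSpace ℝ (Fin m))
  (B : Matrix (Fin n) (Fin m) ℝ) (Mhat : ℝ) (σ : Seed c K ε n)

/-- The matrix downsampled at rate `2⁻ℓ`: the rows that do not survive are replaced by zero. -/
def downsample (ℓ : Fin (rates n + 1)) : Matrix (Fin n) (Fin m) ℝ :=
  Matrix.of fun i => if σ.keep ℓ i then B i else 0

/-- The answer of the `ℓ`-th structure to the query `i`. -/
def answer (ℓ : Fin (rates n + 1)) (i : Fin n) : Fin m → ℝ :=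
  query T (downsample B σ ℓ) (σ.hash ℓ) (σ.sign ℓ) i

/-- The estimate `λ_i` of the squared norm of the `i`-th transformed row by the `ℓ`-th
structure. -/
def estimate (ℓ : Fin (rates n + 1)) (i : Fin n) : ℝ := ‖T (answer T B σ ℓ i)‖ ^ 2

/-- `Λ_ℓ`, the top heavy hitters of the `ℓ`-th structure. -/
def heavyHitters (ℓ : Fin (rates n + 1)) : Finset (Fin n) :=
  topIndices (topSize c K ε n) (estimate T B σ ℓ)

/-- The elements of `Λ_ℓ` with estimate in `[(1+ε)ζM̂/2^j, (2-ε)ζM̂/2^j]`. -/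
def levelElements (j : ℕ) (ℓ : Fin (rates n + 1)) : Finset (Fin n) :=
  {i ∈ heavyHitters T B σ ℓ |
    estimate T B σ ℓ i ∈
      Set.Icc ((1 + ε) * (σ.ζ * Mhat / 2 ^ j)) ((2 - ε) * (σ.ζ * Mhat / 2 ^ j))}

/-- The `ℓ` for which `Λ_ℓ` contains an admissible number `s_j` of elements of level `j`. -/
def admissible (j : ℕ) : Finset (Fin (rates n + 1)) :=
  {ℓ | (1 - √20 * ε) * (levels K ε n : ℝ) ^ 2 / ε ^ 2 ≤ (levelElements T B Mhat σ j ℓ).card ∧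
    ((levelElements T B Mhat σ j ℓ).card : ℝ) ≤
      2 * (1 + √20 * ε) * (levels K ε n : ℝ) ^ 2 / ε ^ 2}

/-- The structure used for level `j`: the one for the full matrix if `j ≤ j₀`, and the largest
admissible one, if any, otherwise. -/
def chosen (j : ℕ) : Option (Fin (rates n + 1)) :=
  if j ≤ lastHeavyLevel K ε n then some 0
  else if h : (admissible T B Mhat σ j).Nonempty then some ((admissible T B Mhat σ j).max' h)
  else none

/-- The estimate `M̃_j` of the contribution of level `j`. -/
def levelMass (j : ℕ) : ℝ :=
  match chosen T B Mhat σ j with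
  | none => 0
  | some ℓ => (∑ i ∈ levelElements T B Mhat σ j ℓ, estimate T B σ ℓ i) * 2 ^ (ℓ : ℕ)

/-- The law of the returned vector, given the seed: a level `j ∈ {0, …, L}` is sampled with
probability proportional to `M̃_j`, then an element `i` of this level with probability
proportional to its estimate, and the answer to the query `i` is returned. -/
def output : PMF (Option (Fin m → ℝ)) :=
  (pick fun j : Fin (levels K ε n + 1) => levelMass T B Mhat σ j).bind fun j? =>
    match j? with
    | none => PMF.pure none
    | some j =>
      match chosen T B Mhat σ j with
      | none => PMF.pure none
      | some ℓ =>
        (pick fun i : Fin n =>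
          if i ∈ levelElements T B Mhat σ j ℓ then estimate T B σ ℓ i else 0).map
          (Option.map (answer T B σ ℓ))

/-- The probability, over the seed and over the final sampling, that the algorithm returns a
vector (that is, does not fail) and that this vector has the property `P`. -/
def successProb {Ω : Type*} [MeasurableSpace Ω] (μ : Measure Ω) (S : Ω → Seed c K ε n)
    (P : (Fin m → ℝ) → Prop) : ℝ≥0∞ :=
  ∫⁻ ω, (output T B Mhat (S ω)).toOuterMeasure {v? | ∃ v, v? = some v ∧ P v} ∂μ

end Algorithm

end HSketch

end

open MeasureTheory ProbabilityTheory
open scoped ENNReal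

namespace HSketch

/-! ### Elementary properties of the transformations -/

/-! Write `L` for the number of levels, `M` for the mass and `T = ζM̂/2^j` for the scale of level
`j`.

Accuracy. `f` is even and subadditive, and `f(x)/|x|` decreases in `|x|`. Hence `‖g(·)‖` obeys the
triangle inequality, and a randomly signed sum of rows has expected squared transformed norm at most
twice the sum of the squared transformed norms of these rows (`integral_norm_g_sign_sum_sq_le`). The
rows colliding with `i` thus perturb the norm of its bucket by `O(√(mass/w))` with large constant
probability, and the median makes this hold for all rows and structures at once
(`measure_answer_le`). If this error `tol` is at most `ε√T`, every element of level `j` comes from a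
surviving row, and its answer is correct up to a factor `1 ± 3ε` (`estimate_approx`). The sampled
vector can be bad only when it comes from a level whose structure is too inaccurate for its scale.

Inaccurate levels are negligible (`Favourable.levelMass_le`). Inaccuracy forces `2^ℓ T ≲ Mε⁴/L⁵`,
and an admissible level has at most about `4L²/ε²` elements, so its mass is `O(Mε²/L³)`.

The total of the level masses is at least `M/(32K(L+1))` (`Favourable.le_sum_levelMass`). The random
shift leaves little mass in the gaps between levels, so some level `j` holds rows of mass
`M/(2(L+1))`. If `j ≤ j₀`, either all these rows are found in `Λ₀`, or `Λ₀` is filled up with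
`L³/ε³` elements at least as large, whose estimates mostly fall into levels again. If `j > j₀`,
there are many such rows, and at the rate at which `L²/ε²` to `2L²/ε²` of them are expected to
survive, Chebyshev's inequality shows that the rate is admissible. Choosing the largest admissible
rate can only increase this lower bound, so the chosen structure need not be accurate.

Since `Kε` is small, all inaccurate levels together are at most a hundredth of the total. The events
needed for this define `Favourable`; they fail with probability at most `7/100`. -/

theorem f_nonneg (x : ℝ) : 0 ≤ f x :=
  Real.log_nonneg (by linarith [abs_nonneg x])

theorem f_zero : f 0 = 0 := by simp [f]

theorem f_neg (x : ℝ) : f (-x) = f x := by simp [f]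

theorem f_pos {x : ℝ} (hx : x ≠ 0) : 0 < f x :=
  Real.log_pos (by linarith [abs_pos.2 hx])

theorem f_le_f {x y : ℝ} (h : |x| ≤ |y|) : f x ≤ f y :=
  Real.log_le_log (by linarith [abs_nonneg x]) (by linarith)

theorem f_add_le (x y : ℝ) : f (x + y) ≤ f x + f y := by
  have hx := abs_nonneg x
  have hy := abs_nonneg y
  unfold f
  rw [← Real.log_mul (by linarith) (by linarith)]
  refine Real.log_le_log (by linarith [abs_nonneg (x + y)]) ?_
  nlinarith [abs_add_le x y]

/-- This is the monotonicity of `f(x)/|x|`, free of division. It is Bernoulli's inequality `(1 +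
|y|)^p ≤ 1 + p|y|` with `p = |x|/|y| ≤ 1`, after taking logarithms. -/
theorem abs_mul_f_le {x y : ℝ} (h : |x| ≤ |y|) : |x| * f y ≤ |y| * f x := by
  rcases eq_or_ne y 0 with rfl | hy
  · simp [f_zero]
  have hy' : 0 < |y| := abs_pos.2 hy
  have key : (|x| / |y|) * f y ≤ f x := by
    unfold f
    rw [← Real.log_rpow (by linarith)]
    refine Real.log_le_log (Real.rpow_pos_of_pos (by linarith) _) ?_
    have := rpow_one_add_le_one_add_mul_self (s := |y|) (p := |x| / |y|) (by linarith)
      (by positivity) ((div_le_one hy').2 h)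
    rwa [div_mul_cancel₀ _ hy'.ne'] at this
  rw [div_mul_eq_mul_div, div_le_iff₀ hy'] at key
  linarith

/-- The summand `1` covers `|x| ≤ |y|` by monotonicity, the other one `|x| ≥ |y|` by the decrease of
`f(x)/|x|`. The bound is affine in `x²`, so the second moment of a random `x` controls the
expectation of `f(x)²`. -/
theorem f_sq_le (x : ℝ) {y : ℝ} (hy : y ≠ 0) : f x ^ 2 ≤ (1 + x ^ 2 / y ^ 2) * f y ^ 2 := by
  rcases le_total |x| |y| with h | h
  · have h1 := pow_le_pow_left₀ (f_nonneg x) (f_le_f h) 2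
    have : 0 ≤ x ^ 2 / y ^ 2 * f y ^ 2 := by positivity
    linarith
  · have h1 := pow_le_pow_left₀ (mul_nonneg (abs_nonneg y) (f_nonneg x)) (abs_mul_f_le h) 2
    rw [mul_pow, mul_pow, sq_abs, sq_abs] at h1
    have hy2 : 0 < y ^ 2 := by positivity
    have h2 : f x ^ 2 ≤ x ^ 2 / y ^ 2 * f y ^ 2 := by
      rw [div_mul_eq_mul_div, le_div_iff₀ hy2]; linarith
    linarith [sq_nonneg (f y)]

/-- Each `|a k|` is at most `√Y`, so `f(a k) ≥ (|a k|/√Y) f(√Y)`; the squares of the ratios sum to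
`1`. -/
theorem f_sqrt_sum_sq_le {ι : Type*} (s : Finset ι) (a : ι → ℝ) :
    f (√(∑ k ∈ s, a k ^ 2)) ^ 2 ≤ ∑ k ∈ s, f (a k) ^ 2 := by
  set Y := ∑ k ∈ s, a k ^ 2 with hY
  have hY0 : 0 ≤ Y := Finset.sum_nonneg fun _ _ => sq_nonneg _
  rcases hY0.eq_or_lt with h0 | h0
  · rw [← h0]; simp only [Real.sqrt_zero, f_zero]
    simpa using Finset.sum_nonneg fun k _ => sq_nonneg (f (a k))
  have hk : ∀ k ∈ s, a k ^ 2 / Y * f (√Y) ^ 2 ≤ f (a k) ^ 2 := by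
    intro k hk
    have h1 : a k ^ 2 ≤ Y := Finset.single_le_sum (fun i _ => sq_nonneg (a i)) hk
    have h2 : |a k| ≤ |√Y| := by
      rw [abs_of_nonneg (Real.sqrt_nonneg Y)]; exact Real.abs_le_sqrt h1
    have h3 := pow_le_pow_left₀ (mul_nonneg (abs_nonneg _) (f_nonneg _)) (abs_mul_f_le h2) 2
    rw [mul_pow, mul_pow, sq_abs, sq_abs, Real.sq_sqrt hY0] at h3
    rw [div_mul_eq_mul_div, div_le_iff₀ h0]; linarith
  have := Finset.sum_le_sum hk
  rwa [← Finset.sum_mul, ← Finset.sum_div, ← hY, div_self h0.ne', one_mul] at this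

theorem norm_g_sq {d : ℕ} (x : Fin (d + 1) → ℝ) :
    ‖g x‖ ^ 2 = (∑ t : Fin d, f (x t.castSucc) ^ 2) + x (Fin.last d) ^ 2 := by
  rw [EuclideanSpace.norm_sq_eq, Fin.sum_univ_castSucc]
  simp [g]

theorem norm_g_concat_sq {n d : ℕ} (A : Matrix (Fin n) (Fin d) ℝ) (b : Fin n → ℝ) (u : Fin n) :
    ‖g (concat A b u)‖ ^ 2 = ‖fVec (A u)‖ ^ 2 + |b u| ^ 2 := by
  rw [norm_g_sq, EuclideanSpace.norm_sq_eq]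
  simp [concat, fVec]

theorem norm_g_zero {d : ℕ} : ‖g (0 : Fin (d + 1) → ℝ)‖ = 0 := by
  have := norm_g_sq (0 : Fin (d + 1) → ℝ)
  simpa [f_zero] using this

theorem norm_g_neg {d : ℕ} (x : Fin (d + 1) → ℝ) : ‖g (-x)‖ = ‖g x‖ := by
  rw [← sq_eq_sq₀ (norm_nonneg _) (norm_nonneg _), norm_g_sq, norm_g_sq]
  simp [f_neg]

theorem norm_g_add_le {d : ℕ} (x y : Fin (d + 1) → ℝ) : ‖g (x + y)‖ ≤ ‖g x‖ + ‖g y‖ := by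
  -- Passing to absolute values of the entries does not change the norm and makes the subadditivity
  -- of every coordinate, including the untransformed last one, a comparison of nonnegative vectors.
  set a : (Fin (d + 1) → ℝ) → EuclideanSpace ℝ (Fin (d + 1)) := fun z =>
    WithLp.toLp 2 fun t => |g z t| with ha
  have hn : ∀ z, ‖a z‖ = ‖g z‖ := fun z => by
    rw [EuclideanSpace.norm_eq, EuclideanSpace.norm_eq]; simp [ha]
  rw [← hn x, ← hn y]
  refine le_trans ?_ (norm_add_le (a x) (a y))
  rw [EuclideanSpace.norm_eq, EuclideanSpace.norm_eq]
  refine Real.sqrt_le_sqrt (Finset.sum_le_sum fun t _ => ?_)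
  refine pow_le_pow_left₀ (norm_nonneg _) ?_ 2
  have h0 : 0 ≤ |g x t| + |g y t| := by positivity
  simp only [ha, PiLp.add_apply, Real.norm_eq_abs, abs_of_nonneg h0]
  refine Fin.lastCases ?_ (fun t => ?_) t
  · simpa [g] using abs_add_le (x (Fin.last d)) (y (Fin.last d))
  · simp only [g, Fin.snoc_castSucc, Pi.add_apply, abs_of_nonneg (f_nonneg _)]
    exact f_add_le _ _

theorem abs_norm_g_add_sub_le {d : ℕ} (x y : Fin (d + 1) → ℝ) :
    |‖g (x + y)‖ - ‖g x‖| ≤ ‖g y‖ := by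
  have h1 := norm_g_add_le x y
  have h2 := norm_g_add_le (x + y) (-y)
  rw [norm_g_neg, add_neg_cancel_right] at h2
  rw [abs_le]; constructor <;> linarith

theorem norm_g_sign_mul {d : ℕ} (s : ℤˣ) (x : Fin (d + 1) → ℝ) :
    ‖g fun t => ((s : ℤ) : ℝ) * x t‖ = ‖g x‖ := by
  rcases Int.units_eq_one_or s with rfl | rfl
  · simp
  · rw [← norm_g_neg x]; congr 2; ext t; simp

theorem mass_pos {n d : ℕ} {A : Matrix (Fin n) (Fin d) ℝ} {b : Fin n → ℝ} (h : A ≠ 0 ∨ b ≠ 0) :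
    0 < mass g (concat A b) := by
  have hnn : ∀ i ∈ Finset.univ, 0 ≤ ‖g (concat A b i)‖ ^ 2 := fun _ _ => sq_nonneg _
  refine lt_of_le_of_ne (Finset.sum_nonneg hnn) fun h0 => ?_
  have hz := (Finset.sum_eq_zero_iff_of_nonneg hnn).1 h0.symm
  have hz' : ∀ i, (∀ t, A i t = 0) ∧ b i = 0 := by
    intro i
    have h1 := hz i (Finset.mem_univ i)
    rw [norm_g_concat_sq, sq_abs] at h1
    have h2 : ‖fVec (A i)‖ = 0 := by
      have := sq_nonneg (b i)
      exact pow_eq_zero_iff two_ne_zero |>.1 (by nlinarith [sq_nonneg ‖fVec (A i)‖])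
    refine ⟨fun t => ?_, pow_eq_zero_iff two_ne_zero |>.1 (by nlinarith [sq_nonneg (b i)])⟩
    by_contra hne
    have h3 := norm_eq_zero.1 h2
    have h4 : fVec (A i) t = 0 := by rw [h3]; rfl
    exact (f_pos hne).ne' h4
  rcases h with h | h
  · exact h (by ext i t; exact (hz' i).1 t)
  · exact h (by ext i; exact (hz' i).2)

/-! ### Random signs -/

instance : MeasurableSingletonClass ℤˣ where
  measurableSet_singleton u :=
    ⟨{(u : ℤ)}, measurableSet_singleton _, by ext v; simp [Units.ext_iff]⟩

theorem integral_sign_mul_sign {n : ℕ} {ν : Measure (Fin n → ℤˣ)} [IsProbabilityMeasure ν]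
    (hν : KWiseIndependent 4 ν fun s => s) (k l : Fin n) :
    ∫ s, ((s k : ℤ) : ℝ) * ((s l : ℤ) : ℝ) ∂ν = if k = l then 1 else 0 := by
  by_cases hkl : k = l
  · subst hkl
    have h1 : ∀ s : Fin n → ℤˣ, ((s k : ℤ) : ℝ) * ((s k : ℤ) : ℝ) = 1 := fun s => by
      rcases Int.units_eq_one_or (s k) with h | h <;> simp [h]
    simp [h1]
  · have hpair : ∀ u : ℤˣ, ν {s | s k = u ∧ s l = u} = 4⁻¹ := fun u => by
      have h1 := hν {k, l} (by rw [Finset.card_pair hkl]; norm_num) fun _ => u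
      rw [Finset.card_pair hkl] at h1
      have h2 : {s : Fin n → ℤˣ | s k = u ∧ s l = u} =
          {ω | ∀ i ∈ ({k, l} : Finset (Fin n)), ω i = u} := by ext s; simp
      rw [h2, h1, ← ENNReal.inv_pow]
      congr 1
      rw [Fintype.card_units_int]; norm_num
    have hE : ν {s | s k = s l} = 2⁻¹ := by
      have h2 : {s : Fin n → ℤˣ | s k = s l} =
          {s | s k = 1 ∧ s l = 1} ∪ {s | s k = -1 ∧ s l = -1} := by
        ext s
        rcases Int.units_eq_one_or (s k) with h | h <;>
          rcases Int.units_eq_one_or (s l) with h' | h' <;> simp [h, h']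
      rw [h2, measure_union _ (Set.toFinite _).measurableSet, hpair, hpair,
        ← ENNReal.toReal_eq_toReal_iff' (by simp) (by simp)]
      · rw [ENNReal.toReal_add (by simp) (by simp)]; norm_num
      · rw [Set.disjoint_left]
        rintro s ⟨h, -⟩ ⟨h', -⟩
        rw [h] at h'; exact absurd h' (by decide)
    have hfun : ∀ s : Fin n → ℤˣ, ((s k : ℤ) : ℝ) * ((s l : ℤ) : ℝ) =
        2 * ({s : Fin n → ℤˣ | s k = s l}.indicator 1 s) - 1 := fun s => by
      rcases Int.units_eq_one_or (s k) with h | h <;>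
        rcases Int.units_eq_one_or (s l) with h' | h' <;>
        simp [Set.indicator, h, h'] <;> norm_num
    simp only [hfun, if_neg hkl]
    rw [integral_sub (Integrable.of_finite) (integrable_const _), integral_const_mul,
      integral_indicator_one (Set.toFinite _).measurableSet]
    simp [Measure.real, hE]

theorem integral_sign_sum_sq {n : ℕ} {ν : Measure (Fin n → ℤˣ)} [IsProbabilityMeasure ν]
    (hν : KWiseIndependent 4 ν fun s => s) (S : Finset (Fin n)) (a : Fin n → ℝ) :
    ∫ s, (∑ k ∈ S, ((s k : ℤ) : ℝ) * a k) ^ 2 ∂ν = ∑ k ∈ S, a k ^ 2 := by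
  have h1 : ∀ s : Fin n → ℤˣ, (∑ k ∈ S, ((s k : ℤ) : ℝ) * a k) ^ 2 =
      ∑ k ∈ S, ∑ l ∈ S, a k * a l * (((s k : ℤ) : ℝ) * ((s l : ℤ) : ℝ)) := fun s => by
    rw [sq, Finset.sum_mul_sum]
    exact Finset.sum_congr rfl fun k _ => Finset.sum_congr rfl fun l _ => by ring
  simp only [h1]
  rw [integral_finsetSum _ fun _ _ => Integrable.of_finite]
  refine Finset.sum_congr rfl fun k hk => ?_
  rw [integral_finsetSum _ fun _ _ => Integrable.of_finite]
  simp [integral_const_mul, integral_sign_mul_sign hν, hk, sq]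

/-- The signed sum has second moment `Y = ∑ a k ^ 2`. Comparing it with `√Y` by means of `f_sq_le`
gives expectation at most `(1 + 1) f(√Y)²`, and `f_sqrt_sum_sq_le` returns to the single entries. -/
theorem integral_f_sign_sum_sq_le {n : ℕ} {ν : Measure (Fin n → ℤˣ)} [IsProbabilityMeasure ν]
    (hν : KWiseIndependent 4 ν fun s => s) (S : Finset (Fin n)) (a : Fin n → ℝ) :
    ∫ s, f (∑ k ∈ S, ((s k : ℤ) : ℝ) * a k) ^ 2 ∂ν ≤ 2 * ∑ k ∈ S, f (a k) ^ 2 := by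
  set Y := ∑ k ∈ S, a k ^ 2 with hY
  have hY0 : 0 ≤ Y := Finset.sum_nonneg fun _ _ => sq_nonneg _
  have hF : f (√Y) ^ 2 ≤ ∑ k ∈ S, f (a k) ^ 2 := f_sqrt_sum_sq_le S a
  rcases hY0.eq_or_lt with h0 | h0
  · have hz := (Finset.sum_eq_zero_iff_of_nonneg fun k _ => sq_nonneg (a k)).1 h0.symm
    have hs : ∀ s : Fin n → ℤˣ, ∑ k ∈ S, ((s k : ℤ) : ℝ) * a k = 0 := fun s =>
      Finset.sum_eq_zero fun k hk => by rw [pow_eq_zero_iff two_ne_zero |>.1 (hz k hk), mul_zero]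
    simp only [hs, f_zero]
    simpa using Finset.sum_nonneg fun k (_ : k ∈ S) => sq_nonneg (f (a k))
  · calc ∫ s, f (∑ k ∈ S, ((s k : ℤ) : ℝ) * a k) ^ 2 ∂ν
        ≤ ∫ s, (1 + (∑ k ∈ S, ((s k : ℤ) : ℝ) * a k) ^ 2 / √Y ^ 2) * f (√Y) ^ 2 ∂ν :=
          integral_mono Integrable.of_finite Integrable.of_finite fun s =>
            f_sq_le _ (Real.sqrt_pos.2 h0).ne'
      _ = 2 * f (√Y) ^ 2 := by
          rw [integral_mul_const, integral_add (integrable_const _) Integrable.of_finite,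
            integral_div, integral_sign_sum_sq hν, Real.sq_sqrt hY0, ← hY, div_self h0.ne']
          simp; norm_num
      _ ≤ _ := by linarith

theorem integral_norm_g_sign_sum_sq_le {n d : ℕ} {ν : Measure (Fin n → ℤˣ)}
    [IsProbabilityMeasure ν] (hν : KWiseIndependent 4 ν fun s => s) (S : Finset (Fin n))
    (B : Matrix (Fin n) (Fin (d + 1)) ℝ) :
    ∫ s, ‖g fun t => ∑ k ∈ S, ((s k : ℤ) : ℝ) * B k t‖ ^ 2 ∂ν ≤ 2 * ∑ k ∈ S, ‖g (B k)‖ ^ 2 := by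
  simp only [norm_g_sq]
  rw [integral_add Integrable.of_finite Integrable.of_finite,
    integral_finsetSum _ fun _ _ => Integrable.of_finite, integral_sign_sum_sq hν,
    Finset.sum_add_distrib, mul_add, Finset.sum_comm, Finset.mul_sum]
  refine add_le_add (Finset.sum_le_sum fun t _ => integral_f_sign_sum_sq_le hν S _) ?_
  have := Finset.sum_nonneg fun k (_ : k ∈ S) => sq_nonneg (B k (Fin.last d))
  linarith

end HSketch

namespace HSketch

/-! ### Medians -/

/-- If the median were below `lo`, so would be everything sorted before it, and symmetrically for
`hi`. With the position `(R - 1) / 2`, either side together with the median comprises at least half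
of the values. -/
theorem medianIndex_mem_Icc {R : ℕ} (hR : 0 < R) (x : Fin R → ℝ) {lo hi : ℝ}
    (h : 2 * Finset.card {r | x r ∉ Set.Icc lo hi} < R) :
    x (medianIndex hR x) ∈ Set.Icc lo hi := by
  set m : Fin R := ⟨(R - 1) / 2, by omega⟩ with hm
  have hmono : Monotone (x ∘ Tuple.sort x) := Tuple.monotone_sort x
  have hdef : medianIndex hR x = Tuple.sort x m := rfl
  rw [hdef]
  have hcard : ∀ s : Finset (Fin R), (∀ k ∈ s, x (Tuple.sort x k) ∉ Set.Icc lo hi) →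
      s.card ≤ Finset.card {r | x r ∉ Set.Icc lo hi} := fun s hs =>
    Finset.card_le_card_of_injOn (Tuple.sort x) (fun k hk => by simpa using hs k hk)
      (Tuple.sort x).injective.injOn
  by_contra hc
  rcases not_and_or.1 hc with hc | hc
  · have h1 := hcard (Finset.Iic m) fun k hk hk' =>
      hc (hk'.1.trans (hmono (Finset.mem_Iic.1 hk)))
    rw [Fin.card_Iic] at h1
    simp only [hm] at h1
    omega
  · have h1 := hcard (Finset.Ici m) fun k hk hk' =>
      hc ((hmono (Finset.mem_Ici.1 hk)).trans hk'.2)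
    rw [Fin.card_Ici] at h1
    simp only [hm] at h1
    omega

/-! ### Probabilistic tools -/

section Tools

variable {Ω : Type*} [MeasurableSpace Ω] {μ : Measure Ω}

/-- Conditioning on a variable with finitely many values: a bound for the event that is uniform in
the frozen value of `Y` survives averaging. It serves to freeze the downsampling, the random shift,
or the whole sketch. -/
theorem measure_le_of_indepFun [IsProbabilityMeasure μ] {α β : Type*} [MeasurableSpace α]
    [MeasurableSpace β] [Finite β] [MeasurableSingletonClass β] {Y : Ω → β} {X : Ω → α}
    (hY : Measurable Y) (hind : IndepFun Y X μ) (D : β → Set α)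
    (hD : ∀ y, MeasurableSet (D y)) {p : ℝ≥0∞} (hp : ∀ y, μ (X ⁻¹' D y) ≤ p) :
    μ {ω | X ω ∈ D (Y ω)} ≤ p := by
  cases nonempty_fintype β
  have h1 : {ω | X ω ∈ D (Y ω)} = ⋃ y ∈ Finset.univ, (Y ⁻¹' {y} ∩ X ⁻¹' D y) := by
    ext ω; simp
  calc μ {ω | X ω ∈ D (Y ω)} ≤ ∑ y, μ (Y ⁻¹' {y} ∩ X ⁻¹' D y) := by
        rw [h1]; exact measure_biUnion_finset_le _ _
    _ ≤ ∑ y, μ (Y ⁻¹' {y}) * p := Finset.sum_le_sum fun y _ => by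
        rw [hind.measure_inter_preimage_eq_mul _ _ (measurableSet_singleton y) (hD y)]
        gcongr; exact hp y
    _ = p := by
        rw [← Finset.sum_mul, sum_measure_preimage_singleton _ fun y _ =>
          hY (measurableSet_singleton y)]
        simp

/-- Union bound over at most `2^R` sets of failing repetitions. Each has at least `R/2` elements,
hence probability at most `64^(-R/2) = 8^(-R)`. -/
theorem measure_many_le [IsProbabilityMeasure μ] {R : ℕ} {α : Type*} [MeasurableSpace α]
    {X : Fin R → Ω → α} (hX : iIndepFun X μ) {D : Fin R → Set α}
    (hD : ∀ r, MeasurableSet (D r)) (hp : ∀ r, μ (X r ⁻¹' D r) ≤ 64⁻¹) :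
    μ {ω | ∃ T : Finset (Fin R), R ≤ 2 * T.card ∧ ∀ r ∈ T, X r ω ∈ D r} ≤ 4⁻¹ ^ R := by
  have h1 : {ω | ∃ T : Finset (Fin R), R ≤ 2 * T.card ∧ ∀ r ∈ T, X r ω ∈ D r} =
      ⋃ T ∈ Finset.univ.filter fun T : Finset (Fin R) => R ≤ 2 * T.card,
        ⋂ r ∈ T, X r ⁻¹' D r := by
    ext ω; simp
  have h8 : (64⁻¹ : ℝ≥0∞) = 8⁻¹ ^ 2 := by rw [← ENNReal.inv_pow]; norm_num
  have h82 : (8⁻¹ : ℝ≥0∞) = 2⁻¹ * 4⁻¹ := by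
    rw [← ENNReal.mul_inv (by simp) (by simp)]; norm_num
  rw [h1]
  calc _ ≤ ∑ T ∈ Finset.univ.filter fun T : Finset (Fin R) => R ≤ 2 * T.card,
          μ (⋂ r ∈ T, X r ⁻¹' D r) := measure_biUnion_finset_le _ _
    _ ≤ ∑ T ∈ Finset.univ.filter fun T : Finset (Fin R) => R ≤ 2 * T.card, 8⁻¹ ^ R := by
        refine Finset.sum_le_sum fun T hT => ?_
        rw [hX.measure_inter_preimage_eq_mul T fun r _ => hD r]
        calc ∏ r ∈ T, μ (X r ⁻¹' D r) ≤ 64⁻¹ ^ T.card :=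
              Finset.prod_le_pow_card _ _ _ fun r _ => hp r
          _ = 8⁻¹ ^ (2 * T.card) := by rw [h8, ← pow_mul]
          _ ≤ 8⁻¹ ^ R := pow_le_pow_right_of_le_one' (by simp) (Finset.mem_filter.1 hT).2
    _ ≤ (2 ^ R : ℝ≥0∞) * 8⁻¹ ^ R := by
        rw [Finset.sum_const, nsmul_eq_mul]
        gcongr
        exact_mod_cast (Finset.card_le_univ _).trans (by simp)
    _ = 4⁻¹ ^ R := by
        rw [← mul_pow, h82, ← mul_assoc, ENNReal.mul_inv_cancel (by simp) (by simp), one_mul]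

theorem measure_union_le_add {s t : Set Ω} {p q : ℝ≥0∞} (hs : μ s ≤ p) (ht : μ t ≤ q) :
    μ (s ∪ t) ≤ p + q :=
  (measure_union_le s t).trans (add_le_add hs ht)

/-- The function need not be measurable, and neither does the event. -/
theorem mul_le_lintegral_of_measure_compl_le [IsProbabilityMeasure μ] {F : Ω → ℝ≥0∞}
    {good : Ω → Prop} {a p : ℝ≥0∞} (hp : μ {ω | ¬ good ω} ≤ p) (hF : ∀ ω, good ω → a ≤ F ω) :
    a * (1 - p) ≤ ∫⁻ ω, F ω ∂μ := by
  set D := toMeasurable μ {ω | ¬ good ω} with hD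
  have hDm : MeasurableSet D := measurableSet_toMeasurable _ _
  calc a * (1 - p) ≤ a * μ Dᶜ := by
        rw [prob_compl_eq_one_sub hDm, hD, measure_toMeasurable]; gcongr
    _ = ∫⁻ ω, Dᶜ.indicator (fun _ => a) ω ∂μ := (lintegral_indicator_const hDm.compl a).symm
    _ ≤ ∫⁻ ω, F ω ∂μ := lintegral_mono fun ω => by
        by_cases hω : ω ∈ D
        · rw [Set.indicator_of_notMem (by simpa using hω)]; exact zero_le
        · rw [Set.indicator_of_mem hω]
          exact hF ω (by by_contra hc; exact hω (subset_toMeasurable μ _ hc))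

/-- Markov's inequality. The strict inequality in the event keeps it valid for `q = 0`, where `X ≤
0` almost everywhere. -/
theorem measure_mul_lt_le {X : Ω → ℝ} (hX : Measurable X) {q : ℝ} (hq : 0 ≤ q)
    (hle : ∫⁻ ω, ENNReal.ofReal (X ω) ∂μ ≤ ENNReal.ofReal q) {c : ℝ} (hc : 0 < c) :
    μ {ω | c * q < X ω} ≤ (ENNReal.ofReal c)⁻¹ := by
  have hmeas : Measurable fun ω => ENNReal.ofReal (X ω) := hX.ennreal_ofReal
  rcases hq.eq_or_lt with h0 | h0
  · rw [← h0] at hle ⊢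
    have h1 := (lintegral_eq_zero_iff hmeas).1 (by simpa using hle)
    have h2 : μ {ω | c * 0 < X ω} = 0 := by
      refine measure_mono_null ?_ (ae_iff.1 h1)
      intro ω hω
      simpa using hω
    rw [h2]; exact zero_le
  · have h1 := mul_meas_ge_le_lintegral (μ := μ) hmeas (ENNReal.ofReal (c * q))
    have h2 : μ {ω | c * q < X ω} ≤ μ {ω | ENNReal.ofReal (c * q) ≤ ENNReal.ofReal (X ω)} :=
      measure_mono fun ω hω => ENNReal.ofReal_le_ofReal (le_of_lt hω)
    refine h2.trans ?_
    have h3 := h1.trans hle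
    have ha0 : ENNReal.ofReal q ≠ 0 := by simpa using h0
    rw [ENNReal.ofReal_mul hc.le, mul_right_comm, ← ENNReal.ofReal_mul hc.le] at h3
    rw [ENNReal.le_inv_iff_mul_le, mul_comm]
    exact (ENNReal.mul_le_mul_iff_left ha0 ENNReal.ofReal_ne_top).1 (by rwa [one_mul])

/-- Moves the computation to the law on a finite function space, where measurability and
integrability are automatic. -/
theorem KWiseIndependent.map {ι β : Type*} [Finite ι] [Fintype β] [MeasurableSpace β]
    [MeasurableSingletonClass β] {k : ℕ} {X : Ω → ι → β} (h : KWiseIndependent k μ X)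
    (hX : Measurable X) : KWiseIndependent k (μ.map X) fun x => x := by
  intro s hs y
  rw [Measure.map_apply hX (Set.toFinite _).measurableSet]
  exact h s hs y

theorem KWiseIndependent.measure_eq {ι β : Type*} [Fintype β] [Nonempty β] [MeasurableSpace β]
    [Finite ι] [MeasurableSingletonClass β] {ν : Measure (ι → β)}
    (h : KWiseIndependent 2 ν fun x => x) {k i : ι} (hki : k ≠ i) :
    ν {x | x k = x i} = (Fintype.card β : ℝ≥0∞)⁻¹ := by
  classical
  have h1 : {x : ι → β | x k = x i} =
      ⋃ v ∈ Finset.univ, {x | ∀ l ∈ ({k, i} : Finset ι), x l = v} := by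
    ext x
    simp only [Set.mem_ofPred_eq, Set.mem_iUnion, Finset.mem_insert, Finset.mem_singleton,
      forall_eq_or_imp, forall_eq]
    exact ⟨fun hx => ⟨x i, Finset.mem_univ _, hx, rfl⟩, fun ⟨v, _, hx, hx'⟩ => hx.trans hx'.symm⟩
  rw [h1, measure_biUnion_finset _ fun _ _ => (Set.toFinite _).measurableSet]
  · rw [Finset.sum_congr rfl fun v _ => h {k, i} (by rw [Finset.card_pair hki]) fun _ => v]
    rw [Finset.card_pair hki, Finset.sum_const, nsmul_eq_mul, Finset.card_univ, sq, ← mul_assoc,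
      ENNReal.mul_inv_cancel (by simp) (by simp), one_mul]
  · intro u _ v _ huv
    rw [Function.onFun, Set.disjoint_left]
    intro x hx hx'
    exact huv ((hx k (by simp)).symm.trans (hx' k (by simp)))

end Tools

/-! ### Accuracy of the sketch -/

/-- The rows, other than row `i`, that are hashed to the bucket of `i`. -/
def noise {n m w : ℕ} (B : Matrix (Fin n) (Fin m) ℝ) (h : Fin n → Fin w) (s : Fin n → ℤˣ)
    (i : Fin n) : Fin m → ℝ :=
  fun t => ∑ k with h k = h i ∧ k ≠ i, ((s k : ℤ) : ℝ) * B k t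

theorem abs_norm_bucket_sub_le {n d w : ℕ} (B : Matrix (Fin n) (Fin (d + 1)) ℝ)
    (h : Fin n → Fin w) (s : Fin n → ℤˣ) (i : Fin n) :
    |‖g (bucket B h s (h i))‖ - ‖g (B i)‖| ≤ ‖g (noise B h s i)‖ := by
  have h1 : bucket B h s (h i) = (fun t => ((s i : ℤ) : ℝ) * B i t) + noise B h s i := by
    ext t
    have h2 : (Finset.univ.filter fun k => h k = h i) =
        insert i (Finset.univ.filter fun k => h k = h i ∧ k ≠ i) := by
      ext k
      by_cases hk : k = i <;> simp [hk]
    simp only [bucket, noise, Pi.add_apply, h2]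
    rw [Finset.sum_insert (by simp)]
  rw [h1, ← norm_g_sign_mul (s i) (B i)]
  exact abs_norm_g_add_sub_le _ _

/-- By independence the signs can be integrated first, for a fixed hash function; this costs the
factor `2`. Then every other row collides with `i` with probability `1/w`. -/
theorem lintegral_norm_noise_le {Ω : Type*} [MeasurableSpace Ω] {μ : Measure Ω}
    [IsProbabilityMeasure μ] {n d w : ℕ} (B : Matrix (Fin n) (Fin (d + 1)) ℝ)
    {h : Ω → Fin n → Fin w} {s : Ω → Fin n → ℤˣ} (hh : Measurable h) (hs : Measurable s)
    (hh2 : KWiseIndependent 2 μ h) (hs4 : KWiseIndependent 4 μ s) (hind : IndepFun h s μ)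
    (i : Fin n) :
    ∫⁻ ω, ENNReal.ofReal (‖g (noise B (h ω) (s ω) i)‖ ^ 2) ∂μ ≤
      ENNReal.ofReal (2 * mass g B / w) := by
  have : Nonempty Ω := μ.nonempty_of_neZero
  have : Nonempty (Fin w) := ⟨h (Classical.arbitrary Ω) i⟩
  have hp1 : IsProbabilityMeasure (μ.map h) := Measure.isProbabilityMeasure_map hh.aemeasurable
  have hp2 : IsProbabilityMeasure (μ.map s) := Measure.isProbabilityMeasure_map hs.aemeasurable
  set F : (Fin n → Fin w) × (Fin n → ℤˣ) → ℝ≥0∞ := fun q =>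
    ENNReal.ofReal (‖g (noise B q.1 q.2 i)‖ ^ 2) with hF
  have hFm : Measurable F := measurable_of_countable _
  have e1 : ∫⁻ ω, ENNReal.ofReal (‖g (noise B (h ω) (s ω) i)‖ ^ 2) ∂μ =
      ∫⁻ a, ∫⁻ b, F (a, b) ∂(μ.map s) ∂(μ.map h) := by
    rw [← lintegral_prod _ hFm.aemeasurable,
      ← (indepFun_iff_map_prod_eq_prod_map_map hh.aemeasurable hs.aemeasurable).1 hind,
      lintegral_map hFm (hh.prodMk hs)]
  have hs4' := hs4.map hs
  have hh2' := hh2.map hh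
  have e2 : ∀ a : Fin n → Fin w, ∫⁻ b, F (a, b) ∂(μ.map s) ≤
      ENNReal.ofReal (2 * ∑ k with a k = a i ∧ k ≠ i, ‖g (B k)‖ ^ 2) := fun a => by
    rw [← ofReal_integral_eq_lintegral_ofReal (f := fun b => ‖g (noise B a b i)‖ ^ 2)
      Integrable.of_finite (Filter.Eventually.of_forall fun b => pow_nonneg (norm_nonneg _) 2)]
    exact ENNReal.ofReal_le_ofReal (integral_norm_g_sign_sum_sq_le hs4' _ B)
  rw [e1]
  refine (lintegral_mono e2).trans ?_
  rw [← ofReal_integral_eq_lintegral_ofReal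
    (f := fun a : Fin n → Fin w => 2 * ∑ k with a k = a i ∧ k ≠ i, ‖g (B k)‖ ^ 2)
    Integrable.of_finite (Filter.Eventually.of_forall fun b => by
      simp only [Pi.zero_apply]; positivity)]
  refine ENNReal.ofReal_le_ofReal ?_
  have e3 : ∀ a : Fin n → Fin w, ∑ k with a k = a i ∧ k ≠ i, ‖g (B k)‖ ^ 2 =
      ∑ k ∈ Finset.univ.erase i,
        ({a : Fin n → Fin w | a k = a i}.indicator 1 a) * ‖g (B k)‖ ^ 2 := fun a => by
    have : (Finset.univ.filter fun k => a k = a i ∧ k ≠ i) =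
        (Finset.univ.erase i).filter fun k => a k = a i := by
      ext k; simp [and_comm]
    rw [this, Finset.sum_filter]
    refine Finset.sum_congr rfl fun k _ => ?_
    by_cases hk : a k = a i <;> simp [hk]
  simp only [e3]
  rw [integral_const_mul, integral_finsetSum _ fun _ _ => Integrable.of_finite, mul_div_assoc]
  refine mul_le_mul_of_nonneg_left ?_ zero_le_two
  have e4 : ∀ k ∈ Finset.univ.erase i, ∫ a, ({a : Fin n → Fin w | a k = a i}.indicator 1 a) *
      ‖g (B k)‖ ^ 2 ∂(μ.map h) = ‖g (B k)‖ ^ 2 / w := fun k hk => by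
    rw [integral_mul_const, integral_indicator_one (Set.toFinite _).measurableSet, Measure.real,
      hh2'.measure_eq (Finset.ne_of_mem_erase hk)]
    simp [ENNReal.toReal_inv]; ring
  rw [Finset.sum_congr rfl e4, ← Finset.sum_div]
  exact div_le_div_of_nonneg_right (Finset.sum_le_sum_of_subset_of_nonneg
    (Finset.subset_univ _) fun _ _ _ => sq_nonneg _) (Nat.cast_nonneg w)

theorem measure_noise_le {Ω : Type*} [MeasurableSpace Ω] {μ : Measure Ω}
    [IsProbabilityMeasure μ] {n d w : ℕ} (B : Matrix (Fin n) (Fin (d + 1)) ℝ)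
    {h : Ω → Fin n → Fin w} {s : Ω → Fin n → ℤˣ} (hh : Measurable h) (hs : Measurable s)
    (hh2 : KWiseIndependent 2 μ h) (hs4 : KWiseIndependent 4 μ s) (hind : IndepFun h s μ)
    (i : Fin n) :
    μ {ω | 128 * mass g B / w < ‖g (noise B (h ω) (s ω) i)‖ ^ 2} ≤ 64⁻¹ := by
  have hle := lintegral_norm_noise_le B hh hs hh2 hs4 hind i
  have hm : 0 ≤ mass g B := Finset.sum_nonneg fun _ _ => pow_nonneg (norm_nonneg _) 2
  set F : (Fin n → Fin w) × (Fin n → ℤˣ) → ℝ := fun q => ‖g (noise B q.1 q.2 i)‖ ^ 2 with hF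
  have hFm : Measurable F := measurable_of_countable _
  have hmeas : Measurable fun ω => F (h ω, s ω) := hFm.comp (hh.prodMk hs)
  -- The factor `64` gives the failure probability required by `measure_many_le`, and `64 · 2 = 128`
  -- is the constant in the threshold.
  have h1 := measure_mul_lt_le hmeas (by positivity) hle (c := 64) (by norm_num)
  have h5 : ENNReal.ofReal 64 = 64 := by norm_num
  have h6 : 64 * (2 * mass g B / w) = 128 * mass g B / w := by ring
  rwa [h5, h6] at h1

theorem measure_query_le {Ω : Type*} [MeasurableSpace Ω] {μ : Measure Ω}
    [IsProbabilityMeasure μ] {n d w R : ℕ} (hR : 0 < R) (B : Matrix (Fin n) (Fin (d + 1)) ℝ)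
    {h : Ω → Fin R → Fin n → Fin w} {s : Ω → Fin R → Fin n → ℤˣ}
    (hh : ∀ r, Measurable fun ω => h ω r) (hs : ∀ r, Measurable fun ω => s ω r)
    (hh2 : ∀ r, KWiseIndependent 2 μ fun ω => h ω r)
    (hs4 : ∀ r, KWiseIndependent 4 μ fun ω => s ω r)
    (hind : ∀ r, IndepFun (fun ω => h ω r) (fun ω => s ω r) μ)
    (hrep : iIndepFun (fun r ω => (h ω r, s ω r)) μ) (i : Fin n) :
    μ {ω | √(128 * mass g B / w) < |‖g (query g B (h ω) (s ω) i)‖ - ‖g (B i)‖|} ≤ 4⁻¹ ^ R := by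
  set τ := √(128 * mass g B / w) with hτ
  refine (measure_mono ?_).trans (measure_many_le hrep
    (D := fun _ => {q | 128 * mass g B / w < ‖g (noise B q.1 q.2 i)‖ ^ 2})
    (fun _ => (Set.toFinite _).measurableSet)
    fun r => measure_noise_le B (hh r) (hs r) (hh2 r) (hs4 r) (hind r) i)
  intro ω hω
  refine ⟨Finset.univ.filter fun r =>
    ‖g (bucket B (h ω r) (s ω r) (h ω r i))‖ ∉ Set.Icc (‖g (B i)‖ - τ) (‖g (B i)‖ + τ), ?_, ?_⟩
  · by_contra hc
    have h1 := medianIndex_mem_Icc hR (fun r => ‖g (bucket B (h ω r) (s ω r) (h ω r i))‖)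
      (lo := ‖g (B i)‖ - τ) (hi := ‖g (B i)‖ + τ) (by simpa using hc)
    have h2 : query g B (h ω) (s ω) i = bucket B
        (h ω (medianIndex hR fun r => ‖g (bucket B (h ω r) (s ω r) (h ω r i))‖))
        (s ω (medianIndex hR fun r => ‖g (bucket B (h ω r) (s ω r) (h ω r i))‖))
        (h ω (medianIndex hR fun r => ‖g (bucket B (h ω r) (s ω r) (h ω r i))‖) i) := by
      rw [query, dif_pos hR]
    simp only [Set.mem_ofPred_eq, h2] at hω
    obtain ⟨h3, h4⟩ := h1
    exact absurd hω (not_lt.2 (abs_le.2 ⟨by linarith, by linarith⟩))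
  · intro r hr
    have hr' := (Finset.mem_filter.1 hr).2
    simp only [Set.mem_ofPred_eq]
    by_contra hc
    have h1 : ‖g (noise B (h ω r) (s ω r) i)‖ ≤ τ := Real.le_sqrt_of_sq_le (not_lt.1 hc)
    have h2 := abs_le.1 ((abs_norm_bucket_sub_le B (h ω r) (s ω r) i).trans h1)
    exact hr' ⟨by linarith [h2.1], by linarith [h2.2]⟩

/-- The accuracy of the `ℓ`-th structure. -/
noncomputable def tol {c : Constants} {K ε : ℝ} {n m : ℕ} (T : (Fin m → ℝ) → EuclideanSpace ℝ (Fin m))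
    (B : Matrix (Fin n) (Fin m) ℝ) (σ : Seed c K ε n) (ℓ : Fin (rates n + 1)) : ℝ :=
  √(128 * mass T (downsample B σ ℓ) / width c K ε n ℓ)

/-- The accuracy `tol` depends on the random surviving rows, so these are frozen first; afterwards
the matrix is fixed and a union bound over the `n` queries remains. -/
theorem measure_answer_le {Ω : Type*} [MeasurableSpace Ω] {μ : Measure Ω}
    [IsProbabilityMeasure μ] {c : Constants} {K ε : ℝ} {n d : ℕ} {S : Ω → Seed c K ε n}
    (hS : IsRandomSeed μ S) (hR : 0 < reps c n) (B : Matrix (Fin n) (Fin (d + 1)) ℝ)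
    (ℓ : Fin (rates n + 1)) :
    μ {ω | ∃ i, tol g B (S ω) ℓ < |‖g (answer g B (S ω) ℓ i)‖ - ‖g (downsample B (S ω) ℓ i)‖|} ≤
      n * 4⁻¹ ^ reps c n := by
  set D : (Fin n → Bool) → Matrix (Fin n) (Fin (d + 1)) ℝ := fun κ =>
    Matrix.of fun i => if κ i then B i else 0 with hD
  have hi : ∀ i, μ {ω | tol g B (S ω) ℓ <
      |‖g (answer g B (S ω) ℓ i)‖ - ‖g (downsample B (S ω) ℓ i)‖|} ≤ 4⁻¹ ^ reps c n := fun i =>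
    measure_le_of_indepFun (hS.measurable_keep ℓ) (hS.keep_indep_sketch ℓ)
      (fun κ => {q | √(128 * mass g (D κ) / width c K ε n ℓ) <
        |‖g (query g (D κ) q.1 q.2 i)‖ - ‖g (D κ i)‖|})
      (fun κ => (Set.toFinite _).measurableSet)
      fun κ => measure_query_le hR (D κ) (hS.measurable_hash ℓ) (hS.measurable_sign ℓ)
        (hS.hash_pairwise ℓ) (hS.sign_fourwise ℓ) (hS.hash_indep_sign ℓ) (hS.reps_indep ℓ) i
  rw [Set.ofPred_exists]
  refine (measure_iUnion_fintype_le _ _).trans ((Finset.sum_le_sum fun i _ => hi i).trans ?_)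
  simp

end HSketch

namespace HSketch

/-! ### The downsampled rows -/

section Sampling

variable {Ω : Type*} [MeasurableSpace Ω] {μ : Measure Ω}
  {c : Constants} {K ε : ℝ} {n : ℕ} {S : Ω → Seed c K ε n}

theorem downsample_apply {m : ℕ} (B : Matrix (Fin n) (Fin m) ℝ) (σ : Seed c K ε n)
    (ℓ : Fin (rates n + 1)) (i : Fin n) :
    downsample B σ ℓ i = if σ.keep ℓ i = true then B i else 0 := rfl

theorem measurableSet_keep (hS : IsRandomSeed μ S) (ℓ : Fin (rates n + 1)) (i : Fin n) :
    MeasurableSet {ω | (S ω).keep ℓ i = true} :=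
  ((measurable_pi_apply i).comp (hS.measurable_keep ℓ)) (measurableSet_singleton true)

/-- Markov's inequality with factor `100(L̂ + 1)` for each structure, then a union bound over the
`L̂ + 1` structures, which needs nothing about their joint law. -/
theorem measure_mass_downsample_le (hS : IsRandomSeed μ S) {d : ℕ}
    (B : Matrix (Fin n) (Fin (d + 1)) ℝ) :
    μ {ω | ∃ ℓ : Fin (rates n + 1), 100 * ((rates n : ℝ) + 1) * (mass g B / 2 ^ (ℓ : ℕ)) <
      mass g (downsample B (S ω) ℓ)} ≤ 100⁻¹ := by
  have hmass : ∀ ω ℓ, mass g (downsample B (S ω) ℓ) =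
      ∑ i, if (S ω).keep ℓ i = true then ‖g (B i)‖ ^ 2 else 0 := fun ω ℓ => by
    refine Finset.sum_congr rfl fun i _ => ?_
    by_cases h : (S ω).keep ℓ i = true <;>
      simp [downsample_apply, h, norm_g_zero]
  have hℓ : ∀ ℓ : Fin (rates n + 1), μ {ω | 100 * ((rates n : ℝ) + 1) * (mass g B / 2 ^ (ℓ : ℕ)) <
      mass g (downsample B (S ω) ℓ)} ≤ (100 * ((rates n : ℝ≥0∞) + 1))⁻¹ := fun ℓ => by
    have hnn : 0 ≤ mass g B := Finset.sum_nonneg fun _ _ => pow_nonneg (norm_nonneg _) 2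
    have hmeas : Measurable fun ω => mass g (downsample B (S ω) ℓ) := by
      simp only [hmass]
      exact Finset.measurable_fun_sum _ fun i _ =>
        Measurable.ite (measurableSet_keep hS ℓ i) measurable_const measurable_const
    have hint : ∫⁻ ω, ENNReal.ofReal (mass g (downsample B (S ω) ℓ)) ∂μ ≤
        ENNReal.ofReal (mass g B / 2 ^ (ℓ : ℕ)) := by
      have h1 : ∀ ω, ENNReal.ofReal (mass g (downsample B (S ω) ℓ)) =
          ∑ i, {ω | (S ω).keep ℓ i = true}.indicator
            (fun _ => ENNReal.ofReal (‖g (B i)‖ ^ 2)) ω := fun ω => by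
        rw [hmass, ENNReal.ofReal_sum_of_nonneg fun i _ => by positivity]
        refine Finset.sum_congr rfl fun i _ => ?_
        by_cases h : (S ω).keep ℓ i = true <;> simp [h]
      simp only [h1]
      rw [lintegral_finsetSum _ fun i _ =>
        measurable_const.indicator (measurableSet_keep hS ℓ i)]
      simp only [lintegral_indicator_const (measurableSet_keep hS ℓ _), hS.keep_prob]
      rw [← Finset.sum_mul, ← ENNReal.ofReal_sum_of_nonneg fun i _ => by positivity,
        div_eq_mul_inv, ENNReal.ofReal_mul hnn, ENNReal.ofReal_inv_of_pos (by positivity),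
        ENNReal.ofReal_pow (by norm_num), ENNReal.inv_pow]
      simp [mass]
    refine (measure_mul_lt_le hmeas (by positivity) hint (by positivity)).trans_eq ?_
    rw [ENNReal.ofReal_mul (by norm_num), ENNReal.ofReal_add (by positivity) (by norm_num)]
    simp
  rw [Set.ofPred_exists]
  refine (measure_iUnion_fintype_le _ _).trans ((Finset.sum_le_sum fun ℓ _ => hℓ ℓ).trans ?_)
  rw [Finset.sum_const, Finset.card_univ, Fintype.card_fin, nsmul_eq_mul,
    ENNReal.mul_inv (by simp) (by simp), mul_left_comm]
  push_cast
  rw [ENNReal.mul_inv_cancel (by simp) (by finiteness), mul_one]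

variable [IsProbabilityMeasure μ]

/-- Chebyshev's inequality; the variance of a Bernoulli variable is at most its mean. -/
theorem measure_card_keep_le (hS : IsRandomSeed μ S) (ℓ : Fin (rates n + 1))
    (I : Finset (Fin n)) {t : ℝ} (ht : 0 < t) :
    μ {ω | t ≤ |((I.filter fun i => (S ω).keep ℓ i = true).card : ℝ) - I.card / 2 ^ (ℓ : ℕ)|} ≤
      ENNReal.ofReal (I.card / 2 ^ (ℓ : ℕ) / t ^ 2) := by
  set X : Fin n → Ω → ℝ := fun i => {ω | (S ω).keep ℓ i = true}.indicator 1 with hX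
  have hXm : ∀ i, Measurable (X i) := fun i =>
    measurable_one.indicator (measurableSet_keep hS ℓ i)
  have hXb : ∀ i, MemLp (X i) 2 μ := fun i =>
    MemLp.indicator (measurableSet_keep hS ℓ i) (memLp_const 1)
  have hXE : ∀ i, ∫ ω, X i ω ∂μ = 1 / 2 ^ (ℓ : ℕ) := fun i => by
    rw [integral_indicator_one (measurableSet_keep hS ℓ i), Measure.real, hS.keep_prob]
    simp
  have hXV : ∀ i, variance (X i) μ ≤ 1 / 2 ^ (ℓ : ℕ) := fun i => by
    refine (variance_le_expectation_sq (hXm i).aestronglyMeasurable).trans_eq ?_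
    rw [← hXE i]
    refine integral_congr_ae (Filter.Eventually.of_forall fun ω => ?_)
    by_cases h : (S ω).keep ℓ i = true <;> simp [hX, h]
  have hsum : ∀ ω, ((I.filter fun i => (S ω).keep ℓ i = true).card : ℝ) = (∑ i ∈ I, X i) ω := by
    intro ω
    rw [Finset.card_filter, Finset.sum_apply]
    push_cast
    refine Finset.sum_congr rfl fun i _ => ?_
    by_cases h : (S ω).keep ℓ i = true <;> simp [hX, h]
  have hind : Set.Pairwise (I : Set (Fin n)) fun i j => IndepFun (X i) (X j) μ := by
    intro i _ j _ hij
    have h1 := ((hS.keep_indep ℓ).indepFun hij).comp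
      (φ := fun b : Bool => if b = true then (1 : ℝ) else 0)
      (ψ := fun b : Bool => if b = true then (1 : ℝ) else 0)
      (measurable_of_countable _) (measurable_of_countable _)
    have h2 : ∀ i, X i = (fun b : Bool => if b = true then (1 : ℝ) else 0) ∘
        fun ω => (S ω).keep ℓ i := fun i => by
      ext ω; by_cases h : (S ω).keep ℓ i = true <;> simp [hX, h]
    rw [h2 i, h2 j]; exact h1
  have hE : ∫ ω, (∑ i ∈ I, X i) ω ∂μ = I.card / 2 ^ (ℓ : ℕ) := by
    simp only [Finset.sum_apply]
    rw [integral_finsetSum _ fun i _ => (hXb i).integrable (by norm_num)]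
    simp [hXE, div_eq_mul_inv]
  have h := meas_ge_le_variance_div_sq (memLp_finsetSum' I fun i _ => hXb i) ht
  rw [hE] at h
  simp only [hsum]
  refine h.trans (ENNReal.ofReal_le_ofReal ?_)
  gcongr
  rw [IndepFun.variance_sum (fun i _ => hXb i) hind]
  refine (Finset.sum_le_sum fun i _ => hXV i).trans_eq ?_
  simp [div_eq_mul_inv]

theorem measurable_finset {α : Type*} [MeasurableSpace α] {I : α → Finset (Fin n)}
    (h : ∀ i, MeasurableSet {z | i ∈ I z}) : @Measurable _ _ _ ⊤ I := by
  let _ : MeasurableSpace (Finset (Fin n)) := ⊤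
  refine measurable_to_countable' fun J => ?_
  have h1 : I ⁻¹' {J} = ⋂ i, {z | i ∈ I z ↔ i ∈ J} := by
    ext z; simp [Finset.ext_iff]
  rw [h1]
  refine MeasurableSet.iInter fun i => ?_
  by_cases hi : i ∈ J
  · simpa [hi] using h i
  · simp only [hi, iff_false]
    exact (h i).compl

/-- The sets `I`, `O`, `G` may depend on the random shift, since that is independent of the
downsampling. -/
theorem measure_sample_le (hS : IsRandomSeed μ S) {I O G : ℝ → Finset (Fin n)}
    (hI : ∀ i, MeasurableSet {z | i ∈ I z}) (hO : ∀ i, MeasurableSet {z | i ∈ O z})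
    (hG : ∀ i, MeasurableSet {z | i ∈ G z}) {s t V : ℝ} (hs : 0 < s) (ht : 0 < t) (hV : 0 < V) :
    μ {ω | ∃ ℓ : Fin (rates n + 1),
      (s ≤ (I (S ω).ζ).card / 2 ^ (ℓ : ℕ) ∧ ((I (S ω).ζ).card : ℝ) / 2 ^ (ℓ : ℕ) < 2 * s ∧
        ((O (S ω).ζ).card : ℝ) / 2 ^ (ℓ : ℕ) ≤ 3 * s ∧
        ((G (S ω).ζ).card : ℝ) / 2 ^ (ℓ : ℕ) ≤ V) ∧
      (t ≤ |(((I (S ω).ζ).filter fun i => (S ω).keep ℓ i = true).card : ℝ) -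
          (I (S ω).ζ).card / 2 ^ (ℓ : ℕ)| ∨
        t ≤ |(((O (S ω).ζ).filter fun i => (S ω).keep ℓ i = true).card : ℝ) -
          (O (S ω).ζ).card / 2 ^ (ℓ : ℕ)| ∨
        V ≤ |(((G (S ω).ζ).filter fun i => (S ω).keep ℓ i = true).card : ℝ) -
          (G (S ω).ζ).card / 2 ^ (ℓ : ℕ)|)} ≤ ENNReal.ofReal (5 * s / t ^ 2 + 1 / V) := by
  let _ : MeasurableSpace (Finset (Fin n)) := ⊤
  set Y : Ω → Finset (Fin n) × Finset (Fin n) × Finset (Fin n) := fun ω =>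
    (I (S ω).ζ, O (S ω).ζ, G (S ω).ζ) with hY
  have hφ : Measurable fun z => (I z, O z, G z) :=
    (measurable_finset hI).prodMk ((measurable_finset hO).prodMk (measurable_finset hG))
  have hYm : Measurable Y := hφ.comp hS.measurable_ζ
  have hind : IndepFun Y (fun ω => (S ω).keep) μ := hS.ζ_indep.comp hφ measurable_fst
  set D : Finset (Fin n) × Finset (Fin n) × Finset (Fin n) →
      Set (Fin (rates n + 1) → Fin n → Bool) := fun p => {κ | ∃ ℓ : Fin (rates n + 1),
      (s ≤ (p.1.card : ℝ) / 2 ^ (ℓ : ℕ) ∧ (p.1.card : ℝ) / 2 ^ (ℓ : ℕ) < 2 * s ∧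
        (p.2.1.card : ℝ) / 2 ^ (ℓ : ℕ) ≤ 3 * s ∧ (p.2.2.card : ℝ) / 2 ^ (ℓ : ℕ) ≤ V) ∧
      (t ≤ |((p.1.filter fun i => κ ℓ i = true).card : ℝ) - p.1.card / 2 ^ (ℓ : ℕ)| ∨
        t ≤ |((p.2.1.filter fun i => κ ℓ i = true).card : ℝ) - p.2.1.card / 2 ^ (ℓ : ℕ)| ∨
        V ≤ |((p.2.2.filter fun i => κ ℓ i = true).card : ℝ) - p.2.2.card / 2 ^ (ℓ : ℕ)|)}
    with hD
  refine measure_le_of_indepFun hYm hind D (fun p => (Set.toFinite _).measurableSet) fun p => ?_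
  by_cases hex : ∃ ℓ : Fin (rates n + 1),
      s ≤ (p.1.card : ℝ) / 2 ^ (ℓ : ℕ) ∧ (p.1.card : ℝ) / 2 ^ (ℓ : ℕ) < 2 * s ∧
        (p.2.1.card : ℝ) / 2 ^ (ℓ : ℕ) ≤ 3 * s ∧ (p.2.2.card : ℝ) / 2 ^ (ℓ : ℕ) ≤ V
  · obtain ⟨ℓ, h1, h2, h3, h4⟩ := hex
    -- Dividing by powers of two hits the window `[s, 2s)` at most once. So for fixed sets only one
    -- rate matters, and no union bound over the rates is needed.
    have huniq : ∀ ℓ' : Fin (rates n + 1), s ≤ (p.1.card : ℝ) / 2 ^ (ℓ' : ℕ) →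
        (p.1.card : ℝ) / 2 ^ (ℓ' : ℕ) < 2 * s → ℓ' = ℓ := by
      have aux : ∀ a b : ℕ, a < b → s ≤ (p.1.card : ℝ) / 2 ^ b →
          (p.1.card : ℝ) / 2 ^ a < 2 * s → False := by
        intro a b hab hb ha
        rw [le_div_iff₀ (by positivity)] at hb
        rw [div_lt_iff₀ (by positivity)] at ha
        have : (2 : ℝ) ^ (a + 1) ≤ 2 ^ b := pow_le_pow_right₀ (by norm_num) hab
        rw [pow_succ] at this
        nlinarith
      intro ℓ' h1' h2'
      by_contra hne
      rcases lt_or_gt_of_ne (fun h => hne (Fin.ext h) : (ℓ' : ℕ) ≠ ℓ) with h | h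
      · exact aux _ _ h h1 h2'
      · exact aux _ _ h h1' h2
    refine (measure_mono (t := {ω | t ≤ |((p.1.filter fun i => (S ω).keep ℓ i = true).card : ℝ) -
        p.1.card / 2 ^ (ℓ : ℕ)|} ∪ ({ω | t ≤ |((p.2.1.filter fun i => (S ω).keep ℓ i = true).card : ℝ)
        - p.2.1.card / 2 ^ (ℓ : ℕ)|} ∪ {ω | V ≤ |((p.2.2.filter fun i =>
          (S ω).keep ℓ i = true).card : ℝ) - p.2.2.card / 2 ^ (ℓ : ℕ)|})) ?_).trans ?_
    · rintro ω ⟨ℓ', ⟨h1', h2', -⟩, h5⟩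
      rw [huniq ℓ' h1' h2'] at h5
      exact h5
    · refine (measure_union_le _ _).trans
        ((add_le_add (measure_card_keep_le hS ℓ _ ht) ((measure_union_le _ _).trans
        (add_le_add (measure_card_keep_le hS ℓ _ ht) (measure_card_keep_le hS ℓ _ hV)))).trans ?_)
      rw [← ENNReal.ofReal_add (by positivity) (by positivity),
        ← ENNReal.ofReal_add (by positivity) (by positivity)]
      refine ENNReal.ofReal_le_ofReal ?_
      have e1 : (p.1.card : ℝ) / 2 ^ (ℓ : ℕ) / t ^ 2 ≤ 2 * s / t ^ 2 := by gcongr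
      have e2 : (p.2.1.card : ℝ) / 2 ^ (ℓ : ℕ) / t ^ 2 ≤ 3 * s / t ^ 2 := by gcongr
      have e3 : (p.2.2.card : ℝ) / 2 ^ (ℓ : ℕ) / V ^ 2 ≤ V / V ^ 2 := by gcongr
      have e4 : V / V ^ 2 = 1 / V := by field_simp
      have e5 : 5 * s / t ^ 2 = 2 * s / t ^ 2 + 3 * s / t ^ 2 := by ring
      linarith
  · have : (fun ω => (S ω).keep) ⁻¹' D p = ∅ := by
      refine Set.eq_empty_of_forall_notMem ?_
      rintro ω ⟨ℓ, h, -⟩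
      exact hex ⟨ℓ, h⟩
    rw [this, measure_empty]; exact zero_le

end Sampling

/-! ### The random shift -/

section Shift

variable {Ω : Type*} [MeasurableSpace Ω] {μ : Measure Ω}

theorem measure_uniform_le {Z : Ω → ℝ} (hZ : Measurable Z)
    (hu : pdf.IsUniform Z (Set.Icc (1 / 2) 1) μ volume) {D : Set ℝ} (hD : MeasurableSet D)
    {a b : ℝ} (h : D ∩ Set.Icc (1 / 2) 1 ⊆ Set.Icc a b) :
    μ (Z ⁻¹' D) ≤ ENNReal.ofReal (2 * (b - a)) := by
  rw [← Measure.map_apply hZ hD, show μ.map Z = _ from hu, ProbabilityTheory.cond_apply measurableSet_Icc,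
    Set.inter_comm, Real.volume_Icc, ENNReal.ofReal_mul (by norm_num)]
  refine mul_le_mul' ?_ ((measure_mono h).trans_eq Real.volume_Icc)
  rw [← ENNReal.ofReal_inv_of_pos (by norm_num)]
  norm_num

theorem ae_uniform_mem {Z : Ω → ℝ} (hZ : Measurable Z)
    (hu : pdf.IsUniform Z (Set.Icc (1 / 2) 1) μ volume) :
    μ {ω | Z ω ∉ Set.Icc (1 / 2 : ℝ) 1} = 0 := by
  have := measure_uniform_le hZ hu (D := (Set.Icc (1 / 2) 1)ᶜ) measurableSet_Icc.compl
    (a := 0) (b := 0) (by simp)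
  rw [sub_self, mul_zero, ENNReal.ofReal_zero] at this
  exact le_antisymm this zero_le

theorem sum_geometric_filter_le {u b : ℝ} (hu : 0 ≤ u) (hb : 0 ≤ b) (N : ℕ) :
    ∑ j ∈ Finset.range N, (if 2 ^ j * u ≤ b then 2 ^ j * u else 0) ≤ 2 * b := by
  have hgeo : ∀ N : ℕ, ∑ j ∈ Finset.range N, (if 2 ^ j * u ≤ b then 2 ^ j * u else 0) ≤
      2 ^ N * u := by
    intro N
    induction N with
    | zero => simpa using hu
    | succ k ih =>
      rw [Finset.sum_range_succ, pow_succ]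
      have : 0 ≤ 2 ^ k * u := by positivity
      split_ifs <;> linarith
  induction N with
  | zero => simpa using hb
  | succ k ih =>
    rw [Finset.sum_range_succ]
    split_ifs with h
    · linarith [hgeo k]
    · linarith

/-- The mass of those `x i` that lie in `[αzM̂/2^j, βzM̂/2^j]`, summed over `j < N`. -/
noncomputable def stripMass {n : ℕ} (α β Mhat : ℝ) (N : ℕ) (x : Fin n → ℝ) (z : ℝ) : ℝ :=
  ∑ j ∈ Finset.range N, ∑ i,
    {z | α * (z * Mhat / 2 ^ j) ≤ x i ∧ x i ≤ β * (z * Mhat / 2 ^ j)}.indicator (fun _ => x i) z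

theorem measurableSet_strip (α β Mhat : ℝ) (j : ℕ) (x : ℝ) :
    MeasurableSet {z : ℝ | α * (z * Mhat / 2 ^ j) ≤ x ∧ x ≤ β * (z * Mhat / 2 ^ j)} :=
  (measurableSet_le (f := fun z => α * (z * Mhat / 2 ^ j)) (by fun_prop) measurable_const).inter
    (measurableSet_le (g := fun z => β * (z * Mhat / 2 ^ j)) measurable_const (by fun_prop))

theorem measurable_stripMass {n : ℕ} (α β Mhat : ℝ) (N : ℕ) (x : Fin n → ℝ) :
    Measurable (stripMass α β Mhat N x) :=
  Finset.measurable_fun_sum _ fun j _ => Finset.measurable_fun_sum _ fun i _ =>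
    measurable_const.indicator (measurableSet_strip α β Mhat j (x i))

/-- With `u = x/M̂`, the strip of level `j` confines `z` to an interval of length `2^j u (β -
α)/(αβ)`, and it is out of reach when `2^j u > β`, since `z ≤ 1`. The density is `2` and the
admissible `2^j u` add up to at most `2β`, so the sum is at most `4(β - α)/α`, uniformly in `N`. -/
theorem measure_strip_le {Z : Ω → ℝ} (hZ : Measurable Z)
    (hu : pdf.IsUniform Z (Set.Icc (1 / 2) 1) μ volume) {α β Mhat x : ℝ} (hα : 1 ≤ α)
    (hαβ : α < β) (hM : 0 < Mhat) (hx : 0 ≤ x) (N : ℕ) :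
    ∑ j ∈ Finset.range N, μ (Z ⁻¹' {z | α * (z * Mhat / 2 ^ j) ≤ x ∧ x ≤ β * (z * Mhat / 2 ^ j)}) ≤
      ENNReal.ofReal (4 * (β - α)) := by
  set u := x / Mhat with hu'
  have hu0 : 0 ≤ u := by positivity
  have hj : ∀ j : ℕ, μ (Z ⁻¹' {z | α * (z * Mhat / 2 ^ j) ≤ x ∧ x ≤ β * (z * Mhat / 2 ^ j)}) ≤
      ENNReal.ofReal (2 * ((if 2 ^ j * u ≤ β then 2 ^ j * u else 0) * ((β - α) / (α * β)))) := by
    intro j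
    have hz : ∀ z ∈ {z : ℝ | α * (z * Mhat / 2 ^ j) ≤ x ∧ x ≤ β * (z * Mhat / 2 ^ j)},
        α * z ≤ 2 ^ j * u ∧ 2 ^ j * u ≤ β * z := by
      intro z ⟨h1, h2⟩
      rw [hu', ← mul_div_assoc, le_div_iff₀ hM, div_le_iff₀ hM]
      rw [← mul_div_assoc, div_le_iff₀ (by positivity)] at h1
      rw [← mul_div_assoc, le_div_iff₀ (by positivity)] at h2
      constructor <;> nlinarith
    split_ifs with h
    · refine (measure_uniform_le hZ hu (measurableSet_strip α β Mhat j x)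
        (a := 2 ^ j * u / β) (b := 2 ^ j * u / α) ?_).trans_eq ?_
      · intro z hz'
        obtain ⟨h1, h2⟩ := hz z hz'.1
        rw [Set.mem_Icc, div_le_iff₀ (by linarith), le_div_iff₀ (by linarith)]
        constructor <;> linarith
      · congr 2
        have : α ≠ 0 := by linarith
        have : β ≠ 0 := by linarith
        field_simp
    · refine (measure_uniform_le hZ hu (measurableSet_strip α β Mhat j x)
        (a := 0) (b := 0) ?_).trans (by simp)
      intro z hz'
      obtain ⟨h1, h2⟩ := hz z hz'.1
      have := hz'.2.2
      exact absurd (h2.trans (by nlinarith)) h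
  refine (Finset.sum_le_sum fun j _ => hj j).trans ?_
  have hpos : 0 ≤ (β - α) / (α * β) := div_nonneg (by linarith) (by nlinarith)
  rw [← ENNReal.ofReal_sum_of_nonneg fun j _ => by
    refine mul_nonneg zero_le_two (mul_nonneg ?_ hpos)
    split_ifs <;> positivity, ← Finset.mul_sum, ← Finset.sum_mul]
  refine ENNReal.ofReal_le_ofReal ?_
  have h1 := mul_le_mul_of_nonneg_right
    (sum_geometric_filter_le hu0 (by linarith : (0 : ℝ) ≤ β) N) hpos
  have h2 : 2 * β * ((β - α) / (α * β)) = 2 * ((β - α) / α) := by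
    have : α ≠ 0 := by linarith
    have : β ≠ 0 := by linarith
    field_simp
  have h3 : (β - α) / α ≤ β - α := div_le_self (by linarith) hα
  linarith

/-- The expected mass in the strips is at most `4(β - α)` times the total, whatever the numbers `x
i` are; Markov's inequality does the rest. -/
theorem measure_stripMass_le {Z : Ω → ℝ} (hZ : Measurable Z)
    (hu : pdf.IsUniform Z (Set.Icc (1 / 2) 1) μ volume) {n : ℕ} {α β Mhat η : ℝ} (hα : 1 ≤ α)
    (hαβ : α < β) (hM : 0 < Mhat) {x : Fin n → ℝ} (hx : ∀ i, 0 ≤ x i) (hη : 0 < η) (N : ℕ) :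
    μ {ω | η * ∑ i, x i < stripMass α β Mhat N x (Z ω)} ≤ ENNReal.ofReal (4 * (β - α) / η) := by
  have hαβ' : 0 < β - α := by linarith
  have hsum : 0 ≤ ∑ i, x i := Finset.sum_nonneg fun i _ => hx i
  have hint : ∫⁻ ω, ENNReal.ofReal (stripMass α β Mhat N x (Z ω)) ∂μ ≤
      ENNReal.ofReal (4 * (β - α) * ∑ i, x i) := by
    have hnn : ∀ j i (ω : Ω), 0 ≤ {z | α * (z * Mhat / 2 ^ j) ≤ x i ∧
        x i ≤ β * (z * Mhat / 2 ^ j)}.indicator (fun _ => x i) (Z ω) := fun j i ω =>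
      Set.indicator_nonneg (fun _ _ => hx i) _
    have h1 : ∀ ω, ENNReal.ofReal (stripMass α β Mhat N x (Z ω)) =
        ∑ i, ∑ j ∈ Finset.range N, (Z ⁻¹' {z | α * (z * Mhat / 2 ^ j) ≤ x i ∧
          x i ≤ β * (z * Mhat / 2 ^ j)}).indicator (fun _ => ENNReal.ofReal (x i)) ω := by
      intro ω
      rw [stripMass, Finset.sum_comm, ENNReal.ofReal_sum_of_nonneg fun i _ =>
        Finset.sum_nonneg fun j _ => hnn j i ω]
      refine Finset.sum_congr rfl fun i _ => ?_
      rw [ENNReal.ofReal_sum_of_nonneg fun j _ => hnn j i ω]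
      refine Finset.sum_congr rfl fun j _ => ?_
      by_cases h : Z ω ∈ {z | α * (z * Mhat / 2 ^ j) ≤ x i ∧ x i ≤ β * (z * Mhat / 2 ^ j)}
      · rw [Set.indicator_of_mem h, Set.indicator_of_mem (by exact h)]
      · rw [Set.indicator_of_notMem h, Set.indicator_of_notMem (by exact h), ENNReal.ofReal_zero]
    simp only [h1]
    have hms : ∀ j i, MeasurableSet (Z ⁻¹' {z | α * (z * Mhat / 2 ^ j) ≤ x i ∧
        x i ≤ β * (z * Mhat / 2 ^ j)}) := fun j i => hZ (measurableSet_strip α β Mhat j (x i))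
    rw [lintegral_finsetSum _ fun i _ => Finset.measurable_fun_sum _ fun j _ =>
      measurable_const.indicator (hms j i), ENNReal.ofReal_mul (by positivity),
      ENNReal.ofReal_sum_of_nonneg fun i _ => hx i, Finset.mul_sum]
    refine Finset.sum_le_sum fun i _ => ?_
    rw [lintegral_finsetSum _ fun j _ => measurable_const.indicator (hms j i)]
    simp only [lintegral_indicator_const (hms _ i)]
    rw [← Finset.mul_sum, mul_comm]
    gcongr
    exact measure_strip_le hZ hu hα hαβ hM (hx i) N
  have h := measure_mul_lt_le ((measurable_stripMass α β Mhat N x).comp hZ)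
    (by positivity) hint (c := η / (4 * (β - α))) (by positivity)
  have e1 : η / (4 * (β - α)) * (4 * (β - α) * ∑ i, x i) = η * ∑ i, x i := by field_simp
  rw [e1, ← ENNReal.ofReal_inv_of_pos (by positivity), inv_div] at h
  exact h

end Shift

end HSketch

namespace HSketch

/-! ### Top indices -/

section Top

variable {n : ℕ} {k : ℕ} {x : Fin n → ℝ}

theorem mem_topIndices_of_card_le {i : Fin n} (h : Finset.card {i' | x i ≤ x i'} ≤ k) :
    i ∈ topIndices k x := by
  rw [topIndices, Finset.mem_filter]
  refine ⟨Finset.mem_univ i, lt_of_lt_of_le (Finset.card_lt_card ?_) h⟩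
  rw [Finset.ssubset_iff_of_subset]
  · exact ⟨i, by simp, by simp⟩
  · intro i' hi'
    simp only [Finset.mem_filter, Finset.mem_univ, true_and] at hi' ⊢
    rcases hi' with h | h
    · exact h.le
    · exact h.1.ge

/-- The position of `i` in the order used by `topIndices`. -/
noncomputable def rankOf (x : Fin n → ℝ) (i : Fin n) : ℕ :=
  Finset.card {i' : Fin n | x i < x i' ∨ (x i' = x i ∧ i' < i)}

theorem rankOf_lt_rankOf {i j : Fin n} (h : x i < x j ∨ (x j = x i ∧ j < i)) :
    rankOf x j < rankOf x i := by
  refine Finset.card_lt_card ?_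
  rw [Finset.ssubset_iff_of_subset]
  · exact ⟨j, by simpa using h, by simp⟩
  · intro i' hi'
    simp only [Finset.mem_filter, Finset.mem_univ, true_and] at hi' ⊢
    rcases hi' with h' | h' <;> rcases h with h | h
    · exact Or.inl (h.trans h')
    · exact Or.inl (h.1 ▸ h')
    · exact Or.inl (h'.1 ▸ h)
    · exact Or.inr ⟨h'.1.trans h.1, h'.2.trans h.2⟩

theorem rankOf_injective : Function.Injective (rankOf x) := by
  intro i j hij
  by_contra hne
  rcases lt_trichotomy (x i) (x j) with h | h | h
  · exact (rankOf_lt_rankOf (Or.inl h)).ne hij.symm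
  · rcases lt_or_gt_of_ne hne with h' | h'
    · exact (rankOf_lt_rankOf (x := x) (i := j) (j := i) (Or.inr ⟨h, h'⟩)).ne hij
    · exact (rankOf_lt_rankOf (x := x) (i := i) (j := j) (Or.inr ⟨h.symm, h'⟩)).ne hij.symm
  · exact (rankOf_lt_rankOf (Or.inl h)).ne hij

theorem rankOf_lt (i : Fin n) : rankOf x i < n := by
  refine (Finset.card_lt_univ_of_notMem (x := i) (by simp)).trans_eq (by simp)

/-- Breaking ties by index makes the rank a bijection onto `Fin n`. If some index is left out, all
ranks below `k` occur and belong to the top set. -/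
theorem card_topIndices_of_notMem {i : Fin n} (h : i ∉ topIndices k x) :
    k ≤ (topIndices k x).card := by
  have hk : k ≤ rankOf x i := by simpa [topIndices, rankOf] using h
  have hsurj : Function.Surjective fun i : Fin n => (⟨rankOf x i, rankOf_lt i⟩ : Fin n) :=
    Finite.injective_iff_surjective.1 fun a b hab => rankOf_injective (Fin.mk.inj hab)
  have hsub : Finset.range k ⊆ (topIndices k x).image (rankOf x) := by
    intro r hr
    have hr' := Finset.mem_range.1 hr
    obtain ⟨a, ha⟩ := hsurj ⟨r, hr'.trans (hk.trans_lt (rankOf_lt i))⟩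
    have ha' : rankOf x a = r := Fin.mk.inj ha
    refine Finset.mem_image.2 ⟨a, ?_, ha'⟩
    rw [topIndices, Finset.mem_filter]
    exact ⟨Finset.mem_univ a, by change rankOf x a < k; omega⟩
  calc k = (Finset.range k).card := (Finset.card_range k).symm
    _ ≤ _ := (Finset.card_le_card hsub).trans Finset.card_image_le

theorem le_of_notMem_topIndices {i i' : Fin n} (h : i ∉ topIndices k x)
    (h' : i' ∈ topIndices k x) : x i ≤ x i' := by
  have hk : k ≤ rankOf x i := by simpa [topIndices, rankOf] using h
  have hk' : rankOf x i' < k := by simpa [topIndices, rankOf] using h'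
  by_contra hc
  have := rankOf_lt_rankOf (x := x) (i := i') (j := i) (Or.inl (not_le.1 hc))
  omega

end Top

/-! ### Bounds on the parameters -/

theorem le_two_pow_ceil_logb {x : ℝ} (hx : 0 < x) : x ≤ 2 ^ ⌈Real.logb 2 x⌉₊ := by
  rw [← Real.rpow_natCast, ← Real.logb_le_iff_le_rpow (by norm_num) hx]
  exact Nat.le_ceil _

theorem two_pow_ceil_logb_le {x : ℝ} (hx : 1 ≤ x) : (2 : ℝ) ^ ⌈Real.logb 2 x⌉₊ ≤ 2 * x := by
  have h1 := Nat.ceil_lt_add_one (Real.logb_nonneg (by norm_num : (1 : ℝ) < 2) hx)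
  rw [← Real.rpow_natCast]
  calc (2 : ℝ) ^ ((⌈Real.logb 2 x⌉₊ : ℕ) : ℝ) ≤ 2 ^ (Real.logb 2 x + 1) :=
        Real.rpow_le_rpow_of_exponent_le (by norm_num) h1.le
    _ = 2 * x := by
        rw [Real.rpow_add (by norm_num), Real.rpow_logb (by norm_num) (by norm_num) (by linarith)]
        simp [mul_comm]

theorem le_two_pow_levels {K ε : ℝ} {n : ℕ} (hK : 1 ≤ K) (hε : 0 < ε) (hn : 0 < n) :
    K * n / ε ≤ 2 ^ levels K ε n := by
  have : (0 : ℝ) < n := by exact_mod_cast hn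
  exact le_two_pow_ceil_logb (by positivity)

theorem natCast_le_two_pow_rates {n : ℕ} (hn : 0 < n) : (n : ℝ) ≤ 2 ^ rates n :=
  le_two_pow_ceil_logb (by exact_mod_cast hn)

theorem rates_add_one_le_levels {K ε : ℝ} {n : ℕ} (hK : 1 ≤ K) (hε : 0 < ε) (hε1 : ε ≤ 1 / 2)
    (hn : 0 < n) : rates n + 1 ≤ levels K ε n := by
  have hn' : (1 : ℝ) ≤ n := by exact_mod_cast hn
  have h0 : 0 ≤ Real.logb 2 n := Real.logb_nonneg (by norm_num) hn'
  rw [rates, ← Nat.ceil_add_one h0]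
  refine Nat.ceil_mono ?_
  have h1 : Real.logb 2 n + 1 = Real.logb 2 (n * 2) := by
    rw [Real.logb_mul (by linarith) (by norm_num), Real.logb_self_eq_one (by norm_num)]
  rw [h1]
  refine Real.logb_le_logb_of_le (by norm_num) (by linarith) ?_
  rw [le_div_iff₀ hε]
  nlinarith

theorem le_levels {K ε : ℝ} {n m : ℕ} (hK : 1 ≤ K) (hε : 0 < ε) (hε1 : ε ≤ (1 / 2) ^ m)
    (hn : 0 < n) : m ≤ levels K ε n := by
  have hn' : (1 : ℝ) ≤ n := by exact_mod_cast hn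
  have h1 := le_two_pow_levels hK hε hn
  have h2 : (2 : ℝ) ^ m ≤ K * n / ε := by
    rw [le_div_iff₀ hε]
    calc (2 : ℝ) ^ m * ε ≤ 2 ^ m * (1 / 2) ^ m := by gcongr
      _ = 1 := by rw [← mul_pow]; norm_num
      _ ≤ K * n := by nlinarith
  exact (pow_le_pow_iff_right₀ (by norm_num : (1 : ℝ) < 2)).1 (h2.trans h1)

/-- The constants used in the proof. -/
noncomputable def stdConstants : Constants where
  cw := 1
  cR := 8
  ν := 1 / 20
  cφ₀ := 1
  cφ := 1
  cΛ := 1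
  cw_pos := by norm_num
  cR_pos := by norm_num
  ν_pos := by norm_num
  ν_le := by norm_num
  cφ₀_pos := by norm_num
  cφ_pos := by norm_num
  cΛ_pos := by norm_num

theorem le_width {K ε : ℝ} {n : ℕ} (hK : 1 ≤ K) (hε : 0 < ε) (hL : 0 < levels K ε n)
    (ℓ : Fin (rates n + 1)) :
    8000 * (levels K ε n : ℝ) ^ 6 / ε ^ 6 ≤ width stdConstants K ε n ℓ := by
  have hL' : (0 : ℝ) < levels K ε n := by exact_mod_cast hL
  refine le_trans ?_ (Nat.le_ceil _)
  have hφ : phi stdConstants K ε n ℓ ≤ ε ^ 3 / (levels K ε n : ℝ) ^ 3 := by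
    unfold phi
    split_ifs
    · simp only [stdConstants, one_mul]
      refine div_le_div_of_nonneg_left (by positivity) (by positivity) ?_
      have : (0 : ℝ) < (levels K ε n : ℝ) ^ 3 := by positivity
      nlinarith
    · simp [stdConstants]
  have hφ0 : 0 < phi stdConstants K ε n ℓ := by
    unfold phi
    have hK0 : 0 < K := by linarith
    split_ifs <;> simp only [stdConstants, one_mul] <;> positivity
  -- `8000 = 1/ν³` for `ν = 1/20`. The smaller `φ` of the structure for the full matrix only
  -- enlarges its width, because `K ≥ 1`.
  calc 8000 * (levels K ε n : ℝ) ^ 6 / ε ^ 6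
      = 1 / ((ε ^ 3 / (levels K ε n : ℝ) ^ 3) ^ 2 * (1 / 20) ^ 3) := by
        field_simp; norm_num
    _ ≤ 1 / (phi stdConstants K ε n ℓ ^ 2 * (1 / 20) ^ 3) := by gcongr
    _ = _ := rfl

theorem tol_sq_le {K ε : ℝ} {n d : ℕ} (hK : 1 ≤ K) (hε : 0 < ε) (hL : 0 < levels K ε n)
    (B : Matrix (Fin n) (Fin (d + 1)) ℝ) (σ : Seed stdConstants K ε n) (ℓ : Fin (rates n + 1)) :
    tol g B σ ℓ ^ 2 ≤ mass g (downsample B σ ℓ) * (ε ^ 6 / (levels K ε n : ℝ) ^ 6) := by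
  have hL' : (0 : ℝ) < levels K ε n := by exact_mod_cast hL
  have hm : 0 ≤ mass g (downsample B σ ℓ) :=
    Finset.sum_nonneg fun _ _ => pow_nonneg (norm_nonneg _) 2
  have hw := le_width hK hε hL ℓ
  rw [tol, Real.sq_sqrt (by positivity)]
  have hq : 0 < 8000 * (levels K ε n : ℝ) ^ 6 / ε ^ 6 := by positivity
  calc 128 * mass g (downsample B σ ℓ) / (width stdConstants K ε n ℓ)
      ≤ 128 * mass g (downsample B σ ℓ) / (8000 * (levels K ε n : ℝ) ^ 6 / ε ^ 6) := by gcongr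
    _ = (128 / 8000) * (mass g (downsample B σ ℓ) * (ε ^ 6 / (levels K ε n : ℝ) ^ 6)) := by
        field_simp
    _ ≤ 1 * (mass g (downsample B σ ℓ) * (ε ^ 6 / (levels K ε n : ℝ) ^ 6)) := by
        gcongr; norm_num
    _ = _ := one_mul _

theorem downsample_eq_of_norm_pos {c : Constants} {K ε : ℝ} {n d : ℕ}
    {B : Matrix (Fin n) (Fin (d + 1)) ℝ} {σ : Seed c K ε n} {ℓ : Fin (rates n + 1)} {i : Fin n}
    (h : 0 < ‖g (downsample B σ ℓ i)‖ ^ 2) :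
    σ.keep ℓ i = true ∧ downsample B σ ℓ i = B i := by
  by_cases hk : σ.keep ℓ i = true
  · exact ⟨hk, by simp [downsample_apply, hk]⟩
  · simp [downsample_apply, hk, norm_g_zero] at h

/-- An additive error of `κ√T` is a relative error for numbers above `√T`. -/
theorem sq_bounds_of_abs_sub_le {a x τ κ T : ℝ} (ha : 0 ≤ a) (hx : 0 ≤ x)
    (hκ : 0 ≤ κ) (hκ1 : κ ≤ 1) (hax : |a - x| ≤ τ) (hτ : τ ≤ κ * √T) (hT : T ≤ x ^ 2) :
    (1 - κ) ^ 2 * x ^ 2 ≤ a ^ 2 ∧ a ^ 2 ≤ (1 + κ) ^ 2 * x ^ 2 := by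
  have h1 : √T ≤ x := Real.sqrt_le_iff.2 ⟨hx, hT⟩
  have h2 : τ ≤ κ * x := hτ.trans (mul_le_mul_of_nonneg_left h1 hκ)
  obtain ⟨h3, h4⟩ := abs_le.1 hax
  rw [← mul_pow, ← mul_pow]
  exact ⟨pow_le_pow_left₀ (mul_nonneg (by linarith) hx) (by linarith) 2,
    pow_le_pow_left₀ ha (by linarith) 2⟩

/-- Every number is small, in one of the levels or in one of the gaps between the levels. -/
theorem level_cover {lo up Mhat y z : ℝ} (hM : 0 ≤ Mhat) (hlo : 0 ≤ lo) (hz : 1 / 2 ≤ z)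
    (hy : y ≤ lo * Mhat) (J : ℕ) (hJ : lo * (z * Mhat / 2 ^ J) ≤ y) :
    ∃ j ≤ J, (lo * (z * Mhat / 2 ^ j) ≤ y ∧ y ≤ up * (z * Mhat / 2 ^ j)) ∨
      (up * (z * Mhat / 2 ^ j) ≤ y ∧ y ≤ 2 * lo * (z * Mhat / 2 ^ j)) := by
  classical
  have hex : ∃ j, lo * (z * Mhat / 2 ^ j) ≤ y := ⟨J, hJ⟩
  -- The first level whose lower end is below `y`. The previous level has twice the scale and its
  -- lower end exceeds `y`; for level `0` the hypotheses on `y` and `z ≥ 1/2` replace this.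
  refine ⟨Nat.find hex, Nat.find_min' hex hJ, ?_⟩
  have h1 := Nat.find_spec hex
  have h2 : y ≤ 2 * lo * (z * Mhat / 2 ^ Nat.find hex) := by
    rcases hj : Nat.find hex with _ | j
    · rw [pow_zero, div_one]
      nlinarith [mul_nonneg hlo hM]
    · have h3 := Nat.find_min hex (m := j) (by omega)
      have h4 : z * Mhat / 2 ^ j = 2 * (z * Mhat / 2 ^ (j + 1)) := by
        rw [pow_succ]; field_simp
      rw [h4] at h3
      linarith
  rcases le_total y (up * (z * Mhat / 2 ^ Nat.find hex)) with h | h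
  · exact Or.inl ⟨h1, h⟩
  · exact Or.inr ⟨h, h2⟩

end HSketch

namespace HSketch

/-! ### Favourable seeds -/

/-- The relative width of the strips around the boundaries of the levels in which the estimates may
be on the wrong side. -/
noncomputable def rho (K ε : ℝ) (n : ℕ) : ℝ := ε / (10 ^ 5 * levels K ε n)

section

variable {n d : ℕ}

/-- The rows that are in level `j` with some room to spare. -/
noncomputable def inner (K ε : ℝ) (B : Matrix (Fin n) (Fin (d + 1)) ℝ) (Mhat : ℝ) (j : ℕ) (z : ℝ) :
    Finset (Fin n) :=
  {i | (1 + ε) * (1 + rho K ε n) * (z * Mhat / 2 ^ j) ≤ ‖g (B i)‖ ^ 2 ∧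
    ‖g (B i)‖ ^ 2 ≤ (2 - ε) * (1 - rho K ε n) * (z * Mhat / 2 ^ j)}

/-- The rows that may be taken for rows in level `j`. -/
noncomputable def outer (K ε : ℝ) (B : Matrix (Fin n) (Fin (d + 1)) ℝ) (Mhat : ℝ) (j : ℕ) (z : ℝ) :
    Finset (Fin n) :=
  {i | (1 + ε) * (1 - rho K ε n) * (z * Mhat / 2 ^ j) ≤ ‖g (B i)‖ ^ 2 ∧
    ‖g (B i)‖ ^ 2 ≤ (2 - ε) * (1 + rho K ε n) * (z * Mhat / 2 ^ j)}

/-- The rows that are not below level `j`. -/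
noncomputable def above (B : Matrix (Fin n) (Fin (d + 1)) ℝ) (Mhat : ℝ) (j : ℕ) (z : ℝ) :
    Finset (Fin n) :=
  {i | z * Mhat / 2 ^ j ≤ ‖g (B i)‖ ^ 2}

/-- The estimates of the heavy hitters of the structure for the full matrix. -/
noncomputable def topEstimates {c : Constants} {K ε : ℝ} (B : Matrix (Fin n) (Fin (d + 1)) ℝ)
    (σ : Seed c K ε n) (i : Fin n) : ℝ :=
  if i ∈ heavyHitters g B σ 0 then estimate g B σ 0 i else 0

/-- The seeds for which the algorithm does well. -/
structure Favourable {K ε : ℝ} (B : Matrix (Fin n) (Fin (d + 1)) ℝ) (Mhat : ℝ)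
    (σ : Seed stdConstants K ε n) : Prop where
  shift_mem : σ.ζ ∈ Set.Icc (1 / 2 : ℝ) 1
  keep_zero : ∀ i, σ.keep 0 i = true
  accurate : ∀ ℓ i, |‖g (answer g B σ ℓ i)‖ - ‖g (downsample B σ ℓ i)‖| ≤ tol g B σ ℓ
  mass_le : ∀ ℓ : Fin (rates n + 1),
    mass g (downsample B σ ℓ) ≤ 100 * ((rates n : ℝ) + 1) * (mass g B / 2 ^ (ℓ : ℕ))
  -- The part of the rows lost between the inner range of a level and that of the next larger level.
  gap : stripMass ((2 - ε) * (1 - rho K ε n)) (2 * ((1 + ε) * (1 + rho K ε n))) Mhat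
    (levels K ε n + 1) (fun i => ‖g (B i)‖ ^ 2) σ.ζ ≤ 1 / 4 * mass g B
  -- This strip and the next one contain the rows that are outer but not inner. The bound is small
  -- even against the share `mass / (2 * (L + 1))` of a single level.
  low : stripMass ((1 + ε) * (1 - rho K ε n)) ((1 + ε) * (1 + rho K ε n)) Mhat
    (levels K ε n + 1) (fun i => ‖g (B i)‖ ^ 2) σ.ζ ≤
      ε / (16 * ((levels K ε n : ℝ) + 1)) * mass g B
  high : stripMass ((2 - ε) * (1 - rho K ε n)) ((2 - ε) * (1 + rho K ε n)) Mhat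
    (levels K ε n + 1) (fun i => ‖g (B i)‖ ^ 2) σ.ζ ≤
      ε / (16 * ((levels K ε n : ℝ) + 1)) * mass g B
  -- The gaps are now those between the levels themselves, without the margin `rho`, because
  -- estimates rather than rows are placed.
  top_gap : stripMass (2 - ε) (2 * (1 + ε)) Mhat (levels K ε n + 1) (topEstimates B σ) σ.ζ ≤
    1 / 2 * ∑ i, topEstimates B σ i
  -- Concentration is asked for only at a rate at which between `s` and `2s` inner rows are expected
  -- to survive, where `s = L²/ε²`.
  sample : ∀ j ∈ Finset.range (levels K ε n + 1), ∀ ℓ : Fin (rates n + 1),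
    ((levels K ε n : ℝ) ^ 2 / ε ^ 2 ≤ (inner K ε B Mhat j σ.ζ).card / 2 ^ (ℓ : ℕ) ∧
      ((inner K ε B Mhat j σ.ζ).card : ℝ) / 2 ^ (ℓ : ℕ) < 2 * ((levels K ε n : ℝ) ^ 2 / ε ^ 2) ∧
      ((outer K ε B Mhat j σ.ζ).card : ℝ) / 2 ^ (ℓ : ℕ) ≤ 3 * ((levels K ε n : ℝ) ^ 2 / ε ^ 2) ∧
      ((above B Mhat j σ.ζ).card : ℝ) / 2 ^ (ℓ : ℕ) ≤
        8 * ((levels K ε n : ℝ) + 1) * ((levels K ε n : ℝ) ^ 2 / ε ^ 2)) →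
    |(((inner K ε B Mhat j σ.ζ).filter fun i => σ.keep ℓ i = true).card : ℝ) -
        (inner K ε B Mhat j σ.ζ).card / 2 ^ (ℓ : ℕ)| <
          2 * ε * ((levels K ε n : ℝ) ^ 2 / ε ^ 2) ∧
      |(((outer K ε B Mhat j σ.ζ).filter fun i => σ.keep ℓ i = true).card : ℝ) -
        (outer K ε B Mhat j σ.ζ).card / 2 ^ (ℓ : ℕ)| <
          2 * ε * ((levels K ε n : ℝ) ^ 2 / ε ^ 2) ∧
      |(((above B Mhat j σ.ζ).filter fun i => σ.keep ℓ i = true).card : ℝ) -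
        (above B Mhat j σ.ζ).card / 2 ^ (ℓ : ℕ)| <
          8 * ((levels K ε n : ℝ) + 1) * ((levels K ε n : ℝ) ^ 2 / ε ^ 2)

/-- The assumptions on the input. -/
structure Regime (K ε : ℝ) (B : Matrix (Fin n) (Fin (d + 1)) ℝ) (Mhat : ℝ) : Prop where
  one_le_K : 1 ≤ K
  ε_pos : 0 < ε
  Kε_le : K * ε ≤ 1 / 10 ^ 15
  n_pos : 0 < n
  le_L : 500 ≤ levels K ε n
  rates_le : rates n + 1 ≤ levels K ε n
  mass_pos : 0 < mass g B
  mass_le : mass g B ≤ Mhat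
  le_mass : Mhat ≤ K * mass g B

theorem indicator_strip_of {α β Mhat x z : ℝ} {j : ℕ}
    (h : α * (z * Mhat / 2 ^ j) ≤ x ∧ x ≤ β * (z * Mhat / 2 ^ j)) :
    {z | α * (z * Mhat / 2 ^ j) ≤ x ∧ x ≤ β * (z * Mhat / 2 ^ j)}.indicator (fun _ => x) z = x :=
  Set.indicator_of_mem (s := {z | α * (z * Mhat / 2 ^ j) ≤ x ∧ x ≤ β * (z * Mhat / 2 ^ j)}) h _

theorem le_mul_sqrt {t κ T : ℝ} (hκ : 0 ≤ κ) (h : t ^ 2 ≤ κ ^ 2 * T) : t ≤ κ * √T := by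
  have h1 := Real.le_sqrt_of_sq_le h
  rwa [Real.sqrt_mul (sq_nonneg κ), Real.sqrt_sq hκ] at h1

section

variable {K ε Mhat : ℝ} {B : Matrix (Fin n) (Fin (d + 1)) ℝ}

theorem Regime.ε_le (h : Regime K ε B Mhat) : ε ≤ 1 / 10 ^ 15 := by
  have := h.one_le_K; have := h.ε_pos; have := h.Kε_le
  nlinarith

theorem Regime.le_L' (h : Regime K ε B Mhat) : (500 : ℝ) ≤ levels K ε n := by
  exact_mod_cast h.le_L

theorem Regime.rho_pos (h : Regime K ε B Mhat) : 0 < rho K ε n := by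
  have := h.ε_pos; have := h.le_L'
  unfold rho; positivity

theorem Regime.rho_le (h : Regime K ε B Mhat) : rho K ε n ≤ ε / 2 := by
  have := h.ε_pos; have := h.le_L'
  unfold rho
  exact div_le_div_of_nonneg_left h.ε_pos.le (by norm_num) (by linarith)

theorem Regime.Mhat_pos (h : Regime K ε B Mhat) : 0 < Mhat := h.mass_pos.trans_le h.mass_le

end

variable {K ε Mhat : ℝ} {B : Matrix (Fin n) (Fin (d + 1)) ℝ} {σ : Seed stdConstants K ε n}

theorem Favourable.scale_pos (hR : Regime K ε B Mhat) (hF : Favourable B Mhat σ) (j : ℕ) :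
    0 < σ.ζ * Mhat / 2 ^ j := by
  have := hR.Mhat_pos; have := hF.shift_mem.1
  have : 0 < σ.ζ := by linarith
  positivity

/-- Some level contains its fair share of the mass. -/
theorem Favourable.exists_level (hR : Regime K ε B Mhat) (hF : Favourable B Mhat σ) :
    ∃ j ∈ Finset.range (levels K ε n + 1), mass g B / (2 * ((levels K ε n : ℝ) + 1)) ≤
      ∑ i ∈ inner K ε B Mhat j σ.ζ, ‖g (B i)‖ ^ 2 := by
  classical
  by_contra! hc
  have hε := hR.ε_pos; have hε1 := hR.ε_le; have hρ := hR.rho_pos; have hρ1 := hR.rho_le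
  have hM := hR.mass_pos
  have hn : (0 : ℝ) < n := by exact_mod_cast hR.n_pos
  have hK := hR.one_le_K
  set L := levels K ε n with hL
  set N := Finset.range (L + 1) with hN
  -- Each row is below the last level, in a gap, or inner for some level. If every level had less
  -- than its share, summation would give `M ≤ 2εM + M/4 + M/2`.
  have hi : ∀ i, ‖g (B i)‖ ^ 2 ≤ 2 * ε * mass g B / n +
      ∑ j ∈ N, {z | (2 - ε) * (1 - rho K ε n) * (z * Mhat / 2 ^ j) ≤ ‖g (B i)‖ ^ 2 ∧
        ‖g (B i)‖ ^ 2 ≤ 2 * ((1 + ε) * (1 + rho K ε n)) * (z * Mhat / 2 ^ j)}.indicator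
          (fun _ => ‖g (B i)‖ ^ 2) σ.ζ +
      ∑ j ∈ N, if i ∈ inner K ε B Mhat j σ.ζ then ‖g (B i)‖ ^ 2 else 0 := by
    intro i
    have hy0 : 0 ≤ ‖g (B i)‖ ^ 2 := sq_nonneg _
    have t1 : 0 ≤ 2 * ε * mass g B / n := by positivity
    have hnn : ∀ j ∈ N, 0 ≤ {z | (2 - ε) * (1 - rho K ε n) * (z * Mhat / 2 ^ j) ≤ ‖g (B i)‖ ^ 2 ∧
        ‖g (B i)‖ ^ 2 ≤ 2 * ((1 + ε) * (1 + rho K ε n)) * (z * Mhat / 2 ^ j)}.indicator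
          (fun _ => ‖g (B i)‖ ^ 2) σ.ζ := fun j _ => Set.indicator_nonneg (fun _ _ => hy0) _
    have hnn' : ∀ j ∈ N, 0 ≤ if i ∈ inner K ε B Mhat j σ.ζ then ‖g (B i)‖ ^ 2 else 0 :=
      fun j _ => by split_ifs <;> simp
    have t2 := Finset.sum_nonneg hnn
    have t3 := Finset.sum_nonneg hnn'
    rcases lt_or_ge (‖g (B i)‖ ^ 2) ((1 + ε) * (1 + rho K ε n) * (σ.ζ * Mhat / 2 ^ L))
      with hlt | hge
    -- `L` is chosen so that `2^L ≥ Kn/ε`; hence all the rows below the last level together are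
    -- negligible.
    · have h1 : σ.ζ * Mhat / 2 ^ L ≤ ε * mass g B / n := by
        have h2 := le_two_pow_levels hK hε hR.n_pos
        rw [div_le_iff₀ hε] at h2
        rw [div_le_div_iff₀ (by positivity) hn]
        have h3 : σ.ζ * Mhat ≤ K * mass g B := by
          have := hF.shift_mem.2; have := hR.Mhat_pos; have := hR.le_mass
          nlinarith
        calc σ.ζ * Mhat * n ≤ K * mass g B * n := by gcongr
          _ = mass g B * (K * n) := by ring
          _ ≤ mass g B * (2 ^ L * ε) := by gcongr
          _ = _ := by ring
      have h4 : (1 + ε) * (1 + rho K ε n) ≤ 2 := by nlinarith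
      have h5 := hF.scale_pos hR L
      have h6 : (1 + ε) * (1 + rho K ε n) * (σ.ζ * Mhat / 2 ^ L) ≤ 2 * ε * mass g B / n := by
        calc _ ≤ 2 * (ε * mass g B / n) := by gcongr
          _ = _ := by ring
      linarith
    · have hyM : ‖g (B i)‖ ^ 2 ≤ (1 + ε) * (1 + rho K ε n) * Mhat := by
        have h1 : ‖g (B i)‖ ^ 2 ≤ mass g B :=
          Finset.single_le_sum (f := fun i => ‖g (B i)‖ ^ 2) (fun _ _ => sq_nonneg _)
            (Finset.mem_univ i)
        have h2 : 1 ≤ (1 + ε) * (1 + rho K ε n) := by nlinarith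
        have := hR.mass_le; have := hR.Mhat_pos
        nlinarith
      obtain ⟨j, hj, h | h⟩ := level_cover (up := (2 - ε) * (1 - rho K ε n)) hR.Mhat_pos.le
        (by positivity) hF.shift_mem.1 hyM L hge
      · have hjN : j ∈ N := Finset.mem_range.2 (by omega)
        have h1 := Finset.single_le_sum hnn' hjN
        rw [if_pos (by simpa [inner] using h)] at h1
        linarith
      · have hjN : j ∈ N := Finset.mem_range.2 (by omega)
        have h1 := Finset.single_le_sum hnn hjN
        rw [indicator_strip_of h] at h1
        linarith
  have hsum := Finset.sum_le_sum fun i (_ : i ∈ Finset.univ) => hi i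
  rw [Finset.sum_add_distrib, Finset.sum_add_distrib, Finset.sum_comm,
    Finset.sum_comm (f := fun i j => if i ∈ inner K ε B Mhat j σ.ζ then ‖g (B i)‖ ^ 2 else 0)]
    at hsum
  have h1 : ∑ i : Fin n, 2 * ε * mass g B / n = 2 * ε * mass g B := by
    rw [Finset.sum_const, Finset.card_univ, Fintype.card_fin, nsmul_eq_mul]; field_simp
  have h2 : ∑ j ∈ N, ∑ i, (if i ∈ inner K ε B Mhat j σ.ζ then ‖g (B i)‖ ^ 2 else 0) ≤
      mass g B / 2 := by
    calc _ = ∑ j ∈ N, ∑ i ∈ inner K ε B Mhat j σ.ζ, ‖g (B i)‖ ^ 2 :=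
          Finset.sum_congr rfl fun j _ => by rw [← Finset.sum_filter]; simp
      _ ≤ ∑ j ∈ N, mass g B / (2 * ((L : ℝ) + 1)) :=
          Finset.sum_le_sum fun j hj => (hc j hj).le
      _ = _ := by
          rw [Finset.sum_const, Finset.card_range, nsmul_eq_mul]; push_cast; field_simp
  have h3 := hF.gap
  unfold stripMass at h3
  have h4 : ∑ i, ‖g (B i)‖ ^ 2 = mass g B := rfl
  rw [h1, h4] at hsum
  nlinarith

/-! ### Consequences of accuracy -/

section Accuracy

variable (hR : Regime K ε B Mhat) (hF : Favourable B Mhat σ) {j : ℕ} {ℓ : Fin (rates n + 1)}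
  (hτ : tol g B σ ℓ ≤ rho K ε n / 8 * √(σ.ζ * Mhat / 2 ^ j))

include hR hF hτ

/-- The relative error `(1 ± ρ/8)²` of the estimate is absorbed by the margin `1 ± ρ` in the
definition of `inner`. -/
theorem Favourable.estimate_mem {i : Fin n} (hi : i ∈ inner K ε B Mhat j σ.ζ)
    (hk : σ.keep ℓ i = true) : estimate g B σ ℓ i ∈
      Set.Icc ((1 + ε) * (σ.ζ * Mhat / 2 ^ j)) ((2 - ε) * (σ.ζ * Mhat / 2 ^ j)) := by
  have hε := hR.ε_pos; have hε1 := hR.ε_le; have hρ := hR.rho_pos; have hρ1 := hR.rho_le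
  have hT := hF.scale_pos hR j
  set T := σ.ζ * Mhat / 2 ^ j with hTd
  set ρ := rho K ε n with hρd
  obtain ⟨h1, h2⟩ := (Finset.mem_filter.1 hi).2
  have hacc := hF.accurate ℓ i
  have hd : downsample B σ ℓ i = B i := by simp [downsample_apply, hk]
  rw [hd] at hacc
  have hlo : 1 ≤ (1 + ε) * (1 + ρ) := by nlinarith
  obtain ⟨h3, h4⟩ := sq_bounds_of_abs_sub_le (norm_nonneg _) (norm_nonneg _) (by positivity)
    (by linarith) hacc hτ (by nlinarith)
  have e0 : 1 - ρ / 4 ≤ (1 - ρ / 8) ^ 2 := by nlinarith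
  have e1 : 1 ≤ (1 - ρ / 8) ^ 2 * (1 + ρ) :=
    le_trans (by nlinarith) (mul_le_mul_of_nonneg_right e0 (by linarith : 0 ≤ 1 + ρ))
  have e2 : (1 + ρ / 8) ^ 2 * (1 - ρ) ≤ 1 := by nlinarith
  constructor
  · calc (1 + ε) * T ≤ ((1 - ρ / 8) ^ 2 * (1 + ρ)) * ((1 + ε) * T) :=
          le_mul_of_one_le_left (by positivity) e1
      _ = (1 - ρ / 8) ^ 2 * ((1 + ε) * (1 + ρ) * T) := by ring
      _ ≤ (1 - ρ / 8) ^ 2 * ‖g (B i)‖ ^ 2 := by gcongr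
      _ ≤ _ := h3
  · calc _ ≤ (1 + ρ / 8) ^ 2 * ‖g (B i)‖ ^ 2 := h4
      _ ≤ (1 + ρ / 8) ^ 2 * ((2 - ε) * (1 - ρ) * T) := by gcongr
      _ = ((1 + ρ / 8) ^ 2 * (1 - ρ)) * ((2 - ε) * T) := by ring
      _ ≤ 1 * ((2 - ε) * T) := by
          have : 0 ≤ (2 - ε) * T := mul_nonneg (by linarith) hT.le
          gcongr
      _ = _ := one_mul _

/-- The converse direction: here the estimate is known to exceed the scale, so the additive error is
relative to the estimate. The row of the downsampled matrix is then nonzero, hence it has survived.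
-/
theorem Favourable.mem_above {i : Fin n} (h : (1 + ε) * (σ.ζ * Mhat / 2 ^ j) ≤ estimate g B σ ℓ i) :
    σ.keep ℓ i = true ∧ i ∈ above B Mhat j σ.ζ ∧
      (estimate g B σ ℓ i ≤ (2 - ε) * (σ.ζ * Mhat / 2 ^ j) → i ∈ outer K ε B Mhat j σ.ζ) := by
  have hε := hR.ε_pos; have hε1 := hR.ε_le; have hρ := hR.rho_pos; have hρ1 := hR.rho_le
  have hT := hF.scale_pos hR j
  set T := σ.ζ * Mhat / 2 ^ j with hTd
  set ρ := rho K ε n with hρd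
  have hacc := hF.accurate ℓ i
  rw [abs_sub_comm] at hacc
  obtain ⟨h3, h4⟩ := sq_bounds_of_abs_sub_le (norm_nonneg _) (norm_nonneg _)
    (by positivity : 0 ≤ ρ / 8) (by linarith) hacc hτ (le_trans (by nlinarith) h)
  change _ * estimate g B σ ℓ i ≤ _ at h3
  change _ ≤ _ * estimate g B σ ℓ i at h4
  have e1 : 1 - ρ ≤ (1 - ρ / 8) ^ 2 := by nlinarith
  have e2 : (1 + ρ / 8) ^ 2 ≤ 1 + ρ := by nlinarith
  have e3 : 1 ≤ (1 + ε) * (1 - ρ) := by nlinarith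
  have h5 : (1 + ε) * (1 - ρ) * T ≤ ‖g (downsample B σ ℓ i)‖ ^ 2 := by
    calc (1 + ε) * (1 - ρ) * T = (1 - ρ) * ((1 + ε) * T) := by ring
      _ ≤ (1 - ρ / 8) ^ 2 * estimate g B σ ℓ i :=
          mul_le_mul e1 h (by positivity) (by positivity)
      _ ≤ _ := h3
  have h6 : T ≤ ‖g (downsample B σ ℓ i)‖ ^ 2 := le_trans (by nlinarith) h5
  obtain ⟨hk, hd⟩ := downsample_eq_of_norm_pos (hT.trans_le h6)
  rw [hd] at h4 h5 h6
  refine ⟨hk, by simpa [above] using h6, fun h7 => ?_⟩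
  refine Finset.mem_filter.2 ⟨Finset.mem_univ _, h5, h4.trans ?_⟩
  calc (1 + ρ / 8) ^ 2 * estimate g B σ ℓ i ≤ (1 + ρ) * ((2 - ε) * T) :=
        mul_le_mul e2 h7 (sq_nonneg _) (by positivity)
    _ = _ := by ring

end Accuracy

/-- The estimate of a level element exceeds the scale, so `tol ≤ ε√T` is a relative error, and a row
that did not survive cannot produce such an estimate. This is the guarantee in the theorem, with `C
= 3`; the accuracy assumed is coarser than the one needed to compare levels with their rows. -/
theorem estimate_approx (hR : Regime K ε B Mhat) (hF : Favourable B Mhat σ) {j : ℕ}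
    {ℓ : Fin (rates n + 1)} (hτ : tol g B σ ℓ ≤ ε * √(σ.ζ * Mhat / 2 ^ j)) {i : Fin n}
    (hi : i ∈ levelElements g B Mhat σ j ℓ) :
    (1 - 3 * ε) * ‖g (B i)‖ ^ 2 ≤ ‖g (answer g B σ ℓ i)‖ ^ 2 ∧
      ‖g (answer g B σ ℓ i)‖ ^ 2 ≤ (1 + 3 * ε) * ‖g (B i)‖ ^ 2 := by
  have hε := hR.ε_pos; have hε1 := hR.ε_le
  have hT := hF.scale_pos hR j
  have h1 := (Finset.mem_filter.1 hi).2.1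
  have hacc := hF.accurate ℓ i
  rw [abs_sub_comm] at hacc
  have h2 : σ.ζ * Mhat / 2 ^ j ≤ ‖g (answer g B σ ℓ i)‖ ^ 2 := le_trans (by nlinarith) h1
  obtain ⟨h3, h4⟩ := sq_bounds_of_abs_sub_le (norm_nonneg _) (norm_nonneg _) hε.le
    (by linarith) hacc hτ h2
  have ha : 0 < ‖g (answer g B σ ℓ i)‖ ^ 2 := hT.trans_le h2
  have hx : 0 < ‖g (downsample B σ ℓ i)‖ ^ 2 := by
    have : 0 < (1 - ε) ^ 2 := by nlinarith
    nlinarith [mul_pos this ha]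
  rw [(downsample_eq_of_norm_pos hx).2] at h3 h4
  set a := ‖g (answer g B σ ℓ i)‖ ^ 2
  constructor
  · have e1 : (1 - 3 * ε) * (1 + ε) ^ 2 ≤ 1 := by nlinarith [pow_pos hε 3]
    calc _ ≤ (1 - 3 * ε) * ((1 + ε) ^ 2 * a) := by
          have : 0 ≤ 1 - 3 * ε := by linarith
          gcongr
      _ = ((1 - 3 * ε) * (1 + ε) ^ 2) * a := by ring
      _ ≤ 1 * a := by gcongr
      _ = a := one_mul a
  · have e1 : 1 ≤ (1 + 3 * ε) * (1 - ε) ^ 2 := by nlinarith [pow_pos hε 3]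
    calc a ≤ ((1 + 3 * ε) * (1 - ε) ^ 2) * a := le_mul_of_one_le_left ha.le e1
      _ = (1 + 3 * ε) * ((1 - ε) ^ 2 * a) := by ring
      _ ≤ _ := by gcongr

/-! ### The masses of the levels -/

section LevelMass

variable {c : Constants} {m : ℕ} {T : (Fin m → ℝ) → EuclideanSpace ℝ (Fin m)}
  {A : Matrix (Fin n) (Fin m) ℝ} {σ : Seed c K ε n} {j : ℕ} {ℓ : Fin (rates n + 1)}

theorem levelMass_of_chosen (h : chosen T A Mhat σ j = some ℓ) : levelMass T A Mhat σ j =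
    (∑ i ∈ levelElements T A Mhat σ j ℓ, estimate T A σ ℓ i) * 2 ^ (ℓ : ℕ) := by
  rw [levelMass, h]

theorem levelMass_of_chosen_none (h : chosen T A Mhat σ j = none) :
    levelMass T A Mhat σ j = 0 := by
  rw [levelMass, h]

theorem estimate_nonneg (i : Fin n) : 0 ≤ estimate T A σ ℓ i := pow_nonneg (norm_nonneg _) 2

theorem levelMass_nonneg : 0 ≤ levelMass T A Mhat σ j := by
  rcases h : chosen T A Mhat σ j with _ | ℓ
  · rw [levelMass_of_chosen_none h]
  · rw [levelMass_of_chosen h]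
    exact mul_nonneg (Finset.sum_nonneg fun i _ => estimate_nonneg i) (by positivity)

theorem chosen_of_le (h : j ≤ lastHeavyLevel K ε n) : chosen T A Mhat σ j = some 0 := by
  rw [chosen, if_pos h]

theorem levelMass_of_le (h : j ≤ lastHeavyLevel K ε n) : levelMass T A Mhat σ j =
    ∑ i ∈ levelElements T A Mhat σ j 0, estimate T A σ 0 i := by
  rw [levelMass_of_chosen (chosen_of_le h)]; simp

theorem exists_chosen_of_admissible (h : lastHeavyLevel K ε n < j)
    (hℓ : ℓ ∈ admissible T A Mhat σ j) :
    ∃ ℓ' ∈ admissible T A Mhat σ j, chosen T A Mhat σ j = some ℓ' ∧ ℓ ≤ ℓ' := by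
  refine ⟨(admissible T A Mhat σ j).max' ⟨ℓ, hℓ⟩, Finset.max'_mem _ _, ?_,
    Finset.le_max' _ _ hℓ⟩
  rw [chosen, if_neg (not_le.2 h), dif_pos ⟨ℓ, hℓ⟩]

theorem mem_admissible_of_chosen (h : lastHeavyLevel K ε n < j)
    (hc : chosen T A Mhat σ j = some ℓ) : ℓ ∈ admissible T A Mhat σ j := by
  rw [chosen, if_neg (not_le.2 h)] at hc
  split_ifs at hc with h1
  rw [← Option.some.inj hc]
  exact Finset.max'_mem _ _

end LevelMass

end

end HSketch

namespace HSketch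

/-! ### Lower bound for the total level mass: heavy levels -/

section

variable {n d : ℕ} {K ε Mhat : ℝ} {B : Matrix (Fin n) (Fin (d + 1)) ℝ}
  {σ : Seed stdConstants K ε n} {j : ℕ}

theorem mass_downsample_le (B : Matrix (Fin n) (Fin (d + 1)) ℝ) {c : Constants}
    (σ : Seed c K ε n) (ℓ : Fin (rates n + 1)) : mass g (downsample B σ ℓ) ≤ mass g B := by
  refine Finset.sum_le_sum fun i _ => ?_
  by_cases h : σ.keep ℓ i = true <;> simp [downsample_apply, h, norm_g_zero]

theorem Regime.le_lastHeavyLevel (hR : Regime K ε B Mhat) :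
    4 * K * (levels K ε n : ℝ) ^ 3 / ε ^ 3 ≤ 2 ^ lastHeavyLevel K ε n := by
  have := hR.ε_pos; have := hR.le_L'; have := hR.one_le_K
  exact le_two_pow_ceil_logb (by positivity)

theorem Regime.lastHeavyLevel_le (hR : Regime K ε B Mhat) :
    (2 : ℝ) ^ lastHeavyLevel K ε n ≤ 8 * K * (levels K ε n : ℝ) ^ 3 / ε ^ 3 := by
  have hε := hR.ε_pos; have hL := hR.le_L'; have hK := hR.one_le_K; have hε1 := hR.ε_le
  refine (two_pow_ceil_logb_le ?_).trans_eq (by ring)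
  rw [le_div_iff₀ (by positivity)]
  have h1 : ε ^ 3 ≤ 1 := pow_le_one₀ hε.le (by linarith)
  have h2 : (1 : ℝ) ≤ (levels K ε n : ℝ) ^ 3 := one_le_pow₀ (by linarith)
  nlinarith

theorem Favourable.le_scale (hR : Regime K ε B Mhat) (hF : Favourable B Mhat σ)
    (hj : j ≤ lastHeavyLevel K ε n) :
    mass g B * ε ^ 3 / (16 * K * (levels K ε n : ℝ) ^ 3) ≤ σ.ζ * Mhat / 2 ^ j := by
  have hε := hR.ε_pos; have hL := hR.le_L'; have hK := hR.one_le_K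
  have h1 : (2 : ℝ) ^ j ≤ 8 * K * (levels K ε n : ℝ) ^ 3 / ε ^ 3 :=
    (pow_le_pow_right₀ (by norm_num) hj).trans hR.lastHeavyLevel_le
  have h2 : mass g B / 2 ≤ σ.ζ * Mhat := by
    have := hF.shift_mem.1; have := hR.mass_le; have := hR.mass_pos
    nlinarith
  have hM := hR.mass_pos
  calc mass g B * ε ^ 3 / (16 * K * (levels K ε n : ℝ) ^ 3)
      = (mass g B / 2) / (8 * K * (levels K ε n : ℝ) ^ 3 / ε ^ 3) := by field_simp; ring
    _ ≤ σ.ζ * Mhat / 2 ^ j := by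
        have : 0 ≤ σ.ζ * Mhat := by linarith
        gcongr

/-- Below the last heavy level, the structure for the full matrix is accurate. -/
theorem Favourable.tol_zero_le (hR : Regime K ε B Mhat) (hF : Favourable B Mhat σ)
    (hj : j ≤ lastHeavyLevel K ε n) :
    tol g B σ 0 ≤ rho K ε n / 8 * √(σ.ζ * Mhat / 2 ^ j) := by
  have hε := hR.ε_pos; have hL := hR.le_L'; have hK := hR.one_le_K; have hM := hR.mass_pos
  refine le_mul_sqrt (by have := hR.rho_pos; positivity) ?_
  have hL0 : 0 < levels K ε n := by have := hR.le_L; omega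
  refine (tol_sq_le hK hε hL0 B σ 0).trans ?_
  have h1 := mass_downsample_le B σ 0
  have h2 := hF.le_scale hR hj
  have hKε := hR.Kε_le
  set L : ℝ := (levels K ε n : ℝ) with hLd
  have h3 : rho K ε n = ε / (10 ^ 5 * L) := rfl
  calc _ ≤ mass g B * (ε ^ 6 / L ^ 6) := by gcongr
    -- The scale of a heavy level may be as small as `Mε³/(16KL³)`; the factor `K` lost here is paid
    -- for by `Kε ≤ 10⁻¹⁵`.
    _ = (16 * 64 * 10 ^ 10 * (K * ε) / L) *
        ((rho K ε n / 8) ^ 2 * (mass g B * ε ^ 3 / (16 * K * L ^ 3))) := by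
        rw [h3]; field_simp; ring
    _ ≤ 1 * ((rho K ε n / 8) ^ 2 * (mass g B * ε ^ 3 / (16 * K * L ^ 3))) := by
        gcongr
        rw [div_le_one (by linarith)]
        linarith
    _ ≤ _ := by rw [one_mul]; gcongr

/-- Ensures that no estimate lies above the range that `level_cover` can place when `lo = 1 + ε`. -/
theorem Favourable.estimate_zero_le (hR : Regime K ε B Mhat) (hF : Favourable B Mhat σ)
    (i : Fin n) : estimate g B σ 0 i ≤ (1 + ε) * Mhat := by
  have hε := hR.ε_pos; have hε1 := hR.ε_le; have hL := hR.le_L'; have hM := hR.mass_pos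
  have hL0 : 0 < levels K ε n := by have := hR.le_L; omega
  have h1 := mass_downsample_le B σ 0
  have h2 : tol g B σ 0 ≤ ε / 4 * √(mass g B) := by
    refine le_mul_sqrt (by positivity) ((tol_sq_le hR.one_le_K hε hL0 B σ 0).trans ?_)
    set L : ℝ := (levels K ε n : ℝ) with hLd
    calc _ ≤ mass g B * (ε ^ 6 / 1) := by
          gcongr; exact one_le_pow₀ (by linarith)
      _ = (ε ^ 4 * 16) * ((ε / 4) ^ 2 * mass g B) := by ring
      _ ≤ 1 * ((ε / 4) ^ 2 * mass g B) := by
          gcongr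
          have : ε ^ 4 ≤ (1 / 10 ^ 15) ^ 4 := by gcongr
          linarith
      _ = _ := one_mul _
  have h3 : ‖g (downsample B σ 0 i)‖ ≤ √(mass g B) := by
    refine Real.le_sqrt_of_sq_le (le_trans ?_ h1)
    exact Finset.single_le_sum (f := fun i => ‖g (downsample B σ 0 i)‖ ^ 2)
      (fun _ _ => sq_nonneg _) (Finset.mem_univ i)
  have h4 := (abs_le.1 (hF.accurate 0 i)).2
  have h5 : ‖g (answer g B σ 0 i)‖ ≤ (1 + ε / 4) * √(mass g B) := by linarith
  calc estimate g B σ 0 i ≤ ((1 + ε / 4) * √(mass g B)) ^ 2 :=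
        pow_le_pow_left₀ (norm_nonneg _) h5 2
    _ = (1 + ε / 4) ^ 2 * mass g B := by rw [mul_pow, Real.sq_sqrt hM.le]
    _ ≤ (1 + ε) * Mhat := mul_le_mul (by nlinarith) hR.mass_le hM.le (by positivity)

/-- Every heavy hitter is at least as large as the lower end of level `j`, so it falls into a level
`j' ≤ j` or a gap. Those levels are read off the same structure, since `j ≤ j₀`, and `top_gap`
limits the loss in the gaps to one half. -/
theorem Favourable.le_sum_of_truncated (hR : Regime K ε B Mhat) (hF : Favourable B Mhat σ)
    (hjL : j ≤ levels K ε n) (hj : j ≤ lastHeavyLevel K ε n)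
    (hbig : ∀ i ∈ heavyHitters g B σ 0, (1 + ε) * (σ.ζ * Mhat / 2 ^ j) ≤ estimate g B σ 0 i) :
    1 / 2 * ∑ i ∈ heavyHitters g B σ 0, estimate g B σ 0 i ≤
      ∑ j ∈ Finset.range (levels K ε n + 1), levelMass g B Mhat σ j := by
  classical
  have hε := hR.ε_pos
  set N := Finset.range (levels K ε n + 1) with hN
  have hx0 : ∀ i, 0 ≤ topEstimates B σ i := fun i => by
    unfold topEstimates; split_ifs <;> [exact estimate_nonneg i; exact le_rfl]
  have hi : ∀ i, topEstimates B σ i ≤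
      ∑ j ∈ N, {z | (2 - ε) * (z * Mhat / 2 ^ j) ≤ topEstimates B σ i ∧ topEstimates B σ i ≤
        2 * (1 + ε) * (z * Mhat / 2 ^ j)}.indicator (fun _ => topEstimates B σ i) σ.ζ +
      ∑ j ∈ N, if j ≤ lastHeavyLevel K ε n ∧ i ∈ levelElements g B Mhat σ j 0
        then estimate g B σ 0 i else 0 := by
    intro i
    have hnn : ∀ j ∈ N, 0 ≤ {z | (2 - ε) * (z * Mhat / 2 ^ j) ≤ topEstimates B σ i ∧
        topEstimates B σ i ≤ 2 * (1 + ε) * (z * Mhat / 2 ^ j)}.indicator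
        (fun _ => topEstimates B σ i) σ.ζ := fun j _ => Set.indicator_nonneg (fun _ _ => hx0 i) _
    have hnn' : ∀ j ∈ N, 0 ≤ if j ≤ lastHeavyLevel K ε n ∧ i ∈ levelElements g B Mhat σ j 0
        then estimate g B σ 0 i else 0 :=
      fun j _ => by split_ifs <;> [exact estimate_nonneg i; exact le_rfl]
    have t2 := Finset.sum_nonneg hnn
    have t3 := Finset.sum_nonneg hnn'
    by_cases hmem : i ∈ heavyHitters g B σ 0
    · have hx : topEstimates B σ i = estimate g B σ 0 i := if_pos hmem
      obtain ⟨j', hj', h | h⟩ := level_cover (up := 2 - ε) hR.Mhat_pos.le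
        (by positivity) hF.shift_mem.1 (hF.estimate_zero_le hR i) j (hbig i hmem)
      · have hjN : j' ∈ N := Finset.mem_range.2 (by omega)
        have h1 := Finset.single_le_sum hnn' hjN
        rw [if_pos ⟨hj'.trans hj, Finset.mem_filter.2 ⟨hmem, h⟩⟩] at h1
        linarith
      · have hjN : j' ∈ N := Finset.mem_range.2 (by omega)
        have h1 := Finset.single_le_sum hnn hjN
        rw [indicator_strip_of (by rwa [hx])] at h1
        linarith
    · have hx : topEstimates B σ i = 0 := if_neg hmem
      linarith
  have hsum := Finset.sum_le_sum fun i (_ : i ∈ Finset.univ) => hi i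
  rw [Finset.sum_add_distrib, Finset.sum_comm, Finset.sum_comm (f := fun i j =>
    if j ≤ lastHeavyLevel K ε n ∧ i ∈ levelElements g B Mhat σ j 0
        then estimate g B σ 0 i else 0)] at hsum
  have h2 : ∑ j ∈ N, ∑ i, (if j ≤ lastHeavyLevel K ε n ∧ i ∈ levelElements g B Mhat σ j 0
      then estimate g B σ 0 i else 0) ≤ ∑ j ∈ N, levelMass g B Mhat σ j := by
    refine Finset.sum_le_sum fun j _ => ?_
    by_cases hjj : j ≤ lastHeavyLevel K ε n
    · rw [levelMass_of_le hjj]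
      simp [hjj]
    · simpa [hjj] using levelMass_nonneg
  have h3 := hF.top_gap
  unfold stripMass at h3
  have h4 : ∑ i, topEstimates B σ i = ∑ i ∈ heavyHitters g B σ 0, estimate g B σ 0 i := by
    simp [topEstimates]
  linarith

/-- Either all inner rows are among the heavy hitters, and level `j` itself is large; or one is
missing. In the latter case the top set contains at least `L³/ε³` indices, all with estimates above
the lower end of level `j`, which is at least `Mε³/(16KL³)`. Their estimates sum to at least
`M/(16K)`, half of which lies in levels. -/
theorem Favourable.le_sum_levelMass_of_heavy (hR : Regime K ε B Mhat) (hF : Favourable B Mhat σ)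
    (hjL : j ≤ levels K ε n) (hj : j ≤ lastHeavyLevel K ε n)
    (hmass : mass g B / (2 * ((levels K ε n : ℝ) + 1)) ≤
      ∑ i ∈ inner K ε B Mhat j σ.ζ, ‖g (B i)‖ ^ 2) :
    mass g B / (32 * K * ((levels K ε n : ℝ) + 1)) ≤
      ∑ j ∈ Finset.range (levels K ε n + 1), levelMass g B Mhat σ j := by
  have hε := hR.ε_pos; have hε1 := hR.ε_le; have hL := hR.le_L'; have hM := hR.mass_pos
  have hK := hR.one_le_K; have hρ := hR.rho_pos; have hρ1 := hR.rho_le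
  have hτ := hF.tol_zero_le hR hj
  have hT := hF.scale_pos hR j
  have hmem := fun i (hi : i ∈ inner K ε B Mhat j σ.ζ) =>
    hF.estimate_mem hR hτ hi (hF.keep_zero i)
  by_cases hall : ∀ i ∈ inner K ε B Mhat j σ.ζ, i ∈ heavyHitters g B σ 0
  · have h1 : ∑ i ∈ inner K ε B Mhat j σ.ζ, ‖g (B i)‖ ^ 2 ≤ 2 * levelMass g B Mhat σ j := by
      rw [levelMass_of_le hj, Finset.mul_sum]
      refine (Finset.sum_le_sum fun i hi => ?_).trans
        (Finset.sum_le_sum_of_subset_of_nonneg (fun i hi =>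
          Finset.mem_filter.2 ⟨hall i hi, hmem i hi⟩)
          fun i _ _ => mul_nonneg zero_le_two (estimate_nonneg i))
      have h2 := (Finset.mem_filter.1 hi).2.2
      have h3 := (hmem i hi).1
      have h4 : (2 - ε) * (1 - rho K ε n) ≤ 2 := by nlinarith
      nlinarith
    have h2 : levelMass g B Mhat σ j ≤
        ∑ j ∈ Finset.range (levels K ε n + 1), levelMass g B Mhat σ j :=
      Finset.single_le_sum (f := fun j => levelMass g B Mhat σ j)
        (fun j _ => levelMass_nonneg) (Finset.mem_range.2 (by omega))
    have h3 : mass g B / (32 * K * ((levels K ε n : ℝ) + 1)) ≤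
        mass g B / (2 * ((levels K ε n : ℝ) + 1)) / 2 := by
      rw [div_div]
      exact div_le_div_of_nonneg_left hM.le (by positivity) (by nlinarith)
    linarith
  · push Not at hall
    obtain ⟨i₀, hi₀, hi₀'⟩ := hall
    have hbig : ∀ i ∈ heavyHitters g B σ 0,
        (1 + ε) * (σ.ζ * Mhat / 2 ^ j) ≤ estimate g B σ 0 i := fun i hi =>
      (hmem i₀ hi₀).1.trans (le_of_notMem_topIndices hi₀' hi)
    refine le_trans ?_ (hF.le_sum_of_truncated hR hjL hj hbig)
    have hcard : (levels K ε n : ℝ) ^ 3 / ε ^ 3 ≤ (heavyHitters g B σ 0).card := by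
      have h1 : topSize stdConstants K ε n ≤ (heavyHitters g B σ 0).card :=
        card_topIndices_of_notMem hi₀'
      have h2 : (levels K ε n : ℝ) ^ 3 / ε ^ 3 ≤ topSize stdConstants K ε n := by
        refine le_trans (le_of_eq ?_) (Nat.le_ceil _)
        simp [stdConstants]
      exact h2.trans (by exact_mod_cast h1)
    have hs := Finset.card_nsmul_le_sum _ _ _ fun i hi => hbig i hi
    rw [nsmul_eq_mul] at hs
    have h5 : mass g B / (16 * K) ≤
        (heavyHitters g B σ 0).card * ((1 + ε) * (σ.ζ * Mhat / 2 ^ j)) := by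
      calc mass g B / (16 * K) = (levels K ε n : ℝ) ^ 3 / ε ^ 3 *
            (mass g B * ε ^ 3 / (16 * K * (levels K ε n : ℝ) ^ 3)) := by field_simp
        _ ≤ (heavyHitters g B σ 0).card * ((1 + ε) * (σ.ζ * Mhat / 2 ^ j)) := by
            refine mul_le_mul hcard ((hF.le_scale hR hj).trans ?_) (by positivity) (by positivity)
            nlinarith
    have h6 : mass g B / (32 * K * ((levels K ε n : ℝ) + 1)) ≤ mass g B / (16 * K) / 2 := by
      rw [div_div]
      refine div_le_div_of_nonneg_left hM.le (by positivity) ?_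
      nlinarith
    linarith

/-! ### Light levels: admissible sampling rates -/

theorem mem_admissible_iff {c : Constants} {σ : Seed c K ε n} {ℓ : Fin (rates n + 1)} :
    ℓ ∈ admissible g B Mhat σ j ↔
      (1 - √20 * ε) * ((levels K ε n : ℝ) ^ 2 / ε ^ 2) ≤ (levelElements g B Mhat σ j ℓ).card ∧
      ((levelElements g B Mhat σ j ℓ).card : ℝ) ≤
        2 * (1 + √20 * ε) * ((levels K ε n : ℝ) ^ 2 / ε ^ 2) := by
  simp [admissible, mul_div_assoc]

theorem sqrt_twenty_mem : √20 ∈ Set.Icc (4 : ℝ) 5 :=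
  ⟨Real.le_sqrt_of_sq_le (by norm_num), Real.sqrt_le_iff.2 (by norm_num)⟩

/-- Outer rows that are not inner lie in one of two thin boundary strips and have squared norm at
least `T`, so the mass of the strips bounds their number by `εM/(8(L+1)T)`. By `hN` this is at most
`ε/2` times the number of inner rows. -/
theorem Favourable.card_outer_le (hR : Regime K ε B Mhat) (hF : Favourable B Mhat σ)
    (hjL : j ≤ levels K ε n)
    (hN : mass g B ≤ 4 * ((levels K ε n : ℝ) + 1) * (σ.ζ * Mhat / 2 ^ j) *
      (inner K ε B Mhat j σ.ζ).card) :
    ((outer K ε B Mhat j σ.ζ).card : ℝ) ≤ (1 + ε / 2) * (inner K ε B Mhat j σ.ζ).card := by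
  classical
  have hε := hR.ε_pos; have hε1 := hR.ε_le; have hL := hR.le_L'; have hM := hR.mass_pos
  have hρ := hR.rho_pos; have hρ1 := hR.rho_le
  have hT := hF.scale_pos hR j
  have hl := hF.low
  have hh := hF.high
  set T := σ.ζ * Mhat / 2 ^ j with hTd
  set L : ℝ := (levels K ε n : ℝ) with hLd
  set I := inner K ε B Mhat j σ.ζ with hI
  set O := outer K ε B Mhat j σ.ζ with hO
  have hsub : O.card ≤ I.card + (O \ I).card := by
    rw [← Finset.card_union_of_disjoint Finset.disjoint_sdiff]
    exact Finset.card_le_card (by rw [Finset.union_sdiff_self_eq_union]; exact Finset.subset_union_right)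
  have hsub' : (O.card : ℝ) ≤ I.card + (O \ I).card := by exact_mod_cast hsub
  have hstrip : ∀ {α β : ℝ} {N : ℕ}, j < N →
      ∑ i, {z | α * (z * Mhat / 2 ^ j) ≤ ‖g (B i)‖ ^ 2 ∧ ‖g (B i)‖ ^ 2 ≤
        β * (z * Mhat / 2 ^ j)}.indicator (fun _ => ‖g (B i)‖ ^ 2) σ.ζ ≤
      stripMass α β Mhat N (fun i => ‖g (B i)‖ ^ 2) σ.ζ := by
    intro α β N hjN
    unfold stripMass
    exact Finset.single_le_sum (f := fun j => ∑ i, {z | α * (z * Mhat / 2 ^ j) ≤ ‖g (B i)‖ ^ 2 ∧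
      ‖g (B i)‖ ^ 2 ≤ β * (z * Mhat / 2 ^ j)}.indicator (fun _ => ‖g (B i)‖ ^ 2) σ.ζ)
      (fun j _ => Finset.sum_nonneg fun i _ => Set.indicator_nonneg (fun _ _ => sq_nonneg _) _)
      (Finset.mem_range.2 hjN)
  have hl' := (hstrip (Nat.lt_succ_of_le hjL)).trans hl
  have hh' := (hstrip (Nat.lt_succ_of_le hjL)).trans hh
  have hnn : ∀ (α β : ℝ) i, 0 ≤ {z | α * (z * Mhat / 2 ^ j) ≤ ‖g (B i)‖ ^ 2 ∧ ‖g (B i)‖ ^ 2 ≤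
        β * (z * Mhat / 2 ^ j)}.indicator (fun _ => ‖g (B i)‖ ^ 2) σ.ζ := fun α β i =>
    Set.indicator_nonneg (fun _ _ => sq_nonneg _) _
  have hi : ∀ i ∈ O \ I, T ≤
      {z | (1 + ε) * (1 - rho K ε n) * (z * Mhat / 2 ^ j) ≤ ‖g (B i)‖ ^ 2 ∧ ‖g (B i)‖ ^ 2 ≤
        (1 + ε) * (1 + rho K ε n) * (z * Mhat / 2 ^ j)}.indicator
          (fun _ => ‖g (B i)‖ ^ 2) σ.ζ +
      {z | (2 - ε) * (1 - rho K ε n) * (z * Mhat / 2 ^ j) ≤ ‖g (B i)‖ ^ 2 ∧ ‖g (B i)‖ ^ 2 ≤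
        (2 - ε) * (1 + rho K ε n) * (z * Mhat / 2 ^ j)}.indicator
          (fun _ => ‖g (B i)‖ ^ 2) σ.ζ := by
    intro i hi
    obtain ⟨hiO, hiI⟩ := Finset.mem_sdiff.1 hi
    obtain ⟨h1, h2⟩ := (Finset.mem_filter.1 hiO).2
    have h3 : 1 ≤ (1 + ε) * (1 - rho K ε n) := by nlinarith
    have h4 : T ≤ ‖g (B i)‖ ^ 2 := le_trans (by nlinarith) h1
    rcases le_or_gt (‖g (B i)‖ ^ 2) ((1 + ε) * (1 + rho K ε n) * T) with h | h
    · rw [indicator_strip_of ⟨h1, h⟩]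
      linarith [hnn ((2 - ε) * (1 - rho K ε n)) ((2 - ε) * (1 + rho K ε n)) i]
    · have h5 : (2 - ε) * (1 - rho K ε n) * T ≤ ‖g (B i)‖ ^ 2 := by
        by_contra hc
        exact hiI (Finset.mem_filter.2 ⟨Finset.mem_univ _, h.le, (not_le.1 hc).le⟩)
      have h6 := indicator_strip_of ⟨h5, h2⟩
      rw [h6]
      linarith [hnn ((1 + ε) * (1 - rho K ε n)) ((1 + ε) * (1 + rho K ε n)) i]
  have hs := Finset.card_nsmul_le_sum _ _ _ hi
  rw [nsmul_eq_mul, Finset.sum_add_distrib] at hs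
  have hs1 := Finset.sum_le_sum_of_subset_of_nonneg (Finset.subset_univ (O \ I))
    fun i _ _ => hnn ((1 + ε) * (1 - rho K ε n)) ((1 + ε) * (1 + rho K ε n)) i
  have hs2 := Finset.sum_le_sum_of_subset_of_nonneg (Finset.subset_univ (O \ I))
    fun i _ _ => hnn ((2 - ε) * (1 - rho K ε n)) ((2 - ε) * (1 + rho K ε n)) i
  have h7 : ((O \ I).card : ℝ) * T ≤ ε / (8 * (L + 1)) * mass g B := by
    have : ε / (8 * (L + 1)) * mass g B = 2 * (ε / (16 * (L + 1)) * mass g B) := by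
      field_simp; norm_num
    linarith
  have h8 : ε / (8 * (L + 1)) * mass g B ≤ ε / 2 * I.card * T := by
    calc _ ≤ ε / (8 * (L + 1)) * (4 * (L + 1) * T * I.card) := by gcongr
      _ = _ := by field_simp; ring
  have h9 : ((O \ I).card : ℝ) ≤ ε / 2 * I.card := le_of_mul_le_mul_right (h7.trans h8) hT
  linarith

/-- A rate at which about `L²/ε²` rows of level `j` survive. -/
theorem exists_rate {s : ℝ} (hs : 1 ≤ s) {N : ℕ} (hN : s ≤ N) (hNn : N ≤ n) :
    ∃ ℓ : Fin (rates n + 1), s ≤ (N : ℝ) / 2 ^ (ℓ : ℕ) ∧ (N : ℝ) / 2 ^ (ℓ : ℕ) < 2 * s := by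
  have hs0 : 0 < s := by linarith
  obtain ⟨l, h1, h2⟩ := exists_nat_pow_near ((one_le_div hs0).2 hN) (by norm_num : (1 : ℝ) < 2)
  rw [le_div_iff₀ hs0] at h1
  rw [div_lt_iff₀ hs0, pow_succ] at h2
  have hn : 0 < n := by
    have : (0 : ℝ) < N := by linarith
    have : 0 < N := by exact_mod_cast this
    omega
  have hl : l ≤ rates n := by
    refine (pow_le_pow_iff_right₀ (by norm_num : (1 : ℝ) < 2)).1 ?_
    refine le_trans ?_ (natCast_le_two_pow_rates hn)
    have : (N : ℝ) ≤ n := by exact_mod_cast hNn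
    have : (0 : ℝ) < 2 ^ l := by positivity
    nlinarith
  refine ⟨⟨l, by omega⟩, ?_, ?_⟩
  · rw [le_div_iff₀ (by positivity)]; linarith
  · rw [div_lt_iff₀ (by positivity)]; linarith

theorem Favourable.tol_sq_le (hR : Regime K ε B Mhat) (hF : Favourable B Mhat σ)
    (ℓ : Fin (rates n + 1)) :
    tol g B σ ℓ ^ 2 ≤ 100 * (mass g B / 2 ^ (ℓ : ℕ)) * (ε ^ 6 / (levels K ε n : ℝ) ^ 5) := by
  have hε := hR.ε_pos; have hL := hR.le_L'; have hM := hR.mass_pos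
  have hL0 : 0 < levels K ε n := by have := hR.le_L; omega
  refine (HSketch.tol_sq_le hR.one_le_K hε hL0 B σ ℓ).trans ?_
  have h1 := hF.mass_le ℓ
  have h2 : (rates n : ℝ) + 1 ≤ levels K ε n := by exact_mod_cast hR.rates_le
  set L : ℝ := (levels K ε n : ℝ) with hLd
  calc _ ≤ 100 * L * (mass g B / 2 ^ (ℓ : ℕ)) * (ε ^ 6 / L ^ 6) := by
        gcongr
        exact h1.trans (by gcongr)
    _ = _ := by field_simp

/-- An inner row contributes at most `2T`, so mass turns into a number of rows. Beyond `j₀` the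
scale is at most `Mε³/(8L³)`, which makes this number large enough for sampling. -/
theorem Favourable.card_inner (hR : Regime K ε B Mhat) (hF : Favourable B Mhat σ)
    (hj : lastHeavyLevel K ε n < j) (hmass : mass g B / (2 * ((levels K ε n : ℝ) + 1)) ≤
      ∑ i ∈ inner K ε B Mhat j σ.ζ, ‖g (B i)‖ ^ 2) :
    mass g B ≤ 4 * ((levels K ε n : ℝ) + 1) * (σ.ζ * Mhat / 2 ^ j) *
      (inner K ε B Mhat j σ.ζ).card ∧
    (levels K ε n : ℝ) ^ 2 / ε ^ 2 ≤ (inner K ε B Mhat j σ.ζ).card := by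
  have hε := hR.ε_pos; have hε1 := hR.ε_le; have hL := hR.le_L'; have hM := hR.mass_pos
  have hK := hR.one_le_K; have hρ := hR.rho_pos; have hρ1 := hR.rho_le
  have hT := hF.scale_pos hR j
  have hj0 := hR.le_lastHeavyLevel
  have hTle : σ.ζ * Mhat / 2 ^ j ≤ mass g B * ε ^ 3 / (8 * (levels K ε n : ℝ) ^ 3) := by
    have h1 : 8 * K * (levels K ε n : ℝ) ^ 3 / ε ^ 3 ≤ 2 ^ j := by
      calc 8 * K * (levels K ε n : ℝ) ^ 3 / ε ^ 3
          = 2 * (4 * K * (levels K ε n : ℝ) ^ 3 / ε ^ 3) := by ring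
        _ ≤ 2 * 2 ^ lastHeavyLevel K ε n := by gcongr
        _ = 2 ^ (lastHeavyLevel K ε n + 1) := by ring
        _ ≤ 2 ^ j := pow_le_pow_right₀ (by norm_num) hj
    have h2 : σ.ζ * Mhat ≤ K * mass g B := by
      have := hF.shift_mem.2; have := hR.Mhat_pos; have := hR.le_mass
      nlinarith
    calc σ.ζ * Mhat / 2 ^ j ≤ K * mass g B / (8 * K * (levels K ε n : ℝ) ^ 3 / ε ^ 3) := by
          gcongr
      _ = _ := by field_simp
  set T := σ.ζ * Mhat / 2 ^ j with hTd
  set L : ℝ := (levels K ε n : ℝ) with hLd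
  set s := L ^ 2 / ε ^ 2 with hs
  set I := inner K ε B Mhat j σ.ζ with hI
  have hs1 : 0 < s := by positivity
  have hN : mass g B ≤ 4 * (L + 1) * T * I.card := by
    have h1 : ∑ i ∈ I, ‖g (B i)‖ ^ 2 ≤ I.card * (2 * T) := by
      rw [← nsmul_eq_mul]
      refine Finset.sum_le_card_nsmul _ _ _ fun i hi => ?_
      have h2 := (Finset.mem_filter.1 hi).2.2
      have h4 : (2 - ε) * (1 - rho K ε n) ≤ 2 := by nlinarith
      exact h2.trans (mul_le_mul_of_nonneg_right h4 hT.le)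
    have h2 := hmass.trans h1
    rw [div_le_iff₀ (by positivity)] at h2
    linarith
  have hsN : s ≤ I.card := by
    have h1 : mass g B ≤ 4 * (L + 1) * (mass g B * ε ^ 3 / (8 * L ^ 3)) * I.card :=
      hN.trans (by gcongr)
    have h2 : 4 * (L + 1) * (mass g B * ε ^ 3 / (8 * L ^ 3)) * I.card =
        mass g B * (((L + 1) * ε ^ 3 / (2 * L ^ 3)) * I.card) := by field_simp; ring
    rw [h2] at h1
    have h3 : 1 ≤ ((L + 1) * ε ^ 3 / (2 * L ^ 3)) * I.card :=
      le_of_mul_le_mul_left (by rwa [mul_one]) hM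
    have h4 : (L + 1) * ε ^ 3 / (2 * L ^ 3) ≤ 1 / s := by
      rw [hs, one_div_div, div_le_div_iff₀ (by positivity) (by positivity)]
      have : (L + 1) * ε ≤ 2 * L := by nlinarith
      calc (L + 1) * ε ^ 3 * L ^ 2 = ((L + 1) * ε) * (ε ^ 2 * L ^ 2) := by ring
        _ ≤ (2 * L) * (ε ^ 2 * L ^ 2) := by gcongr
        _ = _ := by ring
    have h5 : 1 ≤ 1 / s * I.card := h3.trans (by gcongr)
    rwa [one_div_mul_eq_div, one_le_div (by linarith)] at h5
  exact ⟨hN, hsN⟩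

/-- The rate is the one that brings the number of inner rows into `[s, 2s)`, with `s = L²/ε²`. There
the downsampled mass is `O(L²sT)`, so the structure resolves the scale `T`, and the survivor counts
are those needed for admissibility. -/
theorem Favourable.exists_sample (hR : Regime K ε B Mhat) (hF : Favourable B Mhat σ)
    (hjL : j ≤ levels K ε n) (hj : lastHeavyLevel K ε n < j)
    (hmass : mass g B / (2 * ((levels K ε n : ℝ) + 1)) ≤
      ∑ i ∈ inner K ε B Mhat j σ.ζ, ‖g (B i)‖ ^ 2) :
    ∃ ℓ : Fin (rates n + 1),
      mass g B / 2 ^ (ℓ : ℕ) ≤ 8 * ((levels K ε n : ℝ) + 1) *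
        ((levels K ε n : ℝ) ^ 2 / ε ^ 2) * (σ.ζ * Mhat / 2 ^ j) ∧
      tol g B σ ℓ ≤ rho K ε n / 8 * √(σ.ζ * Mhat / 2 ^ j) ∧
      (1 - √20 * ε) * ((levels K ε n : ℝ) ^ 2 / ε ^ 2) ≤
        ((inner K ε B Mhat j σ.ζ).filter fun i => σ.keep ℓ i = true).card ∧
      (((outer K ε B Mhat j σ.ζ).filter fun i => σ.keep ℓ i = true).card : ℝ) ≤
        2 * (1 + √20 * ε) * ((levels K ε n : ℝ) ^ 2 / ε ^ 2) ∧
      ((above B Mhat j σ.ζ).filter fun i => σ.keep ℓ i = true).card ≤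
        topSize stdConstants K ε n := by
  have hε := hR.ε_pos; have hε1 := hR.ε_le; have hL := hR.le_L'; have hM := hR.mass_pos
  have hK := hR.one_le_K; have hρ := hR.rho_pos; have hρ1 := hR.rho_le
  have hT := hF.scale_pos hR j
  obtain ⟨hq4, hq5⟩ := sqrt_twenty_mem
  obtain ⟨hN, hsN⟩ := hF.card_inner hR hj hmass
  have hsample := hF.sample j (Finset.mem_range.2 (by omega))
  have htop : (levels K ε n : ℝ) ^ 3 / ε ^ 3 ≤ topSize stdConstants K ε n := by
    refine le_trans (le_of_eq ?_) (Nat.le_ceil _)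
    simp [stdConstants]
  have htol := hF.tol_sq_le hR
  have hρd : rho K ε n = ε / (10 ^ 5 * levels K ε n) := rfl
  set T := σ.ζ * Mhat / 2 ^ j with hTd
  set L : ℝ := (levels K ε n : ℝ) with hLd
  set s := L ^ 2 / ε ^ 2 with hs
  have hs1 : 1 ≤ s := by
    rw [hs, one_le_div (by positivity)]
    exact (pow_le_one₀ hε.le (by linarith)).trans (one_le_pow₀ (by linarith))
  set I := inner K ε B Mhat j σ.ζ with hI
  obtain ⟨ℓ, hℓ1, hℓ2⟩ := exists_rate hs1 hsN 
    ((Finset.card_le_univ I).trans_eq (Fintype.card_fin n))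
  have hp : (0 : ℝ) < 2 ^ (ℓ : ℕ) := by positivity
  have hMℓ : mass g B / 2 ^ (ℓ : ℕ) ≤ 8 * (L + 1) * s * T := by
    rw [div_le_iff₀ hp]
    rw [div_lt_iff₀ hp] at hℓ2
    calc mass g B ≤ 4 * (L + 1) * T * I.card := hN
      _ ≤ 4 * (L + 1) * T * (2 * s * 2 ^ (ℓ : ℕ)) := by gcongr
      _ = _ := by ring
  have hO := hF.card_outer_le hR hjL hN
  have hOd : ((outer K ε B Mhat j σ.ζ).card : ℝ) / 2 ^ (ℓ : ℕ) ≤ (2 + ε) * s := by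
    calc _ ≤ (1 + ε / 2) * I.card / 2 ^ (ℓ : ℕ) := by gcongr
      _ = (1 + ε / 2) * (I.card / 2 ^ (ℓ : ℕ)) := by ring
      _ ≤ (1 + ε / 2) * (2 * s) := by gcongr
      _ = _ := by ring
  -- Rows above the level weigh at least `T` each, so their number is at most `M/T`. This controls
  -- the competitors for places in the top set.
  have hG : ((above B Mhat j σ.ζ).card : ℝ) / 2 ^ (ℓ : ℕ) ≤ 8 * (L + 1) * s := by
    have h1 : ((above B Mhat j σ.ζ).card : ℝ) * T ≤ mass g B := by
      have h2 := Finset.card_nsmul_le_sum (above B Mhat j σ.ζ) (fun i => ‖g (B i)‖ ^ 2) T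
        fun i hi => (Finset.mem_filter.1 hi).2
      rw [nsmul_eq_mul] at h2
      exact h2.trans (Finset.sum_le_sum_of_subset_of_nonneg (Finset.subset_univ _)
        fun _ _ _ => sq_nonneg _)
    refine le_of_mul_le_mul_right ?_ hT
    calc ((above B Mhat j σ.ζ).card : ℝ) / 2 ^ (ℓ : ℕ) * T
        = ((above B Mhat j σ.ζ).card : ℝ) * T / 2 ^ (ℓ : ℕ) := by ring
      _ ≤ mass g B / 2 ^ (ℓ : ℕ) := by gcongr
      _ ≤ _ := hMℓ
  obtain ⟨hXI, hXO, hXG⟩ := hsample ℓ ⟨hℓ1, hℓ2,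
    hOd.trans (mul_le_mul_of_nonneg_right (by linarith) (by linarith)), hG⟩
  -- accuracy at this rate
  have hτ : tol g B σ ℓ ≤ rho K ε n / 8 * √T := by
    refine le_mul_sqrt (by positivity) ((htol ℓ).trans ?_)
    calc _ ≤ 100 * (8 * (L + 1) * s * T) * (ε ^ 6 / L ^ 5) := by gcongr
      _ ≤ 100 * (8 * (2 * L) * s * T) * (ε ^ 6 / L ^ 5) := by
          gcongr; linarith
      _ = (1600 * 64 * 10 ^ 10 * ε ^ 2) * ((rho K ε n / 8) ^ 2 * T) := by
          rw [hρd, hs]; field_simp; norm_num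
      _ ≤ 1 * ((rho K ε n / 8) ^ 2 * T) := by
          gcongr
          nlinarith
      _ = _ := one_mul _
  -- The slack `√20 ≥ 4` in the definition of admissibility covers the sampling deviation `2εs` and
  -- the excess `εs` of outer over inner rows.
  refine ⟨ℓ, hMℓ, hτ, ?_, ?_, ?_⟩
  · have h3 := (abs_lt.1 hXI).1
    have h5 : 4 * (ε * s) ≤ √20 * (ε * s) := by gcongr
    have h6 : 0 < ε * s := by positivity
    linarith
  · have h4 := (abs_lt.1 hXO).2
    have h5 : 4 * (ε * s) ≤ √20 * (ε * s) := by gcongr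
    have h6 : 0 < ε * s := by positivity
    linarith
  · have h2 : (((above B Mhat j σ.ζ).filter fun i => σ.keep ℓ i = true).card : ℝ) ≤
        topSize stdConstants K ε n := by
      refine le_trans ?_ htop
      have h3 := (abs_lt.1 hXG).2
      have h4 : 16 * (L + 1) * s ≤ L ^ 3 / ε ^ 3 := by
        rw [hs, ← mul_div_assoc, div_le_div_iff₀ (by positivity) (by positivity)]
        have : 16 * (L + 1) * ε ≤ L := by nlinarith
        calc 16 * (L + 1) * L ^ 2 * ε ^ 3 = (16 * (L + 1) * ε) * (L ^ 2 * ε ^ 2) := by ring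
          _ ≤ L * (L ^ 2 * ε ^ 2) := by gcongr
          _ = _ := by ring
      linarith
    exact_mod_cast h2

/-- The level elements are squeezed between the surviving inner rows and the surviving outer rows.
The bound on the surviving rows above the level keeps the truncation to the top set from cutting any
of them off. -/
theorem Favourable.mem_admissible (hR : Regime K ε B Mhat) (hF : Favourable B Mhat σ)
    {ℓ : Fin (rates n + 1)} (hτ : tol g B σ ℓ ≤ rho K ε n / 8 * √(σ.ζ * Mhat / 2 ^ j))
    (hXI : (1 - √20 * ε) * ((levels K ε n : ℝ) ^ 2 / ε ^ 2) ≤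
      ((inner K ε B Mhat j σ.ζ).filter fun i => σ.keep ℓ i = true).card)
    (hXO : (((outer K ε B Mhat j σ.ζ).filter fun i => σ.keep ℓ i = true).card : ℝ) ≤
      2 * (1 + √20 * ε) * ((levels K ε n : ℝ) ^ 2 / ε ^ 2))
    (hXG : ((above B Mhat j σ.ζ).filter fun i => σ.keep ℓ i = true).card ≤
      topSize stdConstants K ε n) : ℓ ∈ admissible g B Mhat σ j := by
  set T := σ.ζ * Mhat / 2 ^ j with hTd
  set I := inner K ε B Mhat j σ.ζ with hI
  have hΛ : ∀ i, (1 + ε) * T ≤ estimate g B σ ℓ i → i ∈ heavyHitters g B σ ℓ := by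
    intro i hi
    refine mem_topIndices_of_card_le ?_
    have h1 : (Finset.univ.filter fun i' => estimate g B σ ℓ i ≤ estimate g B σ ℓ i') ⊆
        (above B Mhat j σ.ζ).filter fun i => σ.keep ℓ i = true := by
      intro i' hi'
      obtain ⟨h2, h3, -⟩ := hF.mem_above hR hτ (hi.trans (Finset.mem_filter.1 hi').2)
      exact Finset.mem_filter.2 ⟨h3, h2⟩
    exact (Finset.card_le_card h1).trans hXG
  have hlow : (I.filter fun i => σ.keep ℓ i = true) ⊆ levelElements g B Mhat σ j ℓ := by
    intro i hi
    obtain ⟨h1, h2⟩ := Finset.mem_filter.1 hi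
    have h3 := hF.estimate_mem hR hτ h1 h2
    exact Finset.mem_filter.2 ⟨hΛ i h3.1, h3⟩
  have hhigh : levelElements g B Mhat σ j ℓ ⊆
      (outer K ε B Mhat j σ.ζ).filter fun i => σ.keep ℓ i = true := by
    intro i hi
    have h3 := (Finset.mem_filter.1 hi).2
    obtain ⟨h1, -, h2⟩ := hF.mem_above hR hτ h3.1
    exact Finset.mem_filter.2 ⟨h2 h3.2, h1⟩
  rw [mem_admissible_iff]
  have h1 : ((I.filter fun i => σ.keep ℓ i = true).card : ℝ) ≤
    (levelElements g B Mhat σ j ℓ).card := by exact_mod_cast Finset.card_le_card hlow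
  have h2 : ((levelElements g B Mhat σ j ℓ).card : ℝ) ≤
    ((outer K ε B Mhat j σ.ζ).filter fun i => σ.keep ℓ i = true).card := by
    exact_mod_cast Finset.card_le_card hhigh
  exact ⟨hXI.trans h1, h2.trans hXO⟩

/-- The chosen rate `ℓ'` may exceed the good rate `ℓ`, and its structure may be inaccurate. Still,
admissibility gives at least `s/2` elements with estimates at least `T`, and the weight `2^ℓ'` is at
least `2^ℓ`, which is all that the lower bound uses. -/
theorem Favourable.le_levelMass_of_light (hR : Regime K ε B Mhat) (hF : Favourable B Mhat σ)
    (hjL : j ≤ levels K ε n) (hj : lastHeavyLevel K ε n < j)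
    (hmass : mass g B / (2 * ((levels K ε n : ℝ) + 1)) ≤
      ∑ i ∈ inner K ε B Mhat j σ.ζ, ‖g (B i)‖ ^ 2) :
    mass g B / (16 * ((levels K ε n : ℝ) + 1)) ≤ levelMass g B Mhat σ j := by
  have hε := hR.ε_pos; have hε1 := hR.ε_le; have hL := hR.le_L'; have hM := hR.mass_pos
  have hT := hF.scale_pos hR j
  obtain ⟨hq4, hq5⟩ := sqrt_twenty_mem
  obtain ⟨ℓ, hMℓ, hτ, hXI, hXO, hXG⟩ := hF.exists_sample hR hjL hj hmass
  have hadm := hF.mem_admissible hR hτ hXI hXO hXG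
  have hp : (0 : ℝ) < 2 ^ (ℓ : ℕ) := by positivity
  obtain ⟨ℓ', hadm', hch, hle⟩ := exists_chosen_of_admissible hj hadm
  rw [levelMass_of_chosen hch]
  have h1 := (mem_admissible_iff.1 hadm').1
  set T := σ.ζ * Mhat / 2 ^ j with hTd
  set L : ℝ := (levels K ε n : ℝ) with hLd
  set s := L ^ 2 / ε ^ 2 with hs
  have hs0 : 0 < s := by positivity
  change (1 - √20 * ε) * s ≤ _ at h1
  have h2 : ((levelElements g B Mhat σ j ℓ').card : ℝ) * T ≤
      ∑ i ∈ levelElements g B Mhat σ j ℓ', estimate g B σ ℓ' i := by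
    rw [← nsmul_eq_mul]
    refine Finset.card_nsmul_le_sum _ _ _ fun i hi => ?_
    have h3 := (Finset.mem_filter.1 hi).2.1
    exact le_trans (by nlinarith) h3
  have h3 : (2 : ℝ) ^ (ℓ : ℕ) ≤ 2 ^ (ℓ' : ℕ) := pow_le_pow_right₀ (by norm_num) hle
  have h4 : s / 2 ≤ (levelElements g B Mhat σ j ℓ').card := by
    refine le_trans ?_ h1
    have : √20 * ε ≤ 1 / 2 := by nlinarith
    nlinarith
  rw [div_le_iff₀ (by positivity)]
  rw [div_le_iff₀ hp] at hMℓ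
  calc mass g B ≤ 8 * (L + 1) * s * T * 2 ^ (ℓ : ℕ) := hMℓ
    _ = (s / 2 * T * 2 ^ (ℓ : ℕ)) * (16 * (L + 1)) := by ring
    _ ≤ _ := by
        refine mul_le_mul_of_nonneg_right (mul_le_mul ?_ h3 hp.le ?_) (by positivity)
        · exact le_trans (mul_le_mul_of_nonneg_right h4 hT.le) h2
        · exact Finset.sum_nonneg fun i _ => estimate_nonneg i

theorem Favourable.le_sum_levelMass (hR : Regime K ε B Mhat) (hF : Favourable B Mhat σ) :
    mass g B / (32 * K * ((levels K ε n : ℝ) + 1)) ≤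
      ∑ j ∈ Finset.range (levels K ε n + 1), levelMass g B Mhat σ j := by
  obtain ⟨j, hj, hmass⟩ := hF.exists_level hR
  have hjL : j ≤ levels K ε n := by have := Finset.mem_range.1 hj; omega
  rcases le_or_gt j (lastHeavyLevel K ε n) with h | h
  · exact hF.le_sum_levelMass_of_heavy hR hjL h hmass
  · have hL := hR.le_L'; have hM := hR.mass_pos; have hK := hR.one_le_K
    refine le_trans ?_ ((hF.le_levelMass_of_light hR hjL h hmass).trans
      (Finset.single_le_sum (f := fun j => levelMass g B Mhat σ j)
        (fun j _ => levelMass_nonneg) hj))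
    exact div_le_div_of_nonneg_left hM.le (by positivity) (by nlinarith)

/-- A level that is read off a structure that is not accurate for it is negligible. -/
theorem Favourable.levelMass_le (hR : Regime K ε B Mhat) (hF : Favourable B Mhat σ)
    {ℓ : Fin (rates n + 1)} (hc : chosen g B Mhat σ j = some ℓ)
    (hτ : ε * √(σ.ζ * Mhat / 2 ^ j) < tol g B σ ℓ) :
    levelMass g B Mhat σ j ≤ 800 * mass g B * ε ^ 2 / (levels K ε n : ℝ) ^ 3 := by
  have hε := hR.ε_pos; have hε1 := hR.ε_le; have hL := hR.le_L'; have hM := hR.mass_pos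
  have hρ1 := hR.rho_le
  have hT := hF.scale_pos hR j
  obtain ⟨hq4, hq5⟩ := sqrt_twenty_mem
  rcases le_or_gt j (lastHeavyLevel K ε n) with h | h
  · rw [chosen_of_le h] at hc
    rw [← Option.some.inj hc] at hτ
    have h1 := hF.tol_zero_le hR h
    have h2 : rho K ε n / 8 * √(σ.ζ * Mhat / 2 ^ j) ≤ ε * √(σ.ζ * Mhat / 2 ^ j) := by
      gcongr; linarith
    linarith
  · have htol := hF.tol_sq_le hR ℓ
    have hadm := (mem_admissible_iff.1 (mem_admissible_of_chosen h hc)).2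
    rw [levelMass_of_chosen hc]
    set T := σ.ζ * Mhat / 2 ^ j with hTd
    set L : ℝ := (levels K ε n : ℝ) with hLd
    have h1 : ε ^ 2 * T ≤ 100 * (mass g B / 2 ^ (ℓ : ℕ)) * (ε ^ 6 / L ^ 5) := by
      refine le_trans ?_ htol
      have := pow_le_pow_left₀ (by positivity) hτ.le 2
      rwa [mul_pow, Real.sq_sqrt hT.le] at this
    have hp : (0 : ℝ) < 2 ^ (ℓ : ℕ) := by positivity
    have h2 : T * 2 ^ (ℓ : ℕ) ≤ 100 * mass g B * (ε ^ 4 / L ^ 5) := by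
      refine le_of_mul_le_mul_left ?_ (by positivity : 0 < ε ^ 2)
      calc ε ^ 2 * (T * 2 ^ (ℓ : ℕ)) = (ε ^ 2 * T) * 2 ^ (ℓ : ℕ) := by ring
        _ ≤ 100 * (mass g B / 2 ^ (ℓ : ℕ)) * (ε ^ 6 / L ^ 5) * 2 ^ (ℓ : ℕ) := by gcongr
        _ = _ := by field_simp
    have h3 : ∑ i ∈ levelElements g B Mhat σ j ℓ, estimate g B σ ℓ i ≤
        (levelElements g B Mhat σ j ℓ).card * (2 * T) := by
      rw [← nsmul_eq_mul]
      refine Finset.sum_le_card_nsmul _ _ _ fun i hi => ?_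
      have h3 := (Finset.mem_filter.1 hi).2.2
      exact h3.trans (by nlinarith)
    have h4 : ((levelElements g B Mhat σ j ℓ).card : ℝ) ≤ 4 * (L ^ 2 / ε ^ 2) := by
      refine hadm.trans ?_
      gcongr
      nlinarith
    calc _ ≤ (4 * (L ^ 2 / ε ^ 2) * (2 * T)) * 2 ^ (ℓ : ℕ) := by
          gcongr
          exact h3.trans (by gcongr)
      _ = 8 * (L ^ 2 / ε ^ 2) * (T * 2 ^ (ℓ : ℕ)) := by ring
      _ ≤ 8 * (L ^ 2 / ε ^ 2) * (100 * mass g B * (ε ^ 4 / L ^ 5)) := by gcongr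
      _ = _ := by field_simp; norm_num

end

end HSketch

namespace HSketch

/-! ### Most seeds are favourable -/

section Probability

variable {Ω : Type*} [MeasurableSpace Ω] {μ : Measure Ω} [IsProbabilityMeasure μ]
  {n d : ℕ} {K ε Mhat : ℝ} {B : Matrix (Fin n) (Fin (d + 1)) ℝ} {S : Ω → Seed stdConstants K ε n}

/-- With `N = (L̂ + 1)n`, the number of repetitions is at least `8 log(2N)`, so `4^R ≥ e^R ≥ (2N)^8
≥ 100N`. This pays for the union bound over all structures and queries. -/
theorem le_reps (hn : 0 < n) :
    0 < reps stdConstants n ∧ 100 * ((rates n + 1 : ℕ) * n : ℝ) ≤ 4 ^ reps stdConstants n := by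
  have hn' : (1 : ℝ) ≤ n := by exact_mod_cast hn
  have hr : (0 : ℝ) ≤ rates n := Nat.cast_nonneg _
  set N : ℝ := (rates n + 1 : ℕ) * n with hN
  have hN1 : 1 ≤ N := by rw [hN]; push_cast; nlinarith
  have h1 : 2 * (n : ℝ) / (1 / ((rates n : ℝ) + 1)) = 2 * N := by
    rw [hN]; push_cast; field_simp
  have hlog : 0 < Real.log (2 * N) := Real.log_pos (by linarith)
  have h2 : 8 * Real.log (2 * N) ≤ reps stdConstants n := by
    unfold reps
    rw [h1]
    exact Nat.le_ceil _
  have h3 : (0 : ℝ) < reps stdConstants n := by linarith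
  refine ⟨by exact_mod_cast h3, ?_⟩
  calc 100 * N ≤ (2 * N) ^ 8 := by
        have : N ≤ N ^ 8 := le_self_pow₀ hN1 (by norm_num)
        rw [mul_pow]; linarith
    _ = Real.exp (8 * Real.log (2 * N)) := by
        rw [mul_comm 8, Real.exp_mul, Real.exp_log (by linarith)]; norm_cast
    _ ≤ Real.exp (reps stdConstants n) := Real.exp_le_exp.2 h2
    _ = Real.exp 1 ^ reps stdConstants n := by rw [← Real.exp_nat_mul, mul_one]
    _ ≤ 4 ^ reps stdConstants n := by
        gcongr
        linarith [Real.exp_one_lt_d9]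

theorem measure_not_accurate_le (hS : IsRandomSeed μ S) (hn : 0 < n) :
    μ {ω | ∃ ℓ i, tol g B (S ω) ℓ <
      |‖g (answer g B (S ω) ℓ i)‖ - ‖g (downsample B (S ω) ℓ i)‖|} ≤ 100⁻¹ := by
  obtain ⟨h0, h1⟩ := le_reps hn
  rw [Set.ofPred_exists]
  refine (measure_iUnion_fintype_le _ _).trans
    ((Finset.sum_le_sum fun ℓ _ => measure_answer_le hS h0 B ℓ).trans ?_)
  rw [Finset.sum_const, Finset.card_univ, Fintype.card_fin, nsmul_eq_mul, ← mul_assoc,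
    ← ENNReal.inv_pow, ENNReal.le_inv_iff_mul_le, mul_right_comm, ← div_eq_mul_inv]
  refine ENNReal.div_le_of_le_mul ?_
  rw [one_mul, mul_comm]
  have h2 : ((100 * ((rates n + 1) * n) : ℕ) : ℝ) ≤ ((4 ^ reps stdConstants n : ℕ) : ℝ) := by
    push_cast; push_cast at h1; exact h1
  exact_mod_cast Nat.cast_le.1 h2

theorem measure_keep_zero (hS : IsRandomSeed μ S) :
    μ {ω | ∃ i, (S ω).keep 0 i ≠ true} = 0 := by
  rw [Set.ofPred_exists]
  refine measure_iUnion_null fun i => ?_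
  have h1 := hS.keep_prob 0 i
  simp only [Fin.val_zero, pow_zero] at h1
  exact (prob_compl_eq_zero_iff (measurableSet_keep hS 0 i)).2 h1

/-- The estimates are random but do not involve the shift, which is independent of the sketch. They
can be frozen, and the bound for fixed numbers applies. -/
theorem measure_top_gap_le (hS : IsRandomSeed μ S) (hR : Regime K ε B Mhat) :
    μ {ω | 1 / 2 * ∑ i, topEstimates B (S ω) i <
      stripMass (2 - ε) (2 * (1 + ε)) Mhat (levels K ε n + 1) (topEstimates B (S ω)) (S ω).ζ} ≤
      ENNReal.ofReal (4 * (2 * (1 + ε) - (2 - ε)) / (1 / 2)) := by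
  have hε := hR.ε_pos; have hε1 := hR.ε_le
  set x : (Fin (rates n + 1) → Fin n → Bool) ×
      ((ℓ : Fin (rates n + 1)) → Fin (reps stdConstants n) → Fin n →
        Fin (width stdConstants K ε n ℓ)) ×
      (Fin (rates n + 1) → Fin (reps stdConstants n) → Fin n → ℤˣ) → Fin n → ℝ := fun y =>
    topEstimates B (⟨y.1, y.2.1, y.2.2, 0⟩ : Seed stdConstants K ε n) with hx
  have hx0 : ∀ y i, 0 ≤ x y i := fun y i => by
    simp only [hx, topEstimates]
    split_ifs <;> [exact estimate_nonneg i; exact le_rfl]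
  have hYm : Measurable fun ω => ((S ω).keep, (S ω).hash, (S ω).sign) :=
    (measurable_pi_iff.2 hS.measurable_keep).prodMk
      ((measurable_pi_iff.2 fun ℓ => measurable_pi_iff.2 (hS.measurable_hash ℓ)).prodMk
        (measurable_pi_iff.2 fun ℓ => measurable_pi_iff.2 (hS.measurable_sign ℓ)))
  exact measure_le_of_indepFun hYm hS.ζ_indep.symm
    (fun y => {z | 1 / 2 * ∑ i, x y i <
      stripMass (2 - ε) (2 * (1 + ε)) Mhat (levels K ε n + 1) (x y) z})
    (fun y => measurableSet_lt measurable_const (measurable_stripMass _ _ _ _ _))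
    fun y => measure_stripMass_le hS.measurable_ζ hS.ζ_uniform (by linarith) (by linarith)
      hR.Mhat_pos (hx0 y) (by norm_num) _

theorem measurableSet_inner (j : ℕ) (i : Fin n) :
    MeasurableSet {z | i ∈ inner K ε B Mhat j z} := by
  simp only [inner, Finset.mem_filter, Finset.mem_univ, true_and]
  exact measurableSet_strip ((1 + ε) * (1 + rho K ε n)) ((2 - ε) * (1 - rho K ε n)) Mhat j _

theorem measurableSet_outer (j : ℕ) (i : Fin n) :
    MeasurableSet {z | i ∈ outer K ε B Mhat j z} := by
  simp only [outer, Finset.mem_filter, Finset.mem_univ, true_and]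
  exact measurableSet_strip ((1 + ε) * (1 - rho K ε n)) ((2 - ε) * (1 + rho K ε n)) Mhat j _

theorem measurableSet_above (j : ℕ) (i : Fin n) :
    MeasurableSet {z | i ∈ above B Mhat j z} := by
  simp only [above, Finset.mem_filter, Finset.mem_univ, true_and]
  exact measurableSet_le (by fun_prop) measurable_const

theorem ofReal_le_hundredth {x : ℝ} (h : x ≤ 1 / 100) : ENNReal.ofReal x ≤ 100⁻¹ := by
  refine (ENNReal.ofReal_le_ofReal h).trans_eq ?_
  rw [one_div, ENNReal.ofReal_inv_of_pos (by norm_num)]; norm_num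

theorem measure_sum_sample_le (hS : IsRandomSeed μ S) (hR : Regime K ε B Mhat) :
    μ {ω | ∃ j ∈ Finset.range (levels K ε n + 1), ∃ ℓ : Fin (rates n + 1),
      ((levels K ε n : ℝ) ^ 2 / ε ^ 2 ≤ (inner K ε B Mhat j (S ω).ζ).card / 2 ^ (ℓ : ℕ) ∧
        ((inner K ε B Mhat j (S ω).ζ).card : ℝ) / 2 ^ (ℓ : ℕ) <
          2 * ((levels K ε n : ℝ) ^ 2 / ε ^ 2) ∧
        ((outer K ε B Mhat j (S ω).ζ).card : ℝ) / 2 ^ (ℓ : ℕ) ≤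
          3 * ((levels K ε n : ℝ) ^ 2 / ε ^ 2) ∧
        ((above B Mhat j (S ω).ζ).card : ℝ) / 2 ^ (ℓ : ℕ) ≤
          8 * ((levels K ε n : ℝ) + 1) * ((levels K ε n : ℝ) ^ 2 / ε ^ 2)) ∧
      (2 * ε * ((levels K ε n : ℝ) ^ 2 / ε ^ 2) ≤
          |(((inner K ε B Mhat j (S ω).ζ).filter fun i => (S ω).keep ℓ i = true).card : ℝ) -
            (inner K ε B Mhat j (S ω).ζ).card / 2 ^ (ℓ : ℕ)| ∨
        2 * ε * ((levels K ε n : ℝ) ^ 2 / ε ^ 2) ≤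
          |(((outer K ε B Mhat j (S ω).ζ).filter fun i => (S ω).keep ℓ i = true).card : ℝ) -
            (outer K ε B Mhat j (S ω).ζ).card / 2 ^ (ℓ : ℕ)| ∨
        8 * ((levels K ε n : ℝ) + 1) * ((levels K ε n : ℝ) ^ 2 / ε ^ 2) ≤
          |(((above B Mhat j (S ω).ζ).filter fun i => (S ω).keep ℓ i = true).card : ℝ) -
            (above B Mhat j (S ω).ζ).card / 2 ^ (ℓ : ℕ)|)} ≤ 100⁻¹ := by
  have hε := hR.ε_pos; have hε1 := hR.ε_le; have hL := hR.le_L'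
  set s := (levels K ε n : ℝ) ^ 2 / ε ^ 2 with hs
  have hs0 : 0 < s := by positivity
  have hj := fun j : ℕ => measure_sample_le hS
    (measurableSet_inner (K := K) (ε := ε) (B := B) (Mhat := Mhat) j)
    (measurableSet_outer (K := K) (ε := ε) (B := B) (Mhat := Mhat) j)
    (measurableSet_above (B := B) (Mhat := Mhat) j) hs0
    (by positivity : 0 < 2 * ε * s) (by positivity : 0 < 8 * ((levels K ε n : ℝ) + 1) * s)
  refine (measure_mono ?_).trans ((measure_biUnion_finset_le
    (Finset.range (levels K ε n + 1)) _).trans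
    ((Finset.sum_le_sum fun j _ => hj j).trans ?_))
  · rintro ω ⟨j, hjN, h⟩
    exact Set.mem_biUnion hjN h
  · rw [Finset.sum_const, Finset.card_range, nsmul_eq_mul, ← ENNReal.ofReal_natCast,
      ← ENNReal.ofReal_mul (by positivity)]
    refine ofReal_le_hundredth ?_
    -- Each level fails with probability `O(1/L²)`, since `5s/(2εs)² = 5/(4L²)` and `s ≥ L²`. The `L
    -- + 1` levels together give at most `11/(4L)`, and `L ≥ 500`.
    push_cast
    set L : ℝ := (levels K ε n : ℝ) with hLd
    have hs1 : L ^ 2 ≤ s := by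
      rw [hs, le_div_iff₀ (by positivity)]
      exact mul_le_of_le_one_right (by positivity) (pow_le_one₀ hε.le (by linarith))
    have e1 : 5 * s / (2 * ε * s) ^ 2 = 5 / (4 * L ^ 2) := by
      have : ε ^ 2 * s = L ^ 2 := by rw [hs]; field_simp
      have h4 : (2 * ε * s) ^ 2 = 4 * L ^ 2 * s := by rw [← this]; ring
      rw [h4, mul_div_mul_right _ _ hs0.ne']
    have e2 : 1 / (8 * (L + 1) * s) ≤ 1 / (8 * L ^ 2) := by
      refine one_div_le_one_div_of_le (by positivity) ?_
      nlinarith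
    calc (L + 1) * (5 * s / (2 * ε * s) ^ 2 + 1 / (8 * (L + 1) * s))
        ≤ (2 * L) * (5 / (4 * L ^ 2) + 1 / (8 * L ^ 2)) := by
          rw [e1]; gcongr; linarith
      _ = 11 / (4 * L) := by field_simp; norm_num
      _ ≤ 1 / 100 := by
          rw [div_le_div_iff₀ (by positivity) (by norm_num)]; linarith

theorem measure_not_favourable_le (hS : IsRandomSeed μ S) (hR : Regime K ε B Mhat) :
    μ {ω | ¬ Favourable B Mhat (S ω)} ≤ 7 * 100⁻¹ := by
  have hε := hR.ε_pos; have hε1 := hR.ε_le; have hL := hR.le_L'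
  have hρ := hR.rho_pos; have hρ1 := hR.rho_le
  have hρd : rho K ε n = ε / (10 ^ 5 * levels K ε n) := rfl
  have hx0 : ∀ i, 0 ≤ ‖g (B i)‖ ^ 2 := fun i => sq_nonneg _
  have hη : 0 < ε / (16 * ((levels K ε n : ℝ) + 1)) := by positivity
  -- The factor `10^5` in `rho` makes the strips so thin that their expected mass is far below the
  -- mass allowed to them.
  have hratio : rho K ε n / (ε / (16 * ((levels K ε n : ℝ) + 1))) ≤ 32 / 10 ^ 5 := by
    rw [hρd, div_div_div_eq, div_le_div_iff₀ (by positivity) (by norm_num)]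
    nlinarith
  have b0 := ae_uniform_mem hS.measurable_ζ hS.ζ_uniform
  have b1 := measure_keep_zero hS
  have b2 := measure_not_accurate_le (B := B) hS hR.n_pos
  have b3 := measure_mass_downsample_le hS B
  have b4 := (measure_stripMass_le hS.measurable_ζ hS.ζ_uniform
    (α := (2 - ε) * (1 - rho K ε n)) (β := 2 * ((1 + ε) * (1 + rho K ε n)))
    (by nlinarith) (by nlinarith) hR.Mhat_pos hx0 (by norm_num : (0 : ℝ) < 1 / 4)
    (levels K ε n + 1)).trans (ofReal_le_hundredth (by nlinarith))
  have b5 := (measure_stripMass_le hS.measurable_ζ hS.ζ_uniform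
    (α := (1 + ε) * (1 - rho K ε n)) (β := (1 + ε) * (1 + rho K ε n))
    (by nlinarith) (by nlinarith) hR.Mhat_pos hx0 hη
    (levels K ε n + 1)).trans (ofReal_le_hundredth (by
      have : 4 * ((1 + ε) * (1 + rho K ε n) - (1 + ε) * (1 - rho K ε n)) /
          (ε / (16 * ((levels K ε n : ℝ) + 1))) =
          8 * (1 + ε) * (rho K ε n / (ε / (16 * ((levels K ε n : ℝ) + 1)))) := by ring
      rw [this]
      nlinarith))
  have b6 := (measure_stripMass_le hS.measurable_ζ hS.ζ_uniform
    (α := (2 - ε) * (1 - rho K ε n)) (β := (2 - ε) * (1 + rho K ε n))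
    (by nlinarith) (by nlinarith) hR.Mhat_pos hx0 hη
    (levels K ε n + 1)).trans (ofReal_le_hundredth (by
      have : 4 * ((2 - ε) * (1 + rho K ε n) - (2 - ε) * (1 - rho K ε n)) /
          (ε / (16 * ((levels K ε n : ℝ) + 1))) =
          8 * (2 - ε) * (rho K ε n / (ε / (16 * ((levels K ε n : ℝ) + 1)))) := by ring
      rw [this]
      nlinarith))
  have b7 := (measure_top_gap_le hS hR).trans (ofReal_le_hundredth (by linarith))
  have b8 := measure_sum_sample_le hS hR
  refine (measure_mono ?_).trans ((measure_union_le_add b0.le (measure_union_le_add b1.le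
    (measure_union_le_add b2 (measure_union_le_add b3 (measure_union_le_add b4
    (measure_union_le_add b5 (measure_union_le_add b6 (measure_union_le_add b7 b8)))))))).trans_eq ?_)
  · intro ω hω
    by_contra hc
    simp only [Set.mem_union, not_or] at hc
    obtain ⟨c0, c1, c2, c3, c4, c5, c6, c7, c8⟩ := hc
    refine hω ⟨not_not.1 c0, fun i => ?_, fun ℓ i => ?_, fun ℓ => ?_, not_lt.1 c4, not_lt.1 c5,
      not_lt.1 c6, not_lt.1 c7, fun j hj ℓ h => ?_⟩
    · by_contra h; exact c1 ⟨i, h⟩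
    · by_contra h; exact c2 ⟨ℓ, i, not_le.1 h⟩
    · by_contra h; exact c3 ⟨ℓ, not_le.1 h⟩
    · refine ⟨?_, ?_, ?_⟩ <;> by_contra h'
      · exact c8 ⟨j, hj, ℓ, h, Or.inl (not_lt.1 h')⟩
      · exact c8 ⟨j, hj, ℓ, h, Or.inr (Or.inl (not_lt.1 h'))⟩
      · exact c8 ⟨j, hj, ℓ, h, Or.inr (Or.inr (not_lt.1 h'))⟩
  · ring

end Probability

end HSketch

namespace HSketch

/-! ### The final sampling step -/

section Pick

variable {α : Type} [Fintype α] {wt : α → ℝ}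

theorem pick_some (h : ∑ a, ENNReal.ofReal (wt a) ≠ 0) (a : α) :
    pick wt (some a) = ENNReal.ofReal (wt a) * (∑ a, ENNReal.ofReal (wt a))⁻¹ := by
  classical
  rw [pick, dif_neg h, PMF.map_apply, tsum_eq_single a]
  · simp [PMF.normalize_apply]
  · intro b hb
    simp [hb.symm]

theorem mem_support_pick (h : ∑ a, ENNReal.ofReal (wt a) ≠ 0) {x : Option α}
    (hx : x ∈ (pick wt).support) : ∃ a, x = some a ∧ 0 < wt a := by
  have hx' := hx
  rw [pick, dif_neg h, PMF.mem_support_map_iff] at hx'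
  obtain ⟨a, -, rfl⟩ := hx'
  refine ⟨a, rfl, ?_⟩
  rw [PMF.mem_support_iff, pick_some h] at hx
  exact ENNReal.ofReal_pos.1 (pos_iff_ne_zero.2 (left_ne_zero_of_mul hx))

/-- If the weights of the `a` after which `s` is not certain are negligible, then `s` is likely. -/
theorem le_bind_pick {β : Type*} (hwt : ∀ a, 0 ≤ wt a) (F : Option α → PMF β) (s : Set β)
    {γ q : ℝ} (hF : ∀ a, wt a ≤ γ ∨ (F (some a)).toOuterMeasure s = 1)
    (hpos : 0 < ∑ a, wt a) (hγ : 0 ≤ γ) (hq : Fintype.card α * γ ≤ q * ∑ a, wt a) :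
    ENNReal.ofReal (1 - q) ≤ ((pick wt).bind F).toOuterMeasure s := by
  classical
  set W := ∑ a, wt a with hW
  have hsum : ∑ a, ENNReal.ofReal (wt a) = ENNReal.ofReal W :=
    (ENNReal.ofReal_sum_of_nonneg fun a _ => hwt a).symm
  have hne : ∑ a, ENNReal.ofReal (wt a) ≠ 0 := by
    rw [hsum]; exact (ENNReal.ofReal_pos.2 hpos).ne'
  rw [PMF.toOuterMeasure_bind_apply]
  set G : Finset α := Finset.univ.filter fun a => (F (some a)).toOuterMeasure s = 1 with hG
  have hmass : (1 - q) * W ≤ ∑ a ∈ G, wt a := by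
    have h1 := Finset.sum_filter_add_sum_filter_not Finset.univ
      (fun a => (F (some a)).toOuterMeasure s = 1) wt
    have h2 : ∑ a with ¬ (F (some a)).toOuterMeasure s = 1, wt a ≤ Fintype.card α * γ := by
      refine (Finset.sum_le_card_nsmul _ _ γ fun a ha => ?_).trans ?_
      · exact (hF a).resolve_right (Finset.mem_filter.1 ha).2
      · rw [nsmul_eq_mul]
        gcongr
        exact Finset.card_le_univ _
    linarith
  calc ENNReal.ofReal (1 - q) = ENNReal.ofReal ((1 - q) * W) * (ENNReal.ofReal W)⁻¹ := by
        rw [ENNReal.ofReal_mul' hpos.le, mul_assoc, ENNReal.mul_inv_cancel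
          (ENNReal.ofReal_pos.2 hpos).ne' ENNReal.ofReal_ne_top, mul_one]
    _ ≤ ENNReal.ofReal (∑ a ∈ G, wt a) * (ENNReal.ofReal W)⁻¹ := by gcongr
    _ = ∑ a ∈ G, pick wt (some a) * (F (some a)).toOuterMeasure s := by
        rw [ENNReal.ofReal_sum_of_nonneg fun a _ => hwt a, Finset.sum_mul]
        refine Finset.sum_congr rfl fun a ha => ?_
        rw [pick_some hne, hsum, (Finset.mem_filter.1 ha).2, mul_one]
    _ = ∑ x ∈ G.map Function.Embedding.some, pick wt x * (F x).toOuterMeasure s := by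
        rw [Finset.sum_map]; rfl
    _ ≤ _ := ENNReal.sum_le_tsum _

end Pick

theorem Favourable.le_output {n d : ℕ} {K ε Mhat : ℝ} {B : Matrix (Fin n) (Fin (d + 1)) ℝ}
    {σ : Seed stdConstants K ε n} (hR : Regime K ε B Mhat) (hF : Favourable B Mhat σ)
    (P : (Fin (d + 1) → ℝ) → Prop)
    (hP : ∀ v, (∃ u, (1 - 3 * ε) * ‖g (B u)‖ ^ 2 ≤ ‖g v‖ ^ 2 ∧
      ‖g v‖ ^ 2 ≤ (1 + 3 * ε) * ‖g (B u)‖ ^ 2) → P v) :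
    ENNReal.ofReal (1 - 1 / 100) ≤
      (output g B Mhat σ).toOuterMeasure {v? | ∃ v, v? = some v ∧ P v} := by
  have hε := hR.ε_pos; have hε1 := hR.ε_le; have hL := hR.le_L'; have hM := hR.mass_pos
  have hK := hR.one_le_K; have hKε := hR.Kε_le
  have htot := hF.le_sum_levelMass hR
  rw [Finset.sum_range] at htot
  -- A level without a structure, or with an inaccurate one, has mass at most `γ`. A level of
  -- positive mass with an accurate structure returns a good vector with certainty.
  refine le_bind_pick (γ := 800 * mass g B * ε ^ 2 / (levels K ε n : ℝ) ^ 3)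
    (fun j => levelMass_nonneg) _ _ (fun j => ?_)
    (lt_of_lt_of_le (by positivity) htot) (by positivity) ?_
  · rcases h : chosen g B Mhat σ j with _ | ℓ
    · left
      rw [levelMass_of_chosen_none h]
      positivity
    · rcases lt_or_ge (ε * √(σ.ζ * Mhat / 2 ^ (j : ℕ))) (tol g B σ ℓ) with hτ | hτ
      · exact Or.inl (hF.levelMass_le hR h hτ)
      · rcases (levelMass_nonneg (T := g) (A := B) (Mhat := Mhat) (σ := σ)
          (j := (j : ℕ))).eq_or_lt with h0 | h0
        · left; rw [← h0]; positivity
        right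
        rw [PMF.toOuterMeasure_apply_eq_one_iff]
        simp only [h]
        intro x hx
        rw [PMF.mem_support_map_iff] at hx
        obtain ⟨y, hy, rfl⟩ := hx
        rw [levelMass_of_chosen h] at h0
        have hpos := pos_of_mul_pos_left h0 (by positivity)
        have hne : ∑ i, ENNReal.ofReal (if i ∈ levelElements g B Mhat σ j ℓ
            then estimate g B σ ℓ i else 0) ≠ 0 := by
          rw [← ENNReal.ofReal_sum_of_nonneg fun i _ => by
            split_ifs <;> [exact estimate_nonneg i; exact le_rfl]]
          simpa using hpos
        obtain ⟨i, rfl, hi⟩ := mem_support_pick hne hy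
        have hi' : i ∈ levelElements g B Mhat σ j ℓ := by
          by_contra hc; simp [hc] at hi
        exact ⟨answer g B σ ℓ i, rfl, hP _ ⟨i, estimate_approx hR hF hτ hi'⟩⟩
  · refine le_trans ?_ (mul_le_mul_of_nonneg_left htot (by norm_num))
    rw [Fintype.card_fin]
    push_cast
    set L : ℝ := (levels K ε n : ℝ) with hLd
    rw [← mul_div_assoc, ← mul_div_assoc, div_le_div_iff₀ (by positivity) (by positivity)]
    -- All `L + 1` levels at the bound `γ` weigh `O(Mε²/L²)`, against a total of order `M/(KL)`. The
    -- smallness of `Kε` and `L ≥ 500` bring the ratio below `1/100`.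
    have h1 : 800 * ε * (K * ε) ≤ 1 / 10 ^ 10 := by nlinarith
    calc (L + 1) * (800 * mass g B * ε ^ 2) * (32 * K * (L + 1))
        = mass g B * (32 * (800 * ε * (K * ε)) * (L + 1) ^ 2) := by ring
      _ ≤ mass g B * (32 * (1 / 10 ^ 10) * (2 * L) ^ 2) := by gcongr; linarith
      _ ≤ mass g B * (1 / 100 * L ^ 3) := by
          refine mul_le_mul_of_nonneg_left ?_ hM.le
          have : 500 * L ^ 2 ≤ L ^ 3 := by
            rw [pow_succ L 2, mul_comm]; gcongr
          linarith [sq_nonneg L]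
      _ = _ := by ring

end HSketch

namespace HSketch

/-! ### The choice of `ε₀` and the conclusion -/

theorem regime_of_le {n d : ℕ} {K ε Mhat : ℝ} {A : Matrix (Fin n) (Fin d) ℝ} {b : Fin n → ℝ}
    (hK : 1 ≤ K) (hε : 0 < ε) (hε1 : ε ≤ (1 / 2) ^ 500 / K) (hAb : A ≠ 0 ∨ b ≠ 0)
    (h1 : mass g (concat A b) ≤ Mhat) (h2 : Mhat ≤ K * mass g (concat A b)) :
    Regime K ε (concat A b) Mhat := by
  have hK0 : 0 < K := by linarith
  have hpos := HSketch.mass_pos hAb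
  have hn : 0 < n := by
    rcases Nat.eq_zero_or_pos n with rfl | h
    · simp [mass] at hpos
    · exact h
  have hKε : K * ε ≤ (1 / 2) ^ 500 := by
    rw [le_div_iff₀ hK0] at hε1; linarith
  have hε2 : ε ≤ (1 / 2) ^ 500 := le_trans (by nlinarith) hKε
  have h50 : ((1 : ℝ) / 2) ^ 500 ≤ (1 / 2) ^ 50 :=
    pow_le_pow_of_le_one (by norm_num) (by norm_num) (by norm_num)
  refine ⟨hK, hε, hKε.trans (h50.trans (by norm_num)), hn, le_levels hK hε hε2 hn,
    rates_add_one_le_levels hK hε (hε2.trans (h50.trans (by norm_num))) hn, hpos, h1, h2⟩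

end HSketch

theorem mainTheorem7 :
    ∃ (c : HSketch.Constants) (C : ℝ), 0 < C ∧
      ∀ K : ℝ, 1 ≤ K → ∃ ε₀ : ℝ, 0 < ε₀ ∧ ∀ ε : ℝ, 0 < ε → ε ≤ ε₀ →
        ∀ (n d : ℕ) (A : Matrix (Fin n) (Fin d) ℝ) (b : Fin n → ℝ), (A ≠ 0 ∨ b ≠ 0) →
        ∀ Mhat : ℝ, HSketch.mass HSketch.g (HSketch.concat A b) ≤ Mhat →
          Mhat ≤ K * HSketch.mass HSketch.g (HSketch.concat A b) →
        ∀ (Ω : Type*) [MeasurableSpace Ω] (μ : Measure Ω) [IsProbabilityMeasure μ]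
          (S : Ω → HSketch.Seed c K ε n), HSketch.IsRandomSeed μ S →
          9 / 10 ≤ HSketch.successProb HSketch.g (HSketch.concat A b) Mhat μ S fun H =>
            ∃ u : Fin n,
              (1 - C * ε) * (‖HSketch.fVec (A u)‖ ^ 2 + |b u| ^ 2) ≤ ‖HSketch.g H‖ ^ 2 ∧
              ‖HSketch.g H‖ ^ 2 ≤ (1 + C * ε) * (‖HSketch.fVec (A u)‖ ^ 2 + |b u| ^ 2) := by
  -- This `ε₀` forces both `L ≥ 500` and `Kε ≤ 10⁻¹⁵`.
  refine ⟨HSketch.stdConstants, 3, by norm_num, fun K hK => ⟨(1 / 2) ^ 500 / K, ?_, ?_⟩⟩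
  · have : 0 < K := by linarith
    positivity
  intro ε hε hε1 n d A b hAb Mhat h1 h2 Ω _ μ _ S hS
  have hR := HSketch.regime_of_le hK hε hε1 hAb h1 h2
  refine le_trans ?_ (HSketch.mul_le_lintegral_of_measure_compl_le
    (HSketch.measure_not_favourable_le hS hR) fun ω hω => hω.le_output hR _ ?_)
  -- The final sampling succeeds with probability `0.99` on favourable seeds, which have probability
  -- at least `0.93`; the product exceeds `0.9`.
  · rw [← ENNReal.ofReal_one, ← ENNReal.ofReal_ofNat 7, ← ENNReal.ofReal_ofNat 9,
      ← ENNReal.ofReal_ofNat 10, ← ENNReal.ofReal_ofNat 100,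
      ← ENNReal.ofReal_div_of_pos (by norm_num), ← ENNReal.ofReal_inv_of_pos (by norm_num),
      ← ENNReal.ofReal_mul (by norm_num), ← ENNReal.ofReal_sub _ (by norm_num),
      ← ENNReal.ofReal_mul (by norm_num)]
    exact ENNReal.ofReal_le_ofReal (by norm_num)
  · rintro v ⟨u, hu1, hu2⟩
    rw [HSketch.norm_g_concat_sq] at hu1 hu2
    exact ⟨u, hu1, hu2⟩
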